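/- Let $n\ge 0$ be an integer and $\varepsilon>0$. There is a constant $C=C(n,\varepsilon)$, depending only on $n$ and $\varepsilon$, such that the following holds for every smooth immersion $f:\Sigma^n\to\mathbb R^m$ ($m$ arbitrary) of an $n$-dimensional smooth manifold $\Sigma$ without boundary (Hausdorff, second countable) whose normal bundle is flat, i.e. the curvature $R^\perp(X,Y)\zeta=\nabla^\perp_X\nabla^\perp_Y\zeta-\nabla^\perp_Y\nabla^\perp_X\zeta-\nabla^\perp_{[X,Y]}\zeta$ of the normal connection $\nabla^\perp_X\eta=(D_X\eta)^\perp$ vanishes. Give $\Sigma$ the induced metric, with Levi-Civita connection $\nabla$, Laplace-Beltrami operator $\Delta$ and Riemannian measure $\mu$. In orthonormal frames $e_i$ ($1\le i\le n$) of the tangent bundle and $e_\alpha$ ($n+1\le\alpha\le m$) of the normal bundle let $h_{\alpha ij}=\langle (D_{e_i}e_j)^\perp,e_\alpha\rangle$ be the components of the second fundamental form $A$, let $H=H_\alpha e_\alpha$ with $H_\alpha=h_{\alpha ii}$ be the mean curvature vector, let $\nabla_iH_\alpha$ and $\nabla_i\nabla_jH_\alpha$ be the components of its first and second covariant derivatives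 with respect to $\nabla^\perp$ and $\nabla$, and let $|A|^2=\sum h_{\alpha ij}^2$, $|\nabla H|^2=\sum(\nabla_iH_\alpha)^2$ (repeated indices are summed). Then the inequality $$\tfrac12\Delta|A|^2\ \ge\ \Bigl(1+\frac{2}{n+\varepsilon}\Bigr)\bigl|\nabla|A|\bigr|^2+h_{\alpha ij}\nabla_i\nabla_jH_\alpha+H_\alpha h_{\alpha ij}h_{\beta jk}h_{\beta ki}-|A|^4-C(n,\varepsilon)|\nabla H|^2$$ holds pointwise at all points where $|A|\ne0$, and it holds on all of $\Sigma$ in the weak sense: $|A|\in W^{1,\infty}_{loc}(\Sigma)$, and if $\nabla|A|$ denotes the weak gradient of $|A|$, then for all $\varphi\in C_c^\infty(\Sigma)$ with $\varphi\ge0$ the integrals below exist and $$-\tfrac12\int_\Sigma\langle\nabla|A|^2,\nabla\varphi\rangle\,d\mu\ \ge\ \int_\Sigma\Bigl[\Bigl(1+\frac{2}{n+\varepsilon}\Bigr)\bigl|\nabla|A|\bigr|^2+h_{\alpha ij}\nabla_i\nabla_jH_\alpha+H_\alpha h_{\alpha ij}h_{\beta jk}h_{\beta ki}-|A|^4-C(n,\varepsilon)|\nabla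 H|^2\Bigr]\varphi\,d\mu .$$ -/

import Mathlib

open scoped Manifold ContDiff
open MeasureTheory

noncomputable section

namespace FlatNormal

variable (n : ℕ) {m : ℕ} {M : Type*} [TopologicalSpace M] [ChartedSpace (EuclideanSpace ℝ (Fin n)) M]

/-! Smooth immersions `f : M → ℝ^m`. As usual, a tangent vector `ξ ∈ T_p M` is identified with
`df_p ξ ∈ ℝ^m`; so tangent fields and normal fields are maps `M → ℝ^m`. -/

/-- The differential `du_p : T_p M → V` of a map `u` from `M` to a normed space `V`
(the model space `ℝ^n` is Mathlib's `T_p M`). -/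
def differential {V : Type*} [NormedAddCommGroup V] [NormedSpace ℝ V] (u : M → V) (p : M) :
    EuclideanSpace ℝ (Fin n) →L[ℝ] V :=
  mfderiv (𝓡 n) 𝓘(ℝ, V) u p

/-- `f` is a smooth immersion: it is smooth and all its differentials are injective. -/
def IsSmoothImmersion (f : M → EuclideanSpace ℝ (Fin m)) : Prop :=
  ContMDiff (𝓡 n) (𝓡 m) ∞ f ∧ ∀ p, Function.Injective (differential n f p)

/-- The tangent space at `p`, as the subspace `df_p (T_p M)` of `ℝ^m`. -/
def tangent (f : M → EuclideanSpace ℝ (Fin m)) (p : M) :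
    Submodule ℝ (EuclideanSpace ℝ (Fin m)) :=
  (differential n f p).toLinearMap.range

/-- The normal space at `p`. -/
def normal (f : M → EuclideanSpace ℝ (Fin m)) (p : M) :
    Submodule ℝ (EuclideanSpace ℝ (Fin m)) :=
  (tangent n f p)ᗮ

/-- `X : M → ℝ^m` is a smooth tangent vector field. -/
def IsTangentField (f X : M → EuclideanSpace ℝ (Fin m)) : Prop :=
  ContMDiff (𝓡 n) (𝓡 m) ∞ X ∧ ∀ p, X p ∈ tangent n f p

/-- `η : M → ℝ^m` is a smooth section of the normal bundle. -/
def IsNormalField (f η : M → EuclideanSpace ℝ (Fin m)) : Prop :=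
  ContMDiff (𝓡 n) (𝓡 m) ∞ η ∧ ∀ p, η p ∈ normal n f p

/-- The derivative `D_X u` of a vector valued function `u` on `M` along a tangent field `X`:
at `p` it is `du_p ξ`, where `ξ` is the tangent vector with `df_p ξ = X p`. -/
def D {V : Type*} [NormedAddCommGroup V] [NormedSpace ℝ V]
    (f X : M → EuclideanSpace ℝ (Fin m)) (u : M → V) (p : M) : V :=
  differential n u p (Function.invFun (differential n f p) (X p))

/-- The Levi-Civita connection `∇_X Y = (D_X Y)^⊤` of the induced metric. -/
def nablaT (f X Y : M → EuclideanSpace ℝ (Fin m)) (p : M) : EuclideanSpace ℝ (Fin m) :=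
  (tangent n f p).starProjection (D n f X Y p)

/-- The connection `∇^⊥_X η = (D_X η)^⊥` of the normal bundle. -/
def nablaN (f X η : M → EuclideanSpace ℝ (Fin m)) (p : M) : EuclideanSpace ℝ (Fin m) :=
  (tangent n f p)ᗮ.starProjection (D n f X η p)

/-- The second fundamental form `A(X, Y) = (D_X Y)^⊥` on tangent fields. -/
def secondFF (f X Y : M → EuclideanSpace ℝ (Fin m)) (p : M) : EuclideanSpace ℝ (Fin m) :=
  (tangent n f p)ᗮ.starProjection (D n f X Y p)

/-- The Lie bracket `[X, Y]`; under the identification of tangent vectors with their images in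
`ℝ^m` it is `D_X Y - D_Y X`. -/
def bracket (f X Y : M → EuclideanSpace ℝ (Fin m)) (p : M) : EuclideanSpace ℝ (Fin m) :=
  D n f X Y p - D n f Y X p

/-- The curvature `R^⊥(X, Y)ζ` of the normal bundle. -/
def curvN (f X Y ζ : M → EuclideanSpace ℝ (Fin m)) (p : M) : EuclideanSpace ℝ (Fin m) :=
  nablaN n f X (nablaN n f Y ζ) p - nablaN n f Y (nablaN n f X ζ) p - nablaN n f (bracket n f X Y) ζ p

/-- The normal bundle is flat: `R^⊥ = 0`. -/
def HasFlatNormalBundle (f : M → EuclideanSpace ℝ (Fin m)) : Prop :=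
  ∀ X Y ζ, IsTangentField n f X → IsTangentField n f Y → IsNormalField n f ζ →
    ∀ p, curvN n f X Y ζ p = 0

/-- The second covariant derivative of a normal section:
`(∇∇η)(X, Y) = ∇^⊥_X ∇^⊥_Y η - ∇^⊥_{∇_X Y} η`. -/
def hessN (f X Y η : M → EuclideanSpace ℝ (Fin m)) (p : M) : EuclideanSpace ℝ (Fin m) :=
  nablaN n f X (nablaN n f Y η) p - nablaN n f (nablaT n f X Y) η p

/-- The second covariant derivative of a function: `(∇∇u)(X, Y) = X(Y u) - (∇_X Y) u`. -/
def hess (f X Y : M → EuclideanSpace ℝ (Fin m)) (u : M → ℝ) (p : M) : ℝ :=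
  D n f X (D n f Y u) p - D n f (nablaT n f X Y) u p

/-! Components at a point `p` in orthonormal bases `e_i` of the tangent space and `e_α` of the
normal space at `p`. -/

/-- The index set of the `e_i`; for an immersion its cardinality is `n`. -/
abbrev TIdx (f : M → EuclideanSpace ℝ (Fin m)) (p : M) : Type :=
  Fin (Module.finrank ℝ (tangent n f p))

/-- The index set of the `e_α`; for an immersion its cardinality is `m - n`. -/
abbrev NIdx (f : M → EuclideanSpace ℝ (Fin m)) (p : M) : Type :=
  Fin (Module.finrank ℝ (normal n f p))

/-- The vector `e_α` of an orthonormal basis of the normal space at `p`. -/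
def nvec (f : M → EuclideanSpace ℝ (Fin m)) (p : M) (α : NIdx n f p) : EuclideanSpace ℝ (Fin m) :=
  stdOrthonormalBasis ℝ (normal n f p) α

/-- The vector `e_i` of an orthonormal basis of the tangent space at `p`. -/
def tvec (f : M → EuclideanSpace ℝ (Fin m)) (p : M) (i : TIdx n f p) : EuclideanSpace ℝ (Fin m) :=
  stdOrthonormalBasis ℝ (tangent n f p) i

/-- The vector `e_i` at `p`, extended to the smooth tangent field `q ↦ (e_i)^⊤` on `M`.
It serves to evaluate tensors at `p`, whose values there do not depend on the extension. -/
def tfield (f : M → EuclideanSpace ℝ (Fin m)) (p : M) (i : TIdx n f p) (q : M) :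
    EuclideanSpace ℝ (Fin m) :=
  (tangent n f q).starProjection (tvec n f p i)

/-- `h_{αij} = ⟨A(e_i, e_j), e_α⟩`. -/
def h (f : M → EuclideanSpace ℝ (Fin m)) (p : M) (α : NIdx n f p) (i j : TIdx n f p) : ℝ :=
  inner ℝ (secondFF n f (tfield n f p i) (tfield n f p j) p) (nvec n f p α)

/-- The mean curvature vector `H = trace A`. -/
def meanCurv (f : M → EuclideanSpace ℝ (Fin m)) (p : M) : EuclideanSpace ℝ (Fin m) :=
  ∑ i, secondFF n f (tfield n f p i) (tfield n f p i) p

/-- `H_α = h_{αii}`. -/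
def Hc (f : M → EuclideanSpace ℝ (Fin m)) (p : M) (α : NIdx n f p) : ℝ :=
  ∑ i, h n f p α i i

/-- `∇_i H_α = ⟨∇^⊥_{e_i} H, e_α⟩`. -/
def dH (f : M → EuclideanSpace ℝ (Fin m)) (p : M) (i : TIdx n f p) (α : NIdx n f p) : ℝ :=
  inner ℝ (nablaN n f (tfield n f p i) (meanCurv n f) p) (nvec n f p α)

/-- `∇_i ∇_j H_α = ⟨(∇∇H)(e_i, e_j), e_α⟩`. -/
def ddH (f : M → EuclideanSpace ℝ (Fin m)) (p : M) (i j : TIdx n f p) (α : NIdx n f p) : ℝ :=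
  inner ℝ (hessN n f (tfield n f p i) (tfield n f p j) (meanCurv n f) p) (nvec n f p α)

/-- `|A|^2`. -/
def normASq (f : M → EuclideanSpace ℝ (Fin m)) (p : M) : ℝ :=
  ∑ α, ∑ i, ∑ j, h n f p α i j ^ 2

/-- `|A|`. -/
def normA (f : M → EuclideanSpace ℝ (Fin m)) (p : M) : ℝ :=
  √(normASq n f p)

/-- `|∇H|^2`. -/
def normDHSq (f : M → EuclideanSpace ℝ (Fin m)) (p : M) : ℝ :=
  ∑ α, ∑ i, dH n f p i α ^ 2

/-- `⟨∇u, ∇v⟩ = ∇_i u ∇_i v`. -/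
def gradInner (f : M → EuclideanSpace ℝ (Fin m)) (u v : M → ℝ) (p : M) : ℝ :=
  ∑ i, D n f (tfield n f p i) u p * D n f (tfield n f p i) v p

/-- The Laplace-Beltrami operator `Δu = ∇_i ∇_i u`. -/
def laplacian (f : M → EuclideanSpace ℝ (Fin m)) (u : M → ℝ) (p : M) : ℝ :=
  ∑ i, hess n f (tfield n f p i) (tfield n f p i) u p

/-- The divergence `div X = ⟨∇_{e_i} X, e_i⟩` of a tangent field. -/
def divergence (f X : M → EuclideanSpace ℝ (Fin m)) (p : M) : ℝ :=
  ∑ i, inner ℝ (nablaT n f (tfield n f p i) X p) (tvec n f p i)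

/-- The right-hand side
`(1 + 2/(n+ε)) G + h_{αij} ∇_i ∇_j H_α + H_α h_{αij} h_{βjk} h_{βki} - |A|^4 - C |∇H|^2`
at `p`, where `G` stands for the value of `|∇|A||^2` at `p`. -/
def simonsRHS (f : M → EuclideanSpace ℝ (Fin m)) (ε C G : ℝ) (p : M) : ℝ :=
  (1 + 2 / ((n : ℝ) + ε)) * G
    + ∑ α, ∑ i, ∑ j, h n f p α i j * ddH n f p i j α
    + ∑ α, ∑ β, ∑ i, ∑ j, ∑ k, Hc n f p α * h n f p α i j * h n f p β j k * h n f p β k i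
    - normA n f p ^ 4 - C * normDHSq n f p

/-! The Riemannian measure and weak gradients. -/

section measure

variable [MeasurableSpace M]

/-- The Riemannian measure `√(det g_{ij}) dx` of the domain of the chart at `p`,
as a measure on `M`, where `g_{ij} = ⟨∂_i F, ∂_j F⟩` and `F` is `f` in that chart. -/
def chartVol (f : M → EuclideanSpace ℝ (Fin m)) (p : M) : Measure M :=
  Measure.map (extChartAt (𝓡 n) p).symm
    ((volume.restrict (extChartAt (𝓡 n) p).target).withDensity fun x =>
      ENNReal.ofReal (√(Matrix.det (Matrix.of fun i j : Fin n =>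
        inner ℝ
          (fderiv ℝ (f ∘ (extChartAt (𝓡 n) p).symm) x (EuclideanSpace.basisFun (Fin n) ℝ i))
          (fderiv ℝ (f ∘ (extChartAt (𝓡 n) p).symm) x (EuclideanSpace.basisFun (Fin n) ℝ j))))))

/-- The Riemannian measure of `M`. The measures `chartVol f p` agree on overlaps of charts;
so (on a second countable manifold) their least upper bound is the measure that restricts to
`√(det g_{ij}) dx` on every chart domain. -/
def vol (f : M → EuclideanSpace ℝ (Fin m)) : Measure M :=
  ⨆ p, chartVol n f p

/-- The vector field `V` is a weak gradient of `u`: both are locally integrable, `V` is tangent,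
and `∫ u div X = - ∫ ⟨V, X⟩` for all smooth tangent fields `X` with compact support. -/
def IsWeakGradient (f : M → EuclideanSpace ℝ (Fin m)) (u : M → ℝ)
    (V : M → EuclideanSpace ℝ (Fin m)) : Prop :=
  LocallyIntegrable u (vol n f) ∧ LocallyIntegrable V (vol n f) ∧
  (∀ᵐ p ∂(vol n f), V p ∈ tangent n f p) ∧
  ∀ X, IsTangentField n f X → HasCompactSupport X →
    ∫ p, u p * divergence n f X p ∂(vol n f) = - ∫ p, inner ℝ (V p) (X p) ∂(vol n f)

/-- `u` belongs to `L^∞_loc`. -/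
def MemLinftyLoc {V : Type*} [NormedAddCommGroup V] (f : M → EuclideanSpace ℝ (Fin m))
    (u : M → V) : Prop :=
  ∀ K : Set M, IsCompact K → MemLp u ⊤ ((vol n f).restrict K)

/-- `u` belongs to `W^{1,∞}_loc`. -/
def MemW1inftyLoc (f : M → EuclideanSpace ℝ (Fin m)) (u : M → ℝ) : Prop :=
  MemLinftyLoc n f u ∧ ∃ V, IsWeakGradient n f u V ∧ MemLinftyLoc n f V

end measure

end FlatNormal

end

/-! Near a point `p` the immersion is a graph `F` over its tangent space `T` at `p`. At the base
point `DF` is the inclusion of `T` and all higher derivatives of `F` are normal, so the Christoffel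
symbols vanish there: `D²F` is the second fundamental form `A`, `D³F` is `∇A`, and the Codazzi
equation is the symmetry of `D³F`. The curvature corrections come from the tangential projection
`P`; the parts of `DP` and `D²P` that matter are expressed through `A` by differentiating `P ∘ P =
P`. Symmetry of `D⁴F` takes the place of commuting covariant derivatives.

Comparing `½Δ|A|²` with the trace `⟨A, ∇∇H⟩` in these coordinates gives Simons' identity `½Δ|A|² =
|∇A|² + ⟨A, ∇∇H⟩ + (cubic term) - Σ ⟨h_mk, h_ij⟩²`. Flatness of the normal bundle says, by the Ricci
equation, that the shape operators commute; this makes the other quartic terms cancel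
(`simons_contraction`). The last sum is at most `|A|⁴` by Cauchy-Schwarz.

What remains is the refined Kato inequality `(1 + 2/(n+ε)) |∇|A||² ≤ |∇A|² + C |∇H|²`
(`refined_kato`). Commuting shape operators have a joint eigenbasis, in which only the components
`c_kii` of `∇A` enter `∇|A|`. By symmetry each `c_kii` with `i ≠ k` occurs three times in `|∇A|²`,
and `c_kkk` is `∇_k H` minus the sum of the others; Young's inequality and Cauchy-Schwarz finish
(`refined_kato_sum`). Together this is `simons_inequality`.

For the weak form, `|∇|A|²|² ≤ 4 |A|² |DA|²` bounds the gradients of `√(|A|² + δ)` uniformly on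
compact sets. Letting `δ → 0`, the weak gradient of `|A|` is the classical one where `|A| ≠ 0` and
zero elsewhere (`isWeakGradient_gradNormA`). With that gradient the pointwise inequality holds at
every point, including the zeros of `|A|`, so it can be multiplied by `φ` and integrated with
Green's formula. The divergence theorem behind this follows from Jacobi's formula in charts and a
partition of unity, and weak gradients are unique almost everywhere (`IsWeakGradient.ae_eq`). -/

noncomputable section

namespace FlatNormal

/-! ### Linear algebra: traces, joint diagonalization, and the refined Kato inequality -/

section LinearAlgebra

variable {V E G : Type*} [NormedAddCommGroup V] [InnerProductSpace ℝ V]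
  [NormedAddCommGroup E] [InnerProductSpace ℝ E] [AddCommGroup G] [Module ℝ G]
  {ι κ : Type*} [Fintype ι] [Fintype κ]

/-- A trace of a bilinear map does not depend on the orthonormal basis. -/
theorem sum_bilin_eq (B : V → V → G) (h₁ : ∀ w, IsLinearMap ℝ fun v => B v w)
    (h₂ : ∀ v, IsLinearMap ℝ (B v)) (b : OrthonormalBasis ι ℝ V) (b' : OrthonormalBasis κ ℝ V) :
    ∑ i, B (b i) (b i) = ∑ j, B (b' j) (b' j) := by
  have hj : ∀ j, B (b' j) (b' j) = ∑ i, inner ℝ (b i) (b' j) • B (b i) (b' j) := by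
    intro j
    have := map_sum (h₁ (b' j)).mk' (fun i => inner ℝ (b i) (b' j) • b i) Finset.univ
    rw [b.sum_repr' (b' j)] at this
    simpa [(h₁ (b' j)).map_smul] using this
  have hi : ∀ i, B (b i) (b i) = ∑ j, inner ℝ (b' j) (b i) • B (b i) (b' j) := by
    intro i
    have := map_sum (h₂ (b i)).mk' (fun j => inner ℝ (b' j) (b i) • b' j) Finset.univ
    rw [b'.sum_repr' (b i)] at this
    simpa [(h₂ (b i)).map_smul] using this
  simp_rw [hi, hj]
  rw [Finset.sum_comm]
  simp_rw [real_inner_comm]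

/-- The trace over a subspace of a bilinear map that vanishes on its orthogonal complement is the
trace over the whole space. -/
theorem sum_bilin_subspace (T : Submodule ℝ E) [T.HasOrthogonalProjection] (B : E → E → G)
    (h₁ : ∀ w, IsLinearMap ℝ fun v => B v w) (h₂ : ∀ v, IsLinearMap ℝ (B v))
    (h₀ : ∀ v ∈ Tᗮ, ∀ w, B v w = 0) (t : OrthonormalBasis ι ℝ T) (e : OrthonormalBasis κ ℝ E) :
    ∑ i, B (t i) (t i) = ∑ a, B (e a) (e a) := by
  have ha : ∀ a, B (e a) (e a) = ∑ i, inner ℝ (t i : E) (e a) • B (t i) (e a) := by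
    intro a
    have h : e a = T.starProjection (e a) + Tᗮ.starProjection (e a) :=
      (T.starProjection_add_starProjection_orthogonal (e a)).symm
    have hp : T.starProjection (e a) = ∑ i, inner ℝ (t i : E) (e a) • (t i : E) := by
      rw [Submodule.starProjection_apply, ← t.sum_repr' (T.orthogonalProjectionOnto (e a))]
      simp
    calc B (e a) (e a) = B (T.starProjection (e a) + Tᗮ.starProjection (e a)) (e a) := by rw [← h]
      _ = B (T.starProjection (e a)) (e a) := by
        rw [(h₁ (e a)).map_add, h₀ _ (Submodule.starProjection_apply_mem _ _), add_zero]
      _ = _ := by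
        rw [hp]
        have := map_sum (h₁ (e a)).mk' (fun i => inner ℝ (t i : E) (e a) • (t i : E)) Finset.univ
        exact this.trans (Finset.sum_congr rfl fun i _ => (h₁ _).map_smul _ _)
  have hi : ∀ i, B (t i) (t i) = ∑ a, inner ℝ (e a) (t i : E) • B (t i) (e a) := by
    intro i
    have := map_sum (h₂ (t i)).mk' (fun a => inner ℝ (e a) (t i : E) • e a) Finset.univ
    rw [e.sum_repr' (t i : E)] at this
    simpa [(h₂ (t i)).map_smul] using this
  simp_rw [hi, ha]
  rw [Finset.sum_comm]
  simp_rw [real_inner_comm]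

theorem sum_norm_sq_eq (L : V →ₗ[ℝ] E) (b : OrthonormalBasis ι ℝ V)
    (b' : OrthonormalBasis κ ℝ V) : ∑ i, ‖L (b i)‖ ^ 2 = ∑ j, ‖L (b' j)‖ ^ 2 := by
  simp_rw [← real_inner_self_eq_norm_sq]
  exact sum_bilin_eq (fun v w => inner ℝ (L v) (L w))
    (fun w => ⟨by simp [inner_add_left], by simp [inner_smul_left]⟩)
    (fun v => ⟨by simp [inner_add_right], by simp [inner_smul_right]⟩) b b'

/-- A commuting family of symmetric operators has a joint orthonormal eigenbasis. -/
theorem exists_joint_eigenbasis [FiniteDimensional ℝ V] {A : κ → V →ₗ[ℝ] V}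
    (hA : ∀ i, (A i).IsSymmetric) (hC : Pairwise (Function.onFun Commute A)) :
    ∃ (b : OrthonormalBasis (Fin (Module.finrank ℝ V)) ℝ V),
      ∀ i a, ∃ μ : ℝ, A i (b a) = μ • b a := by
  classical
  have h := LinearMap.IsSymmetric.directSum_isInternal_of_pairwise_commute hA hC
  have ho := LinearMap.IsSymmetric.orthogonalFamily_iInf_eigenspaces hA
  -- The joint eigenspaces are indexed by all functions `κ → ℝ`. A subordinate orthonormal basis
  -- needs a finite index type, so only the nonzero eigenspaces are kept; independence makes them
  -- finitely many.
  have h' := DirectSum.isInternal_ne_bot_iff.mpr h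
  have hfin : {α : κ → ℝ | (⨅ j, Module.End.eigenspace (A j) (α j)) ≠ ⊥}.Finite :=
    WellFoundedGT.finite_ne_bot_of_iSupIndep h.submodule_iSupIndep
  have : Fintype {α : κ → ℝ // (⨅ j, Module.End.eigenspace (A j) (α j)) ≠ ⊥} := hfin.fintype
  have ho' := ho.comp (γ := {α : κ → ℝ // (⨅ j, Module.End.eigenspace (A j) (α j)) ≠ ⊥})
    Subtype.val_injective
  refine ⟨h'.subordinateOrthonormalBasis rfl ho', fun i a => ?_⟩
  have hm := h'.subordinateOrthonormalBasis_subordinate rfl a ho'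
  exact ⟨_, Module.End.mem_eigenspace_iff.1 ((Submodule.mem_iInf _).1 hm i)⟩

/-- A bilinear form with values in a Euclidean space whose shape operators commute can be
diagonalized in an orthonormal basis. -/
theorem exists_diagonalizing_basis [FiniteDimensional ℝ V] [FiniteDimensional ℝ E]
    (φ : V →L[ℝ] V →L[ℝ] E) (hs : ∀ v w, φ v w = φ w v) (t : OrthonormalBasis ι ℝ V)
    (hc : ∀ i j ζ, ∑ k, inner ℝ (φ (t j) (t k)) ζ • φ (t i) (t k)
      = ∑ k, inner ℝ (φ (t i) (t k)) ζ • φ (t j) (t k)) :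
    ∃ (b : OrthonormalBasis (Fin (Module.finrank ℝ V)) ℝ V), ∀ i j, i ≠ j → φ (b i) (b j) = 0 := by
  have : CompleteSpace V := FiniteDimensional.complete ℝ V
  let e := stdOrthonormalBasis ℝ E
  -- The shape operator in the direction `e α`, determined by `⟨A α v, w⟩ = ⟨φ v w, e α⟩`. A joint
  -- eigenbasis of all of them annihilates every component of the off-diagonal values of `φ`.
  let A : Fin (Module.finrank ℝ E) → V →ₗ[ℝ] V := fun α =>
    { toFun := fun v => ∑ k, inner ℝ (φ v (t k)) (e α) • t k
      map_add' := by intro v w; simp [inner_add_left, add_smul, Finset.sum_add_distrib]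
      map_smul' := by intro r v; simp [inner_smul_left, mul_smul, Finset.smul_sum] }
  have hAin : ∀ α v w, inner ℝ (A α v) w = inner ℝ (φ v w) (e α) := by
    intro α v w
    conv_rhs => rw [← t.sum_repr' w]
    simp [A, sum_inner, inner_smul_left, map_sum, mul_comm]
  have hA : ∀ α, (A α).IsSymmetric := by
    intro α v w
    rw [hAin, hs, ← hAin, real_inner_comm]
  have hC : Pairwise (Function.onFun Commute A) := by
    intro α β _
    change A α * A β = A β * A α
    have hcomp : ∀ α β v w, inner ℝ (A α (A β v)) w
        = ∑ k, inner ℝ (φ v (t k)) (e β) * inner ℝ (φ w (t k)) (e α) := by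
      intro α β v w
      rw [hAin, hs]
      simp [A, sum_inner, inner_smul_left, map_sum]
    refine t.toBasis.ext fun j => ext_inner_right ℝ fun w => ?_
    rw [Module.End.mul_apply, Module.End.mul_apply, hcomp, hcomp, ← t.sum_repr' w]
    -- Hypothesis `hc` with `ζ = e β`, paired with `e α`, is the commutation of the matrices of `A
    -- α` and `A β` in the basis `t`.
    have h1 : ∀ i, ∑ k, inner ℝ (φ (t j) (t k)) (e β) * inner ℝ (φ (t i) (t k)) (e α)
        = ∑ k, inner ℝ (φ (t j) (t k)) (e α) * inner ℝ (φ (t i) (t k)) (e β) := by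
      intro i
      have := congrArg (fun x => inner ℝ x (e α)) (hc i j (e β))
      simp only [sum_inner, inner_smul_left] at this
      simpa [mul_comm] using this
    simp only [OrthonormalBasis.coe_toBasis, map_sum, map_smul, sum_apply,
      smul_apply, sum_inner, inner_smul_left, Finset.mul_sum]
    rw [Finset.sum_comm]
    conv_rhs => rw [Finset.sum_comm]
    refine Finset.sum_congr rfl fun i _ => ?_
    have := congrArg (fun x => inner ℝ (t i) w * x) (h1 i)
    simp only [Finset.mul_sum] at this
    simp only [conj_trivial]
    rw [Finset.sum_congr rfl fun k _ => mul_left_comm _ _ _, this]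
    exact Finset.sum_congr rfl fun k _ => mul_left_comm _ _ _
  obtain ⟨b, hb⟩ := exists_joint_eigenbasis hA hC
  refine ⟨b, fun i j hij => ?_⟩
  refine InnerProductSpace.ext_inner_right_basis e.toBasis fun α => ?_
  obtain ⟨μ, hμ⟩ := hb α i
  rw [OrthonormalBasis.coe_toBasis, ← hAin, hμ, inner_smul_left,
    b.orthonormal.2 hij]
  simp

/-- The constant in front of `|∇H|²`. -/
def katoConst (n : ℕ) (ε : ℝ) : ℝ := 2 * (1 + ((n : ℝ) + 1) / ε) / ((n : ℝ) + ε)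

theorem norm_sub_sq_le_young {E : Type*} [NormedAddCommGroup E] (x y : E) {δ : ℝ} (hδ : 0 < δ) :
    ‖x - y‖ ^ 2 ≤ (1 + 1 / δ) * ‖x‖ ^ 2 + (1 + δ) * ‖y‖ ^ 2 := by
  have h1 : ‖x - y‖ ^ 2 ≤ (‖x‖ + ‖y‖) ^ 2 := by gcongr; exact norm_sub_le x y
  have h2 : (1 + 1 / δ) * ‖x‖ ^ 2 + (1 + δ) * ‖y‖ ^ 2 - (‖x‖ + ‖y‖) ^ 2
      = (‖x‖ - δ * ‖y‖) ^ 2 / δ := by field_simp; ring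
  have h3 : 0 ≤ (‖x‖ - δ * ‖y‖) ^ 2 / δ := by positivity
  linarith

/-- The algebraic refined Kato inequality for a totally symmetric family of vectors. -/
theorem refined_kato_sum {E : Type*} [NormedAddCommGroup E] (n : ℕ) {ε : ℝ} (hε : 0 < ε) (c : Fin n → Fin n → Fin n → E)
    (h12 : ∀ i j k, c i j k = c j i k) (h23 : ∀ i j k, c i j k = c i k j) :
    (1 + 2 / ((n : ℝ) + ε)) * ∑ k, ∑ i, ‖c k i i‖ ^ 2
      ≤ ∑ k, ∑ i, ∑ j, ‖c k i j‖ ^ 2 + katoConst n ε * ∑ k, ‖∑ i, c k i i‖ ^ 2 := by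
  classical
  set T₀ := ∑ k, ∑ i, ‖c k i i‖ ^ 2 with hT
  set S := ∑ k, ∑ i, if i = k then 0 else ‖c k i i‖ ^ 2 with hS
  set τ := ∑ k, ‖∑ i, c k i i‖ ^ 2 with hτ
  have hS0 : 0 ≤ S := Finset.sum_nonneg fun k _ => Finset.sum_nonneg fun i _ => by
    split_ifs <;> positivity
  have hτ0 : 0 ≤ τ := Finset.sum_nonneg fun k _ => by positivity
  -- The index sets `i = j`, `k = i ≠ j` and `k = j ≠ i` are disjoint. The first contributes `T₀`;
  -- by total symmetry each of the other two contributes `S`.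
  have hA : T₀ + 2 * S ≤ ∑ k, ∑ i, ∑ j, ‖c k i j‖ ^ 2 := by
    have e1 : T₀ = ∑ k, ∑ i, ∑ j, if i = j then ‖c k i j‖ ^ 2 else 0 := by
      simp [hT]
    have e2 : S = ∑ k, ∑ i, ∑ j, if k = i ∧ i ≠ j then ‖c k i j‖ ^ 2 else 0 := by
      rw [hS, Finset.sum_comm]
      refine Finset.sum_congr rfl fun k _ => ?_
      rw [Finset.sum_comm]
      refine Finset.sum_congr rfl fun j _ => ?_
      rw [Finset.sum_eq_single k (by intro b _ hb; simp [Ne.symm hb]) (by simp)]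
      by_cases hkj : k = j
      · simp [hkj]
      · simp only [hkj, if_false, true_and, ne_eq, not_false_eq_true, if_true]
        rw [h12 j k k, h23 k j k]
    have e3 : S = ∑ k, ∑ i, ∑ j, if k = j ∧ i ≠ j then ‖c k i j‖ ^ 2 else 0 := by
      rw [e2]
      refine Finset.sum_congr rfl fun k _ => ?_
      rw [Finset.sum_comm]
      refine Finset.sum_congr rfl fun j _ => Finset.sum_congr rfl fun i _ => ?_
      rw [h23 k j i]
      refine if_congr ?_ rfl rfl
      constructor <;> rintro ⟨rfl, h⟩ <;> exact ⟨rfl, h.symm⟩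
    calc T₀ + 2 * S = T₀ + S + S := by ring
      _ ≤ _ := by
        nth_rewrite 2 [e3]
        rw [e1, e2]
        simp_rw [← Finset.sum_add_distrib]
        refine Finset.sum_le_sum fun k _ => Finset.sum_le_sum fun i _ =>
          Finset.sum_le_sum fun j _ => ?_
        have := sq_nonneg ‖c k i j‖
        by_cases h1 : i = j
        · simp [h1]
        · by_cases h2 : k = i
          · have : k ≠ j := fun h => h1 (h2.symm.trans h)
            simp [h1, h2]
          · by_cases h3 : k = j
            · subst h3
              simp [h1, h2]
            · simp [h1, h2, h3]
  -- The Young parameter. Its denominator is positive for `n = 0` too, and `δ (n - 1) ≤ ε` is what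
  -- the coefficient of `S` requires.
  set δ : ℝ := ε / ((n : ℝ) + 1) with hδ
  have hδ0 : 0 < δ := by positivity
  have hB : T₀ ≤ (1 + 1 / δ) * τ + ((n : ℝ) + ε) * S := by
    rw [hT, hS, hτ, Finset.mul_sum, Finset.mul_sum, ← Finset.sum_add_distrib]
    refine Finset.sum_le_sum fun k _ => ?_
    set R := ∑ i, if i = k then 0 else ‖c k i i‖ ^ 2 with hR
    set y := ∑ i ∈ Finset.univ.erase k, c k i i with hy
    have hsplit : ∑ i, ‖c k i i‖ ^ 2 = ‖c k k k‖ ^ 2 + R := by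
      rw [← Finset.add_sum_erase _ _ (Finset.mem_univ k), hR,
        ← Finset.add_sum_erase _ (fun i => if i = k then 0 else ‖c k i i‖ ^ 2) (Finset.mem_univ k)]
      simp only [if_true, zero_add]
      congr 1
      exact Finset.sum_congr rfl fun i hi => by rw [if_neg (Finset.ne_of_mem_erase hi)]
    have hRe : R = ∑ i ∈ Finset.univ.erase k, ‖c k i i‖ ^ 2 := by
      have := Finset.add_sum_erase Finset.univ (fun i => ‖c k i i‖ ^ 2) (Finset.mem_univ k)
      linarith
    have hR0 : 0 ≤ R := by rw [hRe]; positivity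
    -- The pure component is the trace, which plays the role of `∇_k H`, minus `n - 1` components
    -- that are already counted in `S`.
    have hck : c k k k = ∑ i, c k i i - y := by
      rw [← Finset.add_sum_erase _ (fun i => c k i i) (Finset.mem_univ k)]; simp [hy]
    have hyR : ‖y‖ ^ 2 ≤ ((n : ℝ) - 1) * R := by
      have h1 : ‖y‖ ≤ ∑ i ∈ Finset.univ.erase k, ‖c k i i‖ := norm_sum_le _ _
      have h2 := sq_sum_le_card_mul_sum_sq (s := Finset.univ.erase k) (f := fun i => ‖c k i i‖)
      have h3 : ((Finset.univ.erase k).card : ℝ) = (n : ℝ) - 1 := by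
        rw [Finset.card_erase_of_mem (Finset.mem_univ k), Finset.card_univ, Fintype.card_fin,
          Nat.cast_sub k.pos]
        simp
      rw [h3, ← hRe] at h2
      exact (pow_le_pow_left₀ (norm_nonneg _) h1 2).trans h2
    have hyoung := norm_sub_sq_le_young (∑ i, c k i i) y hδ0
    rw [← hck] at hyoung
    rw [hsplit]
    have hδn : δ * ((n : ℝ) + 1) = ε := by rw [hδ]; field_simp
    have h5 : (1 + δ) * ‖y‖ ^ 2 ≤ (1 + δ) * (((n : ℝ) - 1) * R) := by gcongr
    -- The coefficient of `R` is `1 + (1 + δ)(n - 1) = n + ε - 2δ`, so the surplus `2 δ R ≥ 0` is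
    -- discarded.
    nlinarith [mul_nonneg hδ0.le hR0]
  have hn : 0 < (n : ℝ) + ε := by positivity
  have hC : katoConst n ε = 2 * (1 + 1 / δ) / ((n : ℝ) + ε) := by
    rw [katoConst, hδ, one_div_div]
  have h6 : 2 / ((n : ℝ) + ε) * T₀ ≤ katoConst n ε * τ + 2 * S := by
    rw [hC, div_mul_eq_mul_div, div_mul_eq_mul_div, div_le_iff₀ hn, add_mul,
      div_mul_cancel₀ _ hn.ne']
    linarith
  linarith

/-- The refined Kato inequality for a diagonalizable second fundamental form `φ` and a totally
symmetric covariant derivative `c`. -/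
theorem refined_kato [FiniteDimensional ℝ V] [FiniteDimensional ℝ E] {ε : ℝ} (hε : 0 < ε)
    (φ : V →L[ℝ] V →L[ℝ] E) (c : V →L[ℝ] V →L[ℝ] V →L[ℝ] E) (hs : ∀ v w, φ v w = φ w v)
    (h12 : ∀ u v w, c u v w = c v u w) (h23 : ∀ u v w, c u v w = c u w v)
    (t : OrthonormalBasis ι ℝ V)
    (hc : ∀ i j ζ, ∑ k, inner ℝ (φ (t j) (t k)) ζ • φ (t i) (t k)
      = ∑ k, inner ℝ (φ (t i) (t k)) ζ • φ (t j) (t k)) :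
    ∃ T₀ : ℝ, 0 ≤ T₀ ∧ ∑ k, (∑ i, ∑ j, inner ℝ (φ (t i) (t j)) (c (t k) (t i) (t j))) ^ 2
        ≤ (∑ i, ∑ j, ‖φ (t i) (t j)‖ ^ 2) * T₀ ∧
      (1 + 2 / ((Module.finrank ℝ V : ℝ) + ε)) * T₀
        ≤ ∑ k, ∑ i, ∑ j, ‖c (t k) (t i) (t j)‖ ^ 2
          + katoConst (Module.finrank ℝ V) ε * ∑ k, ‖∑ i, c (t k) (t i) (t i)‖ ^ 2 := by
  obtain ⟨b, hb⟩ := exists_diagonalizing_basis φ hs t hc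
  -- In the basis `b` that diagonalizes `φ`, the pairing of `φ` with `c` sees only the components `c
  -- k i i`, so `T₀` is the sum of their squares. The other sums are traces and may be moved from
  -- `t` to `b`.
  refine ⟨∑ k, ∑ i, ‖c (b k) (b i) (b i)‖ ^ 2, by positivity, ?_, ?_⟩
  · have h1 : ∀ v, ∑ i, ∑ j, inner ℝ (φ (t i) (t j)) (c v (t i) (t j))
        = ∑ i, inner ℝ (φ (b i) (b i)) (c v (b i) (b i)) := by
      intro v
      have e1 : ∀ w, ∑ j, inner ℝ (φ w (t j)) (c v w (t j))
          = ∑ j, inner ℝ (φ w (b j)) (c v w (b j)) := fun w =>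
        sum_bilin_eq (fun x y => inner ℝ (φ w x) (c v w y))
          (fun w => ⟨by simp [inner_add_left], by simp [inner_smul_left]⟩)
          (fun v => ⟨by simp [inner_add_right], by simp [inner_smul_right]⟩) t b
      simp_rw [e1]
      rw [sum_bilin_eq (fun x y => ∑ j, inner ℝ (φ x (b j)) (c v y (b j)))
        (fun w => ⟨by simp [inner_add_left, Finset.sum_add_distrib],
          by simp [inner_smul_left, Finset.mul_sum]⟩)
        (fun v => ⟨by simp [inner_add_right, Finset.sum_add_distrib],
          by simp [inner_smul_right, Finset.mul_sum]⟩) t b]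
      refine Finset.sum_congr rfl fun i _ => ?_
      exact Finset.sum_eq_single i (by intro j _ hj; simp [hb i j (Ne.symm hj)]) (by simp)
    have h2 : ∑ i, ∑ j, ‖φ (t i) (t j)‖ ^ 2 = ∑ i, ‖φ (b i) (b i)‖ ^ 2 := by
      have e1 : ∀ w, ∑ j, ‖φ w (t j)‖ ^ 2 = ∑ j, ‖φ w (b j)‖ ^ 2 := fun w =>
        sum_norm_sq_eq (φ w).toLinearMap t b
      have e2 : ∀ w, ∑ i, ‖φ (t i) w‖ ^ 2 = ∑ i, ‖φ (b i) w‖ ^ 2 := fun w =>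
        sum_norm_sq_eq (φ.flip w).toLinearMap t b
      simp_rw [e1]
      rw [Finset.sum_comm]
      simp_rw [e2]
      rw [Finset.sum_comm]
      refine Finset.sum_congr rfl fun i _ => ?_
      exact Finset.sum_eq_single i (by intro j _ hj; simp [hb i j (Ne.symm hj)]) (by simp)
    have h3 : ∑ k, (∑ i, inner ℝ (φ (b i) (b i)) (c (t k) (b i) (b i))) ^ 2
        = ∑ k, (∑ i, inner ℝ (φ (b i) (b i)) (c (b k) (b i) (b i))) ^ 2 := by
      simp_rw [sq]
      exact sum_bilin_eq (fun x y => (∑ i, inner ℝ (φ (b i) (b i)) (c x (b i) (b i)))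
          * (∑ i, inner ℝ (φ (b i) (b i)) (c y (b i) (b i))))
        (fun w => ⟨by simp [inner_add_right, Finset.sum_add_distrib, add_mul],
          by simp [inner_smul_right, ← Finset.mul_sum, mul_assoc]⟩)
        (fun v => ⟨by simp [inner_add_right, Finset.sum_add_distrib, mul_add],
          by simp [inner_smul_right, ← Finset.mul_sum, mul_left_comm]⟩) t b
    simp_rw [h1]
    rw [h2, h3, Finset.mul_sum]
    refine Finset.sum_le_sum fun k _ => ?_
    have h4 : |∑ i, inner ℝ (φ (b i) (b i)) (c (b k) (b i) (b i))|
        ≤ ∑ i, ‖φ (b i) (b i)‖ * ‖c (b k) (b i) (b i)‖ :=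
      (Finset.abs_sum_le_sum_abs _ _).trans
        (Finset.sum_le_sum fun i _ => abs_real_inner_le_norm _ _)
    rw [← sq_abs]
    exact (pow_le_pow_left₀ (abs_nonneg _) h4 2).trans (Finset.sum_mul_sq_le_sq_mul_sq _ _ _)
  · refine (refined_kato_sum _ hε (fun k i j => c (b k) (b i) (b j)) (fun _ _ _ => h12 _ _ _)
      (fun _ _ _ => h23 _ _ _)).trans_eq ?_
    have e1 : ∀ u w, ∑ j, ‖c u w (t j)‖ ^ 2 = ∑ j, ‖c u w (b j)‖ ^ 2 := fun u w =>
      sum_norm_sq_eq (c u w).toLinearMap t b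
    have e2 : ∀ u w, ∑ i, ‖c u (t i) w‖ ^ 2 = ∑ i, ‖c u (b i) w‖ ^ 2 := fun u w =>
      sum_norm_sq_eq ((c u).flip w).toLinearMap t b
    have e3 : ∀ v w, ∑ k, ‖c (t k) v w‖ ^ 2 = ∑ k, ‖c (b k) v w‖ ^ 2 := fun v w =>
      sum_norm_sq_eq ((c.flip v).flip w).toLinearMap t b
    have e4 : ∀ u, ∑ i, c u (t i) (t i) = ∑ i, c u (b i) (b i) := fun u =>
      sum_bilin_eq (fun x y => c u x y) (fun w => ⟨by simp, by simp⟩)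
        (fun w => ⟨by simp, by simp⟩) t b
    have e5 : ∑ k, ‖∑ i, c (t k) (t i) (t i)‖ ^ 2 = ∑ k, ‖∑ i, c (b k) (b i) (b i)‖ ^ 2 := by
      simp_rw [e4]
      have := sum_norm_sq_eq (∑ i, (c.flip (b i)).flip (b i)).toLinearMap t b
      simpa using this
    rw [e5]
    congr 1
    symm
    simp_rw [e1]
    calc ∑ k, ∑ i, ∑ j, ‖c (t k) (t i) (b j)‖ ^ 2
        = ∑ k, ∑ j, ∑ i, ‖c (t k) (t i) (b j)‖ ^ 2 :=
          Finset.sum_congr rfl fun k _ => Finset.sum_comm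
      _ = ∑ k, ∑ j, ∑ i, ‖c (t k) (b i) (b j)‖ ^ 2 := by simp_rw [e2]
      _ = ∑ j, ∑ i, ∑ k, ‖c (t k) (b i) (b j)‖ ^ 2 := by
          rw [Finset.sum_comm]
          exact Finset.sum_congr rfl fun k _ => Finset.sum_comm
      _ = ∑ j, ∑ i, ∑ k, ‖c (b k) (b i) (b j)‖ ^ 2 := by simp_rw [e3]
      _ = ∑ j, ∑ k, ∑ i, ‖c (b k) (b i) (b j)‖ ^ 2 :=
          Finset.sum_congr rfl fun k _ => Finset.sum_comm
      _ = ∑ k, ∑ j, ∑ i, ‖c (b k) (b i) (b j)‖ ^ 2 := Finset.sum_comm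
      _ = _ := Finset.sum_congr rfl fun k _ => Finset.sum_comm

end LinearAlgebra

end FlatNormal
end

noncomputable section

namespace FlatNormal

/-! ### The pseudoinverse of an injective linear map and its smooth dependence -/

section PseudoInverse

variable {n : ℕ} {E : Type*} [NormedAddCommGroup E] [InnerProductSpace ℝ E]

/-- The Gram matrix `⟨L ε_i, L ε_j⟩` of a linear map on `ℝ^n`. -/
def gramMat (L : EuclideanSpace ℝ (Fin n) →L[ℝ] E) : Matrix (Fin n) (Fin n) ℝ :=
  Matrix.of fun i j : Fin n =>
    inner ℝ (L (EuclideanSpace.basisFun (Fin n) ℝ i)) (L (EuclideanSpace.basisFun (Fin n) ℝ j))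

theorem gramMat_apply (L : EuclideanSpace ℝ (Fin n) →L[ℝ] E) (i j : Fin n) :
    gramMat L i j = inner ℝ (L (EuclideanSpace.basisFun (Fin n) ℝ i))
      (L (EuclideanSpace.basisFun (Fin n) ℝ j)) := rfl

theorem det_gramMat_pos {L : EuclideanSpace ℝ (Fin n) →L[ℝ] E} (hL : Function.Injective L) :
    0 < (gramMat L).det := by
  have h : LinearIndependent ℝ (fun i => L (EuclideanSpace.basisFun (Fin n) ℝ i)) :=
    (EuclideanSpace.basisFun (Fin n) ℝ).orthonormal.linearIndependent.map' L.toLinearMap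
      (LinearMap.ker_eq_bot.2 hL)
  exact (Matrix.posDef_gram_of_linearIndependent h).det_pos

/-- The Moore-Penrose inverse of an injective linear map on `ℝ^n`. -/
def pinv (L : EuclideanSpace ℝ (Fin n) →L[ℝ] E) (v : E) : EuclideanSpace ℝ (Fin n) :=
  ∑ i, ∑ j, ((gramMat L)⁻¹ i j * inner ℝ v (L (EuclideanSpace.basisFun (Fin n) ℝ j))) •
    EuclideanSpace.basisFun (Fin n) ℝ i

/-- These are the normal equations of least squares. They yield both that `L ∘ pinv L` is the
orthogonal projection onto the range of `L` and that `pinv L` is a left inverse of `L`. -/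
theorem inner_apply_pinv {L : EuclideanSpace ℝ (Fin n) →L[ℝ] E} (hL : Function.Injective L)
    (v : E) (w : EuclideanSpace ℝ (Fin n)) : inner ℝ (L (pinv L v)) (L w) = inner ℝ v (L w) := by
  have hdet := (det_gramMat_pos hL).ne'
  have hb : ∀ k, inner ℝ (L (pinv L v)) (L (EuclideanSpace.basisFun (Fin n) ℝ k))
      = inner ℝ v (L (EuclideanSpace.basisFun (Fin n) ℝ k)) := by
    intro k
    have h1 : (gramMat L)⁻¹.transpose * gramMat L = 1 := by
      rw [Matrix.transpose_nonsing_inv]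
      have : (gramMat L).transpose = gramMat L := by
        ext i j; simp [gramMat_apply, real_inner_comm]
      rw [this]
      exact Matrix.nonsing_inv_mul _ (isUnit_iff_ne_zero.2 hdet)
    have h2 : ∀ j, ∑ i, (gramMat L)⁻¹ i j * gramMat L i k = (1 : Matrix _ _ ℝ) j k := by
      intro j
      rw [← h1, Matrix.mul_apply]
      rfl
    simp only [pinv, map_sum, map_smul, sum_inner, inner_smul_left, conj_trivial]
    rw [Finset.sum_comm]
    calc _ = ∑ j, (∑ i, (gramMat L)⁻¹ i j * gramMat L i k) *
          inner ℝ v (L (EuclideanSpace.basisFun (Fin n) ℝ j)) := by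
          refine Finset.sum_congr rfl fun j _ => ?_
          rw [Finset.sum_mul]
          refine Finset.sum_congr rfl fun i _ => ?_
          rw [gramMat_apply]; ring
      _ = _ := by simp [h2, Matrix.one_apply]
  rw [← (EuclideanSpace.basisFun (Fin n) ℝ).sum_repr' w]
  simp only [map_sum, map_smul, inner_sum, inner_smul_right, hb]

theorem apply_pinv [FiniteDimensional ℝ E] {L : EuclideanSpace ℝ (Fin n) →L[ℝ] E}
    (hL : Function.Injective L) (v : E) :
    L (pinv L v) = (L.toLinearMap.range).starProjection v := by
  symm
  refine Submodule.eq_starProjection_of_mem_of_inner_eq_zero ⟨pinv L v, rfl⟩ ?_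
  rintro _ ⟨w, rfl⟩
  rw [inner_sub_left, sub_eq_zero]
  exact (inner_apply_pinv hL v w).symm

theorem pinv_apply {L : EuclideanSpace ℝ (Fin n) →L[ℝ] E} (hL : Function.Injective L)
    (w : EuclideanSpace ℝ (Fin n)) : pinv L (L w) = w := by
  apply hL
  rw [← sub_eq_zero, ← inner_self_eq_zero (𝕜 := ℝ), ← map_sub, map_sub, inner_sub_left]
  rw [← map_sub, inner_apply_pinv hL, sub_self]

variable {W : Type*} [NormedAddCommGroup W] [NormedSpace ℝ W]

theorem contDiffAt_det {ι : Type*} [Fintype ι] [DecidableEq ι] {A : W → Matrix ι ι ℝ} {x : W}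
    {k : ℕ∞ω} (hA : ∀ i j, ContDiffAt ℝ k (fun y => A y i j) x) :
    ContDiffAt ℝ k (fun y => (A y).det) x := by
  simp_rw [Matrix.det_apply]
  exact ContDiffAt.sum fun σ _ => (contDiffAt_prod fun i _ => hA _ _).const_smul _

theorem contDiffAt_matrix_inv {ι : Type*} [Fintype ι] [DecidableEq ι] {A : W → Matrix ι ι ℝ}
    {x : W} {k : ℕ∞ω} (hA : ∀ i j, ContDiffAt ℝ k (fun y => A y i j) x) (hx : (A x).det ≠ 0)
    (i j : ι) : ContDiffAt ℝ k (fun y => (A y)⁻¹ i j) x := by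
  simp_rw [Matrix.inv_def, Matrix.smul_apply, Matrix.adjugate_apply, Ring.inverse_eq_inv',
    smul_eq_mul]
  refine ((contDiffAt_det hA).inv hx).mul (contDiffAt_det fun a b => ?_)
  simp_rw [Matrix.updateRow_apply]
  split_ifs
  · exact contDiffAt_const
  · exact hA _ _

theorem contDiffAt_gramMat {L : W → EuclideanSpace ℝ (Fin n) →L[ℝ] E} {x : W} {k : ℕ∞ω}
    (hL : ContDiffAt ℝ k L x) (i j : Fin n) : ContDiffAt ℝ k (fun y => gramMat (L y) i j) x :=
  (hL.clm_apply (contDiffAt_const (c := EuclideanSpace.basisFun (Fin n) ℝ i))).inner ℝ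
    (hL.clm_apply (contDiffAt_const (c := EuclideanSpace.basisFun (Fin n) ℝ j)))

/-- The entries of the inverse Gram matrix are quotients of polynomials in the entries, with nonzero
denominator at `x`. This is the source of all smoothness statements about tangential projections. -/
theorem contDiffAt_pinv {L : W → EuclideanSpace ℝ (Fin n) →L[ℝ] E} {v : W → E} {x : W}
    {k : ℕ∞ω} (hL : ContDiffAt ℝ k L x) (hv : ContDiffAt ℝ k v x)
    (hx : Function.Injective (L x)) : ContDiffAt ℝ k (fun y => pinv (L y) (v y)) x := by
  unfold pinv
  refine ContDiffAt.sum fun i _ => ?_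
  refine ContDiffAt.sum fun j _ => ?_
  have h₁ := contDiffAt_matrix_inv (contDiffAt_gramMat hL) (det_gramMat_pos hx).ne' i j
  have h₂ := hv.inner ℝ (hL.clm_apply
    (contDiffAt_const (c := EuclideanSpace.basisFun (Fin n) ℝ j)))
  exact (h₁.mul h₂).smul contDiffAt_const

end PseudoInverse

/-! ### Directional derivatives on the immersed manifold, in charts -/

section Calculus

variable {n m : ℕ} {M : Type*} [TopologicalSpace M] [ChartedSpace (EuclideanSpace ℝ (Fin n)) M]
  {f : M → EuclideanSpace ℝ (Fin m)} {V W : Type*} [NormedAddCommGroup V] [NormedSpace ℝ V]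
  [NormedAddCommGroup W] [NormedSpace ℝ W]

/-- `D_X u` in terms of a local parametrization `ψ`. -/
theorem D_eq_fderiv {ψ : W → M} {x ξ : W} {X : M → EuclideanSpace ℝ (Fin m)} {u : M → V}
    (hψ : MDifferentiableAt 𝓘(ℝ, W) (𝓡 n) ψ x)
    (hf : MDifferentiableAt (𝓡 n) (𝓡 m) f (ψ x)) (hu : MDifferentiableAt (𝓡 n) 𝓘(ℝ, V) u (ψ x))
    (hinj : Function.Injective (differential n f (ψ x)))
    (hξ : fderiv ℝ (f ∘ ψ) x ξ = X (ψ x)) :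
    D n f X u (ψ x) = fderiv ℝ (u ∘ ψ) x ξ := by
  have h1 : fderiv ℝ (f ∘ ψ) x ξ
      = differential n f (ψ x) (mfderiv 𝓘(ℝ, W) (𝓡 n) ψ x ξ) := by
    rw [← mfderiv_eq_fderiv, mfderiv_comp x hf hψ]; rfl
  have h2 : fderiv ℝ (u ∘ ψ) x ξ
      = differential n u (ψ x) (mfderiv 𝓘(ℝ, W) (𝓡 n) ψ x ξ) := by
    rw [← mfderiv_eq_fderiv, mfderiv_comp x hu hψ]; rfl
  rw [D, h2, ← hξ, h1]
  congr 1
  exact Function.leftInverse_invFun hinj _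

/-- `D_X u` in terms of tangent vectors. -/
theorem D_eq_differential {X : M → EuclideanSpace ℝ (Fin m)} {u : M → V} {p : M}
    {ξ : EuclideanSpace ℝ (Fin n)} (hinj : Function.Injective (differential n f p))
    (hξ : differential n f p ξ = X p) : D n f X u p = differential n u p ξ := by
  rw [D, ← hξ]
  congr 1
  exact Function.leftInverse_invFun hinj _

theorem D_add_field {X Y Z : M → EuclideanSpace ℝ (Fin m)} {u : M → V} {p : M}
    (hinj : Function.Injective (differential n f p)) (hX : X p ∈ tangent n f p)
    (hY : Y p ∈ tangent n f p) (hZ : Z p = X p + Y p) :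
    D n f Z u p = D n f X u p + D n f Y u p := by
  obtain ⟨ξ, hξ⟩ := hX
  obtain ⟨η, hη⟩ := hY
  rw [D_eq_differential hinj hξ, D_eq_differential hinj hη,
    D_eq_differential (ξ := ξ + η) hinj (by rw [hZ, map_add, ← hξ, ← hη]; rfl), map_add]

theorem D_smul_field {X Z : M → EuclideanSpace ℝ (Fin m)} {u : M → V} {p : M} {r : ℝ}
    (hinj : Function.Injective (differential n f p)) (hX : X p ∈ tangent n f p)
    (hZ : Z p = r • X p) : D n f Z u p = r • D n f X u p := by
  obtain ⟨ξ, hξ⟩ := hX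
  rw [D_eq_differential hinj hξ,
    D_eq_differential (ξ := r • ξ) hinj (by rw [hZ, map_smul, ← hξ]; rfl), map_smul]

theorem D_zero_field {X : M → EuclideanSpace ℝ (Fin m)} {u : M → V} {p : M}
    (hinj : Function.Injective (differential n f p)) (hX : X p = 0) : D n f X u p = 0 := by
  rw [D_eq_differential (ξ := 0) hinj (by rw [hX, map_zero]), map_zero]

theorem contMDiffAt_of_comp_chart_symm {u : M → V} {p : M}
    (hu : ContDiffAt ℝ ∞ (u ∘ (extChartAt (𝓡 n) p).symm) (extChartAt (𝓡 n) p p)) :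
    ContMDiffAt (𝓡 n) 𝓘(ℝ, V) ∞ u p := by
  have h := (contMDiffAt_iff_contDiffAt.2 hu).comp p (contMDiffAt_extChartAt (I := 𝓡 n) (n := ∞))
  refine h.congr_of_eventuallyEq ?_
  filter_upwards [extChartAt_source_mem_nhds (I := 𝓡 n) p] with q hq
  exact congrArg u ((extChartAt (𝓡 n) p).left_inv hq).symm

variable [IsManifold (𝓡 n) ∞ M]

theorem contMDiffAt_chart_symm {p : M} {x : EuclideanSpace ℝ (Fin n)}
    (hx : x ∈ (extChartAt (𝓡 n) p).target) :
    ContMDiffAt (𝓡 n) (𝓡 n) ∞ (extChartAt (𝓡 n) p).symm x :=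
  (contMDiffOn_extChartAt_symm p).contMDiffAt ((isOpen_extChartAt_target p).mem_nhds hx)

theorem contDiffAt_comp_chart_symm {u : M → V} {p : M} {x : EuclideanSpace ℝ (Fin n)}
    (hx : x ∈ (extChartAt (𝓡 n) p).target)
    (hu : ContMDiffAt (𝓡 n) 𝓘(ℝ, V) ∞ u ((extChartAt (𝓡 n) p).symm x)) :
    ContDiffAt ℝ ∞ (u ∘ (extChartAt (𝓡 n) p).symm) x :=
  (hu.comp x (contMDiffAt_chart_symm hx)).contDiffAt

/-- The chart composed with its inverse is the identity near `x`, so the derivative has a left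
inverse. -/
theorem mfderiv_chart_symm_injective {p : M} {x : EuclideanSpace ℝ (Fin n)}
    (hx : x ∈ (extChartAt (𝓡 n) p).target) :
    Function.Injective (mfderiv (𝓡 n) (𝓡 n) (extChartAt (𝓡 n) p).symm x) := by
  have hs : (extChartAt (𝓡 n) p).symm x ∈ (chartAt (EuclideanSpace ℝ (Fin n)) p).source := by
    rw [← extChartAt_source (𝓡 n)]; exact (extChartAt (𝓡 n) p).map_target hx
  have h1 := (contMDiffAt_chart_symm hx).mdifferentiableAt (by simp)
  have : IsManifold (𝓡 n) 1 M := IsManifold.of_le (n := ∞) (by norm_cast)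
  have h2 := mdifferentiableAt_extChartAt (I := 𝓡 n) hs
  have h3 : mfderiv (𝓡 n) (𝓡 n) (extChartAt (𝓡 n) p ∘ (extChartAt (𝓡 n) p).symm) x
      = mfderiv (𝓡 n) (𝓡 n) (id : EuclideanSpace ℝ (Fin n) → _) x := by
    apply Filter.EventuallyEq.mfderiv_eq
    filter_upwards [(isOpen_extChartAt_target (I := 𝓡 n) p).mem_nhds hx] with y hy
    exact (extChartAt (𝓡 n) p).right_inv hy
  rw [mfderiv_comp x h2 h1, mfderiv_id] at h3
  intro v w hvw
  have h4 := congrArg (fun L => L v) h3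
  have h5 := congrArg (fun L => L w) h3
  simp only [ContinuousLinearMap.comp_apply] at h4 h5
  rw [hvw, h5] at h4
  exact h4.symm

variable (hf : IsSmoothImmersion n f)
include hf

theorem fderiv_chart_apply {p : M} {x : EuclideanSpace ℝ (Fin n)}
    (hx : x ∈ (extChartAt (𝓡 n) p).target) (v : EuclideanSpace ℝ (Fin n)) :
    fderiv ℝ (f ∘ (extChartAt (𝓡 n) p).symm) x v
      = differential n f ((extChartAt (𝓡 n) p).symm x)
        (mfderiv (𝓡 n) (𝓡 n) (extChartAt (𝓡 n) p).symm x v) := by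
  rw [← mfderiv_eq_fderiv, mfderiv_comp x (hf.1.contMDiffAt.mdifferentiableAt (by simp))
    ((contMDiffAt_chart_symm hx).mdifferentiableAt (by simp))]
  rfl

theorem fderiv_chart_injective {p : M} {x : EuclideanSpace ℝ (Fin n)}
    (hx : x ∈ (extChartAt (𝓡 n) p).target) :
    Function.Injective (fderiv ℝ (f ∘ (extChartAt (𝓡 n) p).symm) x) := by
  intro v w hvw
  rw [fderiv_chart_apply hf hx, fderiv_chart_apply hf hx] at hvw
  exact mfderiv_chart_symm_injective hx (hf.2 _ hvw)

theorem range_fderiv_chart {p : M} {x : EuclideanSpace ℝ (Fin n)}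
    (hx : x ∈ (extChartAt (𝓡 n) p).target) :
    (fderiv ℝ (f ∘ (extChartAt (𝓡 n) p).symm) x).toLinearMap.range
      = tangent n f ((extChartAt (𝓡 n) p).symm x) := by
  ext v
  constructor
  · rintro ⟨w, rfl⟩
    exact ⟨_, (fderiv_chart_apply hf hx w).symm⟩
  · rintro ⟨w, rfl⟩
    let A : EuclideanSpace ℝ (Fin n) →ₗ[ℝ] EuclideanSpace ℝ (Fin n) :=
      (mfderiv (𝓡 n) (𝓡 n) (extChartAt (𝓡 n) p).symm x).toLinearMap
    have hA : Function.Surjective A := LinearMap.injective_iff_surjective.1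
      (mfderiv_chart_symm_injective hx)
    obtain ⟨z, hz⟩ := hA w
    refine ⟨z, ?_⟩
    change fderiv ℝ (f ∘ (extChartAt (𝓡 n) p).symm) x z = differential n f _ w
    rw [fderiv_chart_apply hf hx, ← hz]
    rfl

theorem apply_pinv_chart {p : M} {x : EuclideanSpace ℝ (Fin n)}
    (hx : x ∈ (extChartAt (𝓡 n) p).target) (v : EuclideanSpace ℝ (Fin m)) :
    fderiv ℝ (f ∘ (extChartAt (𝓡 n) p).symm) x
        (pinv (fderiv ℝ (f ∘ (extChartAt (𝓡 n) p).symm) x) v)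
      = (tangent n f ((extChartAt (𝓡 n) p).symm x)).starProjection v := by
  rw [apply_pinv (fderiv_chart_injective hf hx)]
  congr 2
  exact range_fderiv_chart hf hx

theorem contDiffAt_fderiv_chart {p : M} {x : EuclideanSpace ℝ (Fin n)}
    (hx : x ∈ (extChartAt (𝓡 n) p).target) :
    ContDiffAt ℝ ∞ (fderiv ℝ (f ∘ (extChartAt (𝓡 n) p).symm)) x :=
  (contDiffAt_comp_chart_symm hx hf.1.contMDiffAt).fderiv_right (by norm_cast)

/-- `D_X u` in a chart. -/
theorem D_chart {p : M} {x : EuclideanSpace ℝ (Fin n)} (hx : x ∈ (extChartAt (𝓡 n) p).target)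
    {X : M → EuclideanSpace ℝ (Fin m)} {u : M → V}
    (hX : X ((extChartAt (𝓡 n) p).symm x) ∈ tangent n f ((extChartAt (𝓡 n) p).symm x))
    (hu : MDifferentiableAt (𝓡 n) 𝓘(ℝ, V) u ((extChartAt (𝓡 n) p).symm x)) :
    D n f X u ((extChartAt (𝓡 n) p).symm x)
      = fderiv ℝ (u ∘ (extChartAt (𝓡 n) p).symm) x
        (pinv (fderiv ℝ (f ∘ (extChartAt (𝓡 n) p).symm) x) (X ((extChartAt (𝓡 n) p).symm x))) :=
  D_eq_fderiv ((contMDiffAt_chart_symm hx).mdifferentiableAt (by simp))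
    (hf.1.contMDiffAt.mdifferentiableAt (by simp)) hu (hf.2 _)
    (by rw [apply_pinv_chart hf hx, Submodule.starProjection_eq_self_iff.2 hX])

/-- In a chart, with `F` the immersion read there, the projection onto the tangent space is `DF ∘
pinv DF`, which is smooth. -/
theorem contMDiff_starProjection {v : M → EuclideanSpace ℝ (Fin m)}
    (hv : ContMDiff (𝓡 n) (𝓡 m) ∞ v) :
    ContMDiff (𝓡 n) (𝓡 m) ∞ fun q => (tangent n f q).starProjection (v q) := by
  intro p
  apply contMDiffAt_of_comp_chart_symm
  have hp := mem_extChartAt_target (I := 𝓡 n) p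
  have h := (contDiffAt_fderiv_chart hf hp).clm_apply (contDiffAt_pinv
    (contDiffAt_fderiv_chart hf hp) (contDiffAt_comp_chart_symm hp hv.contMDiffAt)
    (fderiv_chart_injective hf hp))
  refine h.congr_of_eventuallyEq ?_
  filter_upwards [(isOpen_extChartAt_target (I := 𝓡 n) p).mem_nhds hp] with y hy
  exact (apply_pinv_chart hf hy _).symm

/-- The pointwise inverse in the definition of `D` becomes the smooth expression `pinv DF` in a
chart, because the values of `X` are tangent. -/
theorem contMDiff_D {X : M → EuclideanSpace ℝ (Fin m)} {u : M → V} (hX : IsTangentField n f X)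
    (hu : ContMDiff (𝓡 n) 𝓘(ℝ, V) ∞ u) : ContMDiff (𝓡 n) 𝓘(ℝ, V) ∞ (D n f X u) := by
  intro p
  apply contMDiffAt_of_comp_chart_symm
  have hp := mem_extChartAt_target (I := 𝓡 n) p
  have h := ((contDiffAt_comp_chart_symm hp hu.contMDiffAt).fderiv_right (m := ∞)
    (by norm_cast)).clm_apply (contDiffAt_pinv (contDiffAt_fderiv_chart hf hp)
    (contDiffAt_comp_chart_symm hp hX.1.contMDiffAt) (fderiv_chart_injective hf hp))
  refine h.congr_of_eventuallyEq ?_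
  filter_upwards [(isOpen_extChartAt_target (I := 𝓡 n) p).mem_nhds hp] with y hy
  exact D_chart hf hy (hX.2 _) (hu.contMDiffAt.mdifferentiableAt (by simp))

end Calculus

end FlatNormal
end

noncomputable section

namespace FlatNormal

open scoped Topology RealInnerProductSpace

/-! ### Calculus of directional derivatives in a vector space -/

section DirectionalDerivative

variable {V G G₁ G₂ : Type*} [NormedAddCommGroup V] [NormedSpace ℝ V]
  [NormedAddCommGroup G] [NormedSpace ℝ G] [NormedAddCommGroup G₁] [NormedSpace ℝ G₁]
  [NormedAddCommGroup G₂] [NormedSpace ℝ G₂] {x₀ : V}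

/-- The derivative of `g` in the direction `v`. -/
def dd (v : V) (g : V → G) (x : V) : G := fderiv ℝ g x v

theorem contDiffAt_dd {g : V → G} (hg : ContDiffAt ℝ ∞ g x₀) (v : V) :
    ContDiffAt ℝ ∞ (dd v g) x₀ :=
  (hg.fderiv_right (m := ∞) (by norm_cast)).clm_apply contDiffAt_const

theorem eventually_differentiableAt {g : V → G} (hg : ContDiffAt ℝ ∞ g x₀) :
    ∀ᶠ x in 𝓝 x₀, DifferentiableAt ℝ g x := by
  have h1 : ContDiffAt ℝ 1 g x₀ := hg.of_le (by norm_cast)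
  filter_upwards [h1.eventually (by simp)] with x hx
  exact hx.differentiableAt (by simp)

/-- The rules of this section hold on a neighbourhood of `x₀`, not only at `x₀`, so that they can be
differentiated again by means of this lemma. -/
theorem dd_congr {g g' : V → G} (h : g =ᶠ[𝓝 x₀] g') (v : V) : dd v g =ᶠ[𝓝 x₀] dd v g' := by
  filter_upwards [h.fderiv (𝕜 := ℝ)] with x hx
  rw [dd, dd, hx]

theorem dd_const (v : V) (c : G) : dd v (fun _ => c) = fun _ => 0 := by
  funext x
  simp [dd]

theorem dd_clm (L : G₁ →L[ℝ] G) {g : V → G₁} (hg : ContDiffAt ℝ ∞ g x₀) (v : V) :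
    dd v (fun x => L (g x)) =ᶠ[𝓝 x₀] fun x => L (dd v g x) := by
  filter_upwards [eventually_differentiableAt hg] with x hx
  have h := (L.hasFDerivAt.comp x hx.hasFDerivAt).fderiv
  exact congrArg (fun T => T v) h

theorem dd_bilin (B : G₁ →L[ℝ] G₂ →L[ℝ] G) {g₁ : V → G₁} {g₂ : V → G₂}
    (h₁ : ContDiffAt ℝ ∞ g₁ x₀) (h₂ : ContDiffAt ℝ ∞ g₂ x₀) (v : V) :
    dd v (fun x => B (g₁ x) (g₂ x)) =ᶠ[𝓝 x₀]
      fun x => B (dd v g₁ x) (g₂ x) + B (g₁ x) (dd v g₂ x) := by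
  filter_upwards [eventually_differentiableAt h₁, eventually_differentiableAt h₂] with x hx hy
  have h := B.fderiv_of_bilinear hx hy
  simp [dd, h, add_comm]

theorem dd_add {g₁ g₂ : V → G}
    (h₁ : ContDiffAt ℝ ∞ g₁ x₀) (h₂ : ContDiffAt ℝ ∞ g₂ x₀) (v : V) :
    dd v (fun x => g₁ x + g₂ x) =ᶠ[𝓝 x₀] fun x => dd v g₁ x + dd v g₂ x := by
  filter_upwards [eventually_differentiableAt h₁, eventually_differentiableAt h₂] with x hx hy
  simp [dd, fderiv_fun_add hx hy]

theorem dd_sub {g₁ g₂ : V → G}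
    (h₁ : ContDiffAt ℝ ∞ g₁ x₀) (h₂ : ContDiffAt ℝ ∞ g₂ x₀) (v : V) :
    dd v (fun x => g₁ x - g₂ x) =ᶠ[𝓝 x₀] fun x => dd v g₁ x - dd v g₂ x := by
  filter_upwards [eventually_differentiableAt h₁, eventually_differentiableAt h₂] with x hx hy
  simp [dd, fderiv_fun_sub hx hy]

theorem dd_sum {ι : Type*} (s : Finset ι) {g : ι → V → G}
    (h : ∀ i, ContDiffAt ℝ ∞ (g i) x₀) (v : V) :
    dd v (fun x => ∑ i ∈ s, g i x) =ᶠ[𝓝 x₀] fun x => ∑ i ∈ s, dd v (g i) x := by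
  have : ∀ᶠ x in 𝓝 x₀, ∀ i ∈ s, DifferentiableAt ℝ (g i) x :=
    (Filter.eventually_all_finset s).2 fun i _ => eventually_differentiableAt (h i)
  filter_upwards [this] with x hx
  simp [dd, fderiv_fun_sum hx]

theorem dd_dd_apply {g : V → G} (hg : ContDiffAt ℝ ∞ g x₀) (v w : V) :
    dd v (dd w g) =ᶠ[𝓝 x₀] fun x => fderiv ℝ (fderiv ℝ g) x v w := by
  have hg' : ContDiffAt ℝ ∞ (fderiv ℝ g) x₀ := hg.fderiv_right (m := ∞) (by norm_cast)
  exact dd_clm (ContinuousLinearMap.apply ℝ G w) hg' v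

theorem dd_comm {g : V → G} (hg : ContDiffAt ℝ ∞ g x₀) (v w : V) :
    dd v (dd w g) =ᶠ[𝓝 x₀] dd w (dd v g) := by
  have h1 : ContDiffAt ℝ 2 g x₀ := hg.of_le (by norm_cast)
  filter_upwards [dd_dd_apply hg v w, dd_dd_apply hg w v, h1.eventually (by simp)] with x h h' hx
  rw [h, h']
  exact (hx.isSymmSndFDerivAt (by simp)) v w

/-- The second derivative of a bilinear expression. -/
theorem dd_dd_bilin (B : G₁ →L[ℝ] G₂ →L[ℝ] G) {g₁ : V → G₁} {g₂ : V → G₂}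
    (h₁ : ContDiffAt ℝ ∞ g₁ x₀) (h₂ : ContDiffAt ℝ ∞ g₂ x₀) (u v : V) :
    dd u (dd v fun x => B (g₁ x) (g₂ x)) x₀ =
      B (dd u (dd v g₁) x₀) (g₂ x₀) + B (dd v g₁ x₀) (dd u g₂ x₀)
        + B (dd u g₁ x₀) (dd v g₂ x₀) + B (g₁ x₀) (dd u (dd v g₂) x₀) := by
  have hB : ∀ {a : V → G₁} {b : V → G₂}, ContDiffAt ℝ ∞ a x₀ → ContDiffAt ℝ ∞ b x₀ →
      ContDiffAt ℝ ∞ (fun x => B (a x) (b x)) x₀ := fun ha hb =>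
    (B.contDiff.contDiffAt.comp x₀ ha).clm_apply hb
  rw [(dd_congr (dd_bilin B h₁ h₂ v) u).eq_of_nhds,
    (dd_add (hB (contDiffAt_dd h₁ v) h₂) (hB h₁ (contDiffAt_dd h₂ v)) u).eq_of_nhds,
    (dd_bilin B (contDiffAt_dd h₁ v) h₂ u).eq_of_nhds,
    (dd_bilin B h₁ (contDiffAt_dd h₂ v) u).eq_of_nhds]
  abel

end DirectionalDerivative

/-! ### Graphs over a tangent space: derivatives of the tangential projection -/

section Graph

variable {E : Type*} [NormedAddCommGroup E] [InnerProductSpace ℝ E] [FiniteDimensional ℝ E]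

/-- `F` is a local graph over the subspace `T`, tangent to it at `x₀`, and `P x` is the projection
onto its tangent space at `F x`. -/
structure IsGraph (T : Submodule ℝ E) (x₀ : T) (F : T → E) (P : T → E →L[ℝ] E) : Prop where
  contDiffAt_F : ContDiffAt ℝ ∞ F x₀
  contDiffAt_P : ContDiffAt ℝ ∞ P x₀
  proj : ∀ᶠ x in 𝓝 x₀, T.orthogonalProjectionOnto (F x) = x
  symm : ∀ᶠ x in 𝓝 x₀, ∀ v w, ⟪P x v, w⟫ = ⟪v, P x w⟫
  idem : ∀ᶠ x in 𝓝 x₀, ∀ v, P x (P x v) = P x v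
  tang : ∀ᶠ x in 𝓝 x₀, ∀ v, P x (fderiv ℝ F x v) = fderiv ℝ F x v
  rng : ∀ᶠ x in 𝓝 x₀, ∀ v, fderiv ℝ F x (T.orthogonalProjectionOnto (P x v)) = P x v
  base : P x₀ = T.starProjection

namespace IsGraph

variable {T : Submodule ℝ E} {x₀ : T} {F : T → E} {P : T → E →L[ℝ] E}

theorem P_of_mem (h : IsGraph T x₀ F P) {v : E} (hv : v ∈ T) : P x₀ v = v := by
  rw [h.base, Submodule.starProjection_eq_self_iff.2 hv]

theorem P_of_orthogonal (h : IsGraph T x₀ F P) {v : E} (hv : v ∈ Tᗮ) : P x₀ v = 0 := by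
  rw [h.base, (Submodule.starProjection_apply_eq_zero_iff T).2 hv]

theorem P_mem (h : IsGraph T x₀ F P) (v : E) : P x₀ v ∈ T := by
  rw [h.base]; exact Submodule.starProjection_apply_mem _ _

theorem dd_F (h : IsGraph T x₀ F P) (v : T) : dd v F x₀ = v := by
  have := h.rng.self_of_nhds v
  rwa [h.P_of_mem v.2, Submodule.orthogonalProjectionOnto_mem_subspace_eq_self] at this

/-- The projection to `T` is a fixed linear map and commutes with differentiation. Since a graph
satisfies `π F(x) = x`, iterating this shows that the second and higher derivatives of `F` take
values in `Tᗮ`. -/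
theorem proj_dd (w : T) {g : T → E} {c : T} (hg : ContDiffAt ℝ ∞ g x₀)
    (h : ∀ᶠ x in 𝓝 x₀, T.orthogonalProjectionOnto (g x) = c) :
    ∀ᶠ x in 𝓝 x₀, T.orthogonalProjectionOnto (dd w g x) = 0 := by
  have h1 : dd w (fun x => T.orthogonalProjectionOnto (g x)) =ᶠ[𝓝 x₀] dd w fun _ => c :=
    dd_congr h w
  filter_upwards [h1, dd_clm T.orthogonalProjectionOnto hg w] with x hx hy
  rw [← hy, hx, dd_const]

theorem proj_dd_F (h : IsGraph T x₀ F P) (w : T) :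
    ∀ᶠ x in 𝓝 x₀, T.orthogonalProjectionOnto (dd w F x) = w := by
  have h1 : dd w (fun x => T.orthogonalProjectionOnto (F x)) =ᶠ[𝓝 x₀] dd w fun x => x :=
    dd_congr h.proj w
  filter_upwards [h1, dd_clm T.orthogonalProjectionOnto h.contDiffAt_F w] with x hx hy
  rw [← hy, hx, dd, fderiv_fun_id, ContinuousLinearMap.id_apply]

theorem contDiffAt_F₂ (h : IsGraph T x₀ F P) (v w : T) :
    ContDiffAt ℝ ∞ (dd v (dd w F)) x₀ :=
  contDiffAt_dd (contDiffAt_dd h.contDiffAt_F w) v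

theorem contDiffAt_F₃ (h : IsGraph T x₀ F P) (u v w : T) :
    ContDiffAt ℝ ∞ (dd u (dd v (dd w F))) x₀ :=
  contDiffAt_dd (h.contDiffAt_F₂ v w) u

theorem proj_F₂ (h : IsGraph T x₀ F P) (v w : T) :
    ∀ᶠ x in 𝓝 x₀, T.orthogonalProjectionOnto (dd v (dd w F) x) = 0 :=
  proj_dd v (contDiffAt_dd h.contDiffAt_F w) (h.proj_dd_F w)

theorem proj_F₃ (h : IsGraph T x₀ F P) (u v w : T) :
    ∀ᶠ x in 𝓝 x₀, T.orthogonalProjectionOnto (dd u (dd v (dd w F)) x) = 0 :=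
  proj_dd u (h.contDiffAt_F₂ v w) (h.proj_F₂ v w)

/-- This is the vanishing of the Christoffel symbols at `x₀`; it identifies `D²F` there with the
second fundamental form. -/
theorem F₂_mem (h : IsGraph T x₀ F P) (v w : T) : dd v (dd w F) x₀ ∈ Tᗮ :=
  Submodule.orthogonalProjectionOnto_eq_zero_iff.1 (h.proj_F₂ v w).self_of_nhds

theorem F₃_mem (h : IsGraph T x₀ F P) (u v w : T) : dd u (dd v (dd w F)) x₀ ∈ Tᗮ :=
  Submodule.orthogonalProjectionOnto_eq_zero_iff.1 (h.proj_F₃ u v w).self_of_nhds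

theorem F₄_mem (h : IsGraph T x₀ F P) (s u v w : T) :
    dd s (dd u (dd v (dd w F))) x₀ ∈ Tᗮ :=
  Submodule.orthogonalProjectionOnto_eq_zero_iff.1
    (proj_dd s (h.contDiffAt_F₃ u v w) (h.proj_F₃ u v w)).self_of_nhds

theorem contDiffAt_P_apply (h : IsGraph T x₀ F P) {g : T → E} (hg : ContDiffAt ℝ ∞ g x₀) :
    ContDiffAt ℝ ∞ (fun x => P x (g x)) x₀ := h.contDiffAt_P.clm_apply hg

theorem dd_P_apply (h : IsGraph T x₀ F P) {g : T → E} (hg : ContDiffAt ℝ ∞ g x₀) (v : T) :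
    dd v (fun x => P x (g x)) =ᶠ[𝓝 x₀] fun x => dd v P x (g x) + P x (dd v g x) :=
  dd_bilin (ContinuousLinearMap.id ℝ (E →L[ℝ] E)) h.contDiffAt_P hg v

theorem dd_dd_P_apply (h : IsGraph T x₀ F P) {g : T → E} (hg : ContDiffAt ℝ ∞ g x₀) (u v : T) :
    dd u (dd v fun x => P x (g x)) x₀ = dd u (dd v P) x₀ (g x₀) + dd v P x₀ (dd u g x₀)
      + dd u P x₀ (dd v g x₀) + P x₀ (dd u (dd v g) x₀) :=
  dd_dd_bilin (ContinuousLinearMap.id ℝ (E →L[ℝ] E)) h.contDiffAt_P hg u v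

/-- The derivative of the projection maps a tangent vector to the second fundamental form. -/
theorem dd_P_of_mem (h : IsGraph T x₀ F P) (v w : T) : dd v P x₀ (w : E) = dd v (dd w F) x₀ := by
  have hF := contDiffAt_dd h.contDiffAt_F w
  have h1 : (fun x => P x (dd w F x)) =ᶠ[𝓝 x₀] dd w F := by
    filter_upwards [h.tang] with x hx using hx w
  have h2 := (dd_congr h1 v).eq_of_nhds
  rw [(h.dd_P_apply hF v).eq_of_nhds, h.dd_F, h.P_of_orthogonal (h.F₂_mem v w), add_zero] at h2
  exact h2

theorem dd_P_symm (h : IsGraph T x₀ F P) (u : T) (v w : E) :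
    ⟪dd u P x₀ v, w⟫ = ⟪v, dd u P x₀ w⟫ := by
  have h1 : (fun x => innerSL ℝ w (P x v)) =ᶠ[𝓝 x₀] fun x => innerSL ℝ v (P x w) := by
    filter_upwards [h.symm] with x hx
    simpa [real_inner_comm] using hx v w
  have h2 := (dd_congr h1 u).eq_of_nhds
  rw [(dd_clm _ (h.contDiffAt_P_apply contDiffAt_const) u).eq_of_nhds,
    (dd_clm _ (h.contDiffAt_P_apply contDiffAt_const) u).eq_of_nhds,
    (h.dd_P_apply contDiffAt_const u).eq_of_nhds,
    (h.dd_P_apply contDiffAt_const u).eq_of_nhds, dd_const, dd_const] at h2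
  simpa [real_inner_comm] using h2

/-- Differentiating `P ∘ P = P` gives `DP ∘ P + P ∘ DP = DP`; on a normal vector the first term
drops, so `DP ν` is fixed by `P`. -/
theorem dd_P_mem (h : IsGraph T x₀ F P) (u : T) {ν : E} (hν : ν ∈ Tᗮ) : dd u P x₀ ν ∈ T := by
  have h1 : (fun x => P x (P x ν)) =ᶠ[𝓝 x₀] fun x => P x ν := by
    filter_upwards [h.idem] with x hx using hx ν
  have h2 := (dd_congr h1 u).eq_of_nhds
  rw [(h.dd_P_apply (h.contDiffAt_P_apply contDiffAt_const) u).eq_of_nhds,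
    (h.dd_P_apply contDiffAt_const u).eq_of_nhds, dd_const, h.P_of_orthogonal hν] at h2
  simp only [map_zero, zero_add, add_zero] at h2
  rw [← h2]
  exact h.P_mem _

/-- On normal vectors `DP` is the shape operator: the adjoint of the second fundamental form, by
symmetry of `DP`. -/
theorem inner_dd_P (h : IsGraph T x₀ F P) (u w : T) (ν : E) :
    ⟪dd u P x₀ ν, (w : E)⟫ = ⟪dd u (dd w F) x₀, ν⟫ := by
  rw [h.dd_P_symm, h.dd_P_of_mem, real_inner_comm]

/-- Two derivatives of `P ∘ P = P` give four terms. For `P w = w` the term `D²P w` cancels against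
the right-hand side; for `P w = 0`, treated next, that term is absent. The two cases lead to the
tangential and the normal diagonal blocks of `D²P`. -/
theorem P_dd_dd_P (h : IsGraph T x₀ F P) (u v : T) {w : E} (hw : w ∈ T) :
    P x₀ (dd u (dd v P) x₀ w) = -(dd v P x₀ (dd u P x₀ w) + dd u P x₀ (dd v P x₀ w)) := by
  have h1 : (fun x => P x (P x w)) =ᶠ[𝓝 x₀] fun x => P x w := by
    filter_upwards [h.idem] with x hx using hx w
  have h2 := (dd_congr (dd_congr h1 v) u).eq_of_nhds
  have hc : ContDiffAt ℝ ∞ (fun _ : T => w) x₀ := contDiffAt_const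
  rw [h.dd_dd_P_apply (h.contDiffAt_P_apply hc), h.dd_dd_P_apply hc,
    (h.dd_P_apply hc u).eq_of_nhds, (h.dd_P_apply hc v).eq_of_nhds, h.P_of_mem hw] at h2
  simp only [dd_const, map_zero, add_zero] at h2
  rw [eq_neg_iff_add_eq_zero]
  rw [add_assoc, add_assoc, add_eq_left] at h2
  rw [← h2]; abel

theorem dd_dd_P_of_orthogonal (h : IsGraph T x₀ F P) (u v : T) {w : E} (hw : w ∈ Tᗮ) :
    dd u (dd v P) x₀ w - P x₀ (dd u (dd v P) x₀ w)
      = dd v P x₀ (dd u P x₀ w) + dd u P x₀ (dd v P x₀ w) := by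
  have h1 : (fun x => P x (P x w)) =ᶠ[𝓝 x₀] fun x => P x w := by
    filter_upwards [h.idem] with x hx using hx w
  have h2 := (dd_congr (dd_congr h1 v) u).eq_of_nhds
  have hc : ContDiffAt ℝ ∞ (fun _ : T => w) x₀ := contDiffAt_const
  rw [h.dd_dd_P_apply (h.contDiffAt_P_apply hc), h.dd_dd_P_apply hc,
    (h.dd_P_apply hc u).eq_of_nhds, (h.dd_P_apply hc v).eq_of_nhds, h.P_of_orthogonal hw] at h2
  simp only [dd_const, map_zero, add_zero, zero_add] at h2
  rw [sub_eq_iff_eq_add]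
  exact h2.symm

theorem inner_dd_dd_P_tangent (h : IsGraph T x₀ F P) (u v : T) (a b : T) :
    ⟪dd u (dd v P) x₀ (a : E), (b : E)⟫ =
      -(⟪dd u (dd a F) x₀, dd v (dd b F) x₀⟫ + ⟪dd v (dd a F) x₀, dd u (dd b F) x₀⟫) := by
  have h1 : ⟪dd u (dd v P) x₀ (a : E), (b : E)⟫ = ⟪P x₀ (dd u (dd v P) x₀ (a : E)), (b : E)⟫ := by
    rw [h.symm.self_of_nhds, h.P_of_mem b.2]
  rw [h1, h.P_dd_dd_P u v a.2, h.dd_P_of_mem u a, h.dd_P_of_mem v a, inner_neg_left,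
    inner_add_left, h.dd_P_symm v _ b, h.dd_P_symm u _ b, h.dd_P_of_mem, h.dd_P_of_mem]

theorem inner_dd_dd_P_normal (h : IsGraph T x₀ F P) (u v : T) {a b : E} (ha : a ∈ Tᗮ)
    (hb : b ∈ Tᗮ) : ⟪dd u (dd v P) x₀ a, b⟫ =
      ⟪dd u P x₀ a, dd v P x₀ b⟫ + ⟪dd v P x₀ a, dd u P x₀ b⟫ := by
  have h1 : ⟪dd u (dd v P) x₀ a, b⟫
      = ⟪dd u (dd v P) x₀ a - P x₀ (dd u (dd v P) x₀ a), b⟫ := by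
    rw [inner_sub_left, h.symm.self_of_nhds _ b, h.P_of_orthogonal hb, inner_zero_right, sub_zero]
  rw [h1, h.dd_dd_P_of_orthogonal u v ha, inner_add_left, h.dd_P_symm v, h.dd_P_symm u _ b]

end IsGraph

end Graph

end FlatNormal
end

noncomputable section

namespace FlatNormal

open scoped Topology RealInnerProductSpace

/-! ### Graphs: second derivatives of the metric, of `A` and of `|A|²` -/

section Graph

variable {E : Type*} [NormedAddCommGroup E] [InnerProductSpace ℝ E] [FiniteDimensional ℝ E]

/-- The real inner product as a continuous bilinear map. -/
def innerL (E : Type*) [NormedAddCommGroup E] [InnerProductSpace ℝ E] : E →L[ℝ] E →L[ℝ] ℝ :=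
  innerSL ℝ

theorem innerL_apply {E : Type*} [NormedAddCommGroup E] [InnerProductSpace ℝ E] (v w : E) :
    innerL E v w = ⟪v, w⟫ := rfl

namespace IsGraph

variable {T : Submodule ℝ E} {x₀ : T} {F : T → E} {P : T → E →L[ℝ] E}

/-- The coefficient `⟨P a, b⟩` of the inverse metric of a graph. -/
def invMetric (P : T → E →L[ℝ] E) (a b : T) (x : T) : ℝ := ⟪P x a, (b : E)⟫

/-- The second fundamental form of a graph in its coordinates. -/
def sff (F : T → E) (P : T → E →L[ℝ] E) (a b : T) (x : T) : E :=
  dd a (dd b F) x - P x (dd a (dd b F) x)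

/-- The mean curvature vector of a graph. -/
def mean {ι : Type*} [Fintype ι] (F : T → E) (P : T → E →L[ℝ] E) (t : ι → T) (x : T) : E :=
  ∑ i, ∑ j, invMetric P (t i) (t j) x • sff F P (t i) (t j) x

/-- The squared norm of the second fundamental form of a graph. -/
def sffNormSq {ι : Type*} [Fintype ι] (F : T → E) (P : T → E →L[ℝ] E) (t : ι → T) (x : T) : ℝ :=
  ∑ i, ∑ j, ∑ k, ∑ l, invMetric P (t i) (t k) x * (invMetric P (t j) (t l) x *
    ⟪sff F P (t i) (t j) x, dd (t k) (dd (t l) F) x⟫)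

/-- The projection to `T` inverts `DF` on the tangent spaces, so `⟨P a, b⟩` is exactly the
coefficient `g^{ab}` of the inverse metric and no matrix has to be inverted. -/
theorem contDiffAt_invMetric (h : IsGraph T x₀ F P) (a b : T) :
    ContDiffAt ℝ ∞ (invMetric P a b) x₀ :=
  (h.contDiffAt_P_apply contDiffAt_const).inner ℝ contDiffAt_const

theorem contDiffAt_sff (h : IsGraph T x₀ F P) (a b : T) : ContDiffAt ℝ ∞ (sff F P a b) x₀ :=
  (h.contDiffAt_F₂ a b).sub (h.contDiffAt_P_apply (h.contDiffAt_F₂ a b))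

theorem dd_invMetric_eq (h : IsGraph T x₀ F P) (a b v : T) :
    dd v (invMetric P a b) =ᶠ[𝓝 x₀] fun x => innerSL ℝ (b : E) (dd v P x a) := by
  have h1 : invMetric P a b = fun x => innerSL ℝ (b : E) (P x a) := by
    funext x; simp [invMetric, real_inner_comm]
  have h2 := dd_clm (innerSL ℝ (b : E)) (h.contDiffAt_P_apply (contDiffAt_const (c := (a : E)))) v
  rw [h1]
  filter_upwards [h2, h.dd_P_apply (contDiffAt_const (c := (a : E))) v] with x hx hy
  rw [hx, hy, dd_const, map_zero, add_zero]

/-- `DP` maps tangent vectors to normal ones. As the metric is stationary at `x₀`, product rules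
below retain the inverse metric undifferentiated or differentiated twice. -/
theorem dd_invMetric (h : IsGraph T x₀ F P) (a b v : T) : dd v (invMetric P a b) x₀ = 0 := by
  rw [(h.dd_invMetric_eq a b v).eq_of_nhds, h.dd_P_of_mem, innerSL_apply_apply]
  exact Submodule.inner_right_of_mem_orthogonal b.2 (h.F₂_mem v a)

theorem dd_dd_invMetric (h : IsGraph T x₀ F P) (a b u v : T) :
    dd u (dd v (invMetric P a b)) x₀ =
      -(⟪dd u (dd a F) x₀, dd v (dd b F) x₀⟫ + ⟪dd v (dd a F) x₀, dd u (dd b F) x₀⟫) := by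
  have hP := contDiffAt_dd h.contDiffAt_P v
  have hPa : dd u (fun x => dd v P x (a : E)) x₀ = dd u (dd v P) x₀ a :=
    (dd_clm (ContinuousLinearMap.apply ℝ E (a : E)) hP u).eq_of_nhds
  rw [(dd_congr (h.dd_invMetric_eq a b v) u).eq_of_nhds,
    (dd_clm _ (hP.clm_apply contDiffAt_const) u).eq_of_nhds, innerSL_apply_apply, real_inner_comm,
    hPa, h.inner_dd_dd_P_tangent]

theorem invMetric_base {ι : Type*} [DecidableEq ι] [Fintype ι] (h : IsGraph T x₀ F P)
    (t : OrthonormalBasis ι ℝ T) (i j : ι) :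
    invMetric P (t i) (t j) x₀ = if i = j then 1 else 0 := by
  rw [invMetric, h.P_of_mem (t i).2, ← Submodule.coe_inner, orthonormal_iff_ite.1 t.orthonormal]

theorem F₂_symm (h : IsGraph T x₀ F P) (a b : T) : dd a (dd b F) x₀ = dd b (dd a F) x₀ :=
  (dd_comm h.contDiffAt_F a b).eq_of_nhds

theorem F₃_symm₁ (h : IsGraph T x₀ F P) (a b c : T) :
    dd a (dd b (dd c F)) x₀ = dd b (dd a (dd c F)) x₀ :=
  (dd_comm (contDiffAt_dd h.contDiffAt_F c) a b).eq_of_nhds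

theorem F₃_symm₂ (h : IsGraph T x₀ F P) (a b c : T) :
    dd a (dd b (dd c F)) x₀ = dd a (dd c (dd b F)) x₀ :=
  (dd_congr (dd_comm h.contDiffAt_F b c) a).eq_of_nhds

/-- This exchange replaces the interchange of covariant derivatives in the classical proof of
Simons' identity; the curvature terms appear separately, through the derivatives of `P`. -/
theorem F₄_symm (h : IsGraph T x₀ F P) (a b c d : T) :
    dd a (dd b (dd c (dd d F))) x₀ = dd c (dd d (dd a (dd b F))) x₀ := by
  have hF := h.contDiffAt_F
  rw [(dd_congr (dd_comm (contDiffAt_dd hF d) b c) a).eq_of_nhds,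
    (dd_comm (h.contDiffAt_F₂ b d) a c).eq_of_nhds,
    (dd_congr (dd_congr (dd_comm hF b d) a) c).eq_of_nhds,
    (dd_congr (dd_comm (contDiffAt_dd hF b) a d) c).eq_of_nhds]

theorem sff_base (h : IsGraph T x₀ F P) (a b : T) : sff F P a b x₀ = dd a (dd b F) x₀ := by
  rw [sff, h.P_of_orthogonal (h.F₂_mem a b), sub_zero]

/-- The correction term is tangential, so the normal part of the derivative, which is `∇A`, is the
third derivative of `F`. -/
theorem dd_sff (h : IsGraph T x₀ F P) (a b v : T) : dd v (sff F P a b) x₀ =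
    dd v (dd a (dd b F)) x₀ - dd v P x₀ (dd a (dd b F) x₀) := by
  have h2 := h.contDiffAt_F₂ a b
  have h3 := (dd_sub h2 (h.contDiffAt_P_apply h2) v).eq_of_nhds
  rw [(h.dd_P_apply h2 v).eq_of_nhds, h.P_of_orthogonal (h.F₃_mem v a b), add_zero] at h3
  exact h3

theorem dd_dd_sff (h : IsGraph T x₀ F P) (a b u v : T) : dd u (dd v (sff F P a b)) x₀ =
    dd u (dd v (dd a (dd b F))) x₀ - (dd u (dd v P) x₀ (dd a (dd b F) x₀)
      + dd v P x₀ (dd u (dd a (dd b F)) x₀) + dd u P x₀ (dd v (dd a (dd b F)) x₀)) := by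
  have h2 := h.contDiffAt_F₂ a b
  have hP2 := h.contDiffAt_P_apply h2
  have h3 := (dd_congr (dd_sub h2 hP2 v) u).eq_of_nhds
  rw [(dd_sub (contDiffAt_dd h2 v) (contDiffAt_dd hP2 v) u).eq_of_nhds, h.dd_dd_P_apply h2,
    h.P_of_orthogonal (h.F₄_mem u v a b), add_zero] at h3
  exact h3

omit [FiniteDimensional ℝ E] in
theorem inner_of_mem {a b : E} (ha : a ∈ T) (hb : b ∈ Tᗮ) : ⟪a, b⟫ = 0 :=
  Submodule.inner_right_of_mem_orthogonal ha hb

variable {ι : Type*} [Fintype ι] (t : OrthonormalBasis ι ℝ T)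

theorem inner_dd_P_dd_P (h : IsGraph T x₀ F P) (u v : T) {a b : E} (ha : a ∈ Tᗮ) (hb : b ∈ Tᗮ) :
    ⟪dd u P x₀ a, dd v P x₀ b⟫ = ∑ k, ⟪dd u (dd (t k) F) x₀, a⟫ * ⟪dd v (dd (t k) F) x₀, b⟫ := by
  have h1 := t.sum_inner_mul_inner ⟨_, h.dd_P_mem u ha⟩ ⟨_, h.dd_P_mem v hb⟩
  simp only [Submodule.coe_inner] at h1
  rw [← h1]
  refine Finset.sum_congr rfl fun k _ => ?_
  rw [h.inner_dd_P, real_inner_comm (dd v P x₀ b), h.inner_dd_P]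

/-- The mixed terms pair tangential with normal vectors and vanish; the sum over `k` comes from the
normal block of `D²P`. It suffices to project one of the two factors, since `P` is symmetric and
idempotent. -/
theorem dd_dd_inner_sff (h : IsGraph T x₀ F P) (v a b c d : T) :
    dd v (dd v fun x => ⟪sff F P a b x, dd c (dd d F) x⟫) x₀ =
      ⟪dd v (dd v (dd a (dd b F))) x₀, dd c (dd d F) x₀⟫
        + ⟪dd a (dd b F) x₀, dd v (dd v (dd c (dd d F))) x₀⟫
        + 2 * ⟪dd v (dd a (dd b F)) x₀, dd v (dd c (dd d F)) x₀⟫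
        - 2 * ∑ k, ⟪dd v (dd (t k) F) x₀, dd a (dd b F) x₀⟫
          * ⟪dd v (dd (t k) F) x₀, dd c (dd d F) x₀⟫ := by
  have e1 := dd_dd_bilin (innerL E) (h.contDiffAt_sff a b) (h.contDiffAt_F₂ c d) v v
  simp only [innerL_apply] at e1
  rw [e1, h.dd_dd_sff, h.dd_sff, h.sff_base]
  have n1 := h.F₂_mem a b
  have n2 := h.F₂_mem c d
  have z1 : ⟪dd v P x₀ (dd a (dd b F) x₀), dd v (dd c (dd d F)) x₀⟫ = 0 :=
    inner_of_mem (h.dd_P_mem v n1) (h.F₃_mem _ _ _)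
  have z2 : ⟪dd v P x₀ (dd v (dd a (dd b F)) x₀), dd c (dd d F) x₀⟫ = 0 :=
    inner_of_mem (h.dd_P_mem v (h.F₃_mem _ _ _)) n2
  simp only [inner_sub_left, inner_add_left, z1, z2, h.inner_dd_dd_P_normal v v n1 n2,
    h.inner_dd_P_dd_P t v v n1 n2]
  ring

theorem contDiffAt_sffNormSq_summand (h : IsGraph T x₀ F P) (a b c d : T) :
    ContDiffAt ℝ ∞ (fun x => invMetric P a c x * (invMetric P b d x *
      ⟪sff F P a b x, dd c (dd d F) x⟫)) x₀ :=
  (h.contDiffAt_invMetric a c).mul ((h.contDiffAt_invMetric b d).mul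
    ((h.contDiffAt_sff a b).inner ℝ (h.contDiffAt_F₂ c d)))

omit [FiniteDimensional ℝ E] in
theorem sffNormSq_eq_sum :
    sffNormSq F P t = fun x => ∑ q : ι × ι × ι × ι,
      invMetric P (t q.1) (t q.2.2.1) x * (invMetric P (t q.2.1) (t q.2.2.2) x *
      ⟪sff F P (t q.1) (t q.2.1) x, dd (t q.2.2.1) (dd (t q.2.2.2) F) x⟫) := by
  funext x
  simp only [Fintype.sum_prod_type]
  rfl

theorem sffNormSq_base (h : IsGraph T x₀ F P) :
    sffNormSq F P t x₀ = ∑ i, ∑ j, ‖dd (t i) (dd (t j) F) x₀‖ ^ 2 := by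
  classical
  simp [sffNormSq, h.invMetric_base, h.sff_base]

theorem dd_sffNormSq (h : IsGraph T x₀ F P) (v : T) :
    dd v (sffNormSq F P t) x₀ =
      2 * ∑ i, ∑ j, ⟪dd (t i) (dd (t j) F) x₀, dd v (dd (t i) (dd (t j) F)) x₀⟫ := by
  classical
  have hd : ∀ a b c d : T, dd v (fun x => invMetric P a c x * (invMetric P b d x *
      ⟪sff F P a b x, dd c (dd d F) x⟫)) x₀ = invMetric P a c x₀ * (invMetric P b d x₀ *
        (⟪dd v (dd a (dd b F)) x₀, dd c (dd d F) x₀⟫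
          + ⟪dd a (dd b F) x₀, dd v (dd c (dd d F)) x₀⟫)) := by
    intro a b c d
    have hr := (h.contDiffAt_sff a b).inner ℝ (h.contDiffAt_F₂ c d)
    have e1 := (dd_bilin (ContinuousLinearMap.mul ℝ ℝ) (h.contDiffAt_invMetric a c)
      ((h.contDiffAt_invMetric b d).mul hr) v).eq_of_nhds
    have e2 := (dd_bilin (ContinuousLinearMap.mul ℝ ℝ) (h.contDiffAt_invMetric b d) hr v).eq_of_nhds
    have e3 := (dd_bilin (innerL E) (h.contDiffAt_sff a b) (h.contDiffAt_F₂ c d) v).eq_of_nhds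
    simp only [ContinuousLinearMap.mul_apply', innerL_apply] at e1 e2 e3
    rw [e1, e2, e3, h.dd_invMetric, h.dd_invMetric, h.dd_sff, h.sff_base, inner_sub_left,
      inner_of_mem (h.dd_P_mem v (h.F₂_mem a b)) (h.F₂_mem c d)]
    ring
  rw [sffNormSq_eq_sum, (dd_sum _ (fun q => h.contDiffAt_sffNormSq_summand _ _ _ _) v).eq_of_nhds]
  simp only [hd, Fintype.sum_prod_type, h.invMetric_base, Finset.mul_sum]
  simp only [ite_mul, one_mul, zero_mul, Finset.sum_ite_eq, Finset.mem_univ, if_true,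
    Finset.sum_ite_irrel, Finset.sum_const_zero]
  refine Finset.sum_congr rfl fun i _ => Finset.sum_congr rfl fun j _ => ?_
  rw [real_inner_comm]
  ring

/-- The squared products come from differentiating the projection twice, and the last sum from
differentiating the inverse metric twice: once in each pair of indices, with equal contributions by
the symmetry of `A`. -/
theorem dd_dd_sffNormSq (h : IsGraph T x₀ F P) (v : T) :
    dd v (dd v (sffNormSq F P t)) x₀ =
      2 * (∑ i, ∑ j, ⟪dd (t i) (dd (t j) F) x₀, dd v (dd v (dd (t i) (dd (t j) F))) x₀⟫
        + ∑ i, ∑ j, ‖dd v (dd (t i) (dd (t j) F)) x₀‖ ^ 2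
        - ∑ i, ∑ j, ∑ k, ⟪dd v (dd (t k) F) x₀, dd (t i) (dd (t j) F) x₀⟫ ^ 2
        - 2 * ∑ i, ∑ j, ∑ k, ⟪dd v (dd (t i) F) x₀, dd v (dd (t k) F) x₀⟫
          * ⟪dd (t i) (dd (t j) F) x₀, dd (t k) (dd (t j) F) x₀⟫) := by
  classical
  have hd : ∀ a b c d : T, dd v (dd v (fun x => invMetric P a c x * (invMetric P b d x *
      ⟪sff F P a b x, dd c (dd d F) x⟫))) x₀ =
        (-2 * ⟪dd v (dd a F) x₀, dd v (dd c F) x₀⟫) * (invMetric P b d x₀ *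
          ⟪dd a (dd b F) x₀, dd c (dd d F) x₀⟫)
        + invMetric P a c x₀ * ((-2 * ⟪dd v (dd b F) x₀, dd v (dd d F) x₀⟫) *
          ⟪dd a (dd b F) x₀, dd c (dd d F) x₀⟫)
        + invMetric P a c x₀ * (invMetric P b d x₀ *
          dd v (dd v fun x => ⟪sff F P a b x, dd c (dd d F) x⟫) x₀) := by
    intro a b c d
    have hr := (h.contDiffAt_sff a b).inner ℝ (h.contDiffAt_F₂ c d)
    have e1 := dd_dd_bilin (ContinuousLinearMap.mul ℝ ℝ) (h.contDiffAt_invMetric a c)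
      ((h.contDiffAt_invMetric b d).mul hr) v v
    have e2 := dd_dd_bilin (ContinuousLinearMap.mul ℝ ℝ) (h.contDiffAt_invMetric b d) hr v v
    simp only [ContinuousLinearMap.mul_apply'] at e1 e2
    rw [e1, e2, h.dd_invMetric, h.dd_invMetric, h.dd_dd_invMetric, h.dd_dd_invMetric, h.sff_base]
    ring
  rw [sffNormSq_eq_sum, (dd_congr (dd_sum _ (fun q => h.contDiffAt_sffNormSq_summand _ _ _ _) v)
    v).eq_of_nhds, (dd_sum _ (fun q => contDiffAt_dd (h.contDiffAt_sffNormSq_summand _ _ _ _) v)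
    v).eq_of_nhds]
  simp only [hd, h.dd_dd_inner_sff t, Fintype.sum_prod_type, h.invMetric_base,
    Finset.sum_add_distrib]
  set X := ∑ i, ∑ j, ∑ k, ⟪dd v (dd (t i) F) x₀, dd v (dd (t k) F) x₀⟫
    * ⟪dd (t i) (dd (t j) F) x₀, dd (t k) (dd (t j) F) x₀⟫ with hX
  have s1 : ∑ i, ∑ j, ∑ k, ∑ l, -2 * ⟪dd v (dd (t i) F) x₀, dd v (dd (t k) F) x₀⟫ *
      ((if j = l then 1 else 0) * ⟪dd (t i) (dd (t j) F) x₀, dd (t k) (dd (t l) F) x₀⟫) =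
      -2 * X := by
    simp [hX, Finset.mul_sum, mul_assoc]
  have s2 : ∑ i, ∑ j, ∑ k, ∑ l, (if i = k then 1 else 0) *
      (-2 * ⟪dd v (dd (t j) F) x₀, dd v (dd (t l) F) x₀⟫ *
        ⟪dd (t i) (dd (t j) F) x₀, dd (t k) (dd (t l) F) x₀⟫) = -2 * X := by
    simp only [ite_mul, one_mul, zero_mul, Finset.sum_ite_eq, Finset.mem_univ, if_true,
      Finset.sum_ite_irrel, Finset.sum_const_zero, hX, Finset.mul_sum]
    rw [Finset.sum_comm]
    refine Finset.sum_congr rfl fun i _ => Finset.sum_congr rfl fun j _ =>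
      Finset.sum_congr rfl fun k _ => ?_
    rw [h.F₂_symm (t j) (t i), h.F₂_symm (t j) (t k), mul_assoc]
  rw [s1, s2]
  simp only [ite_mul, one_mul, zero_mul, Finset.sum_ite_eq, Finset.mem_univ, if_true,
      Finset.sum_ite_irrel, Finset.sum_const_zero, Finset.sum_sub_distrib, Finset.sum_add_distrib,
      ← Finset.mul_sum, real_inner_self_eq_norm_sq, ← sq]
  have s3 : ∑ i, ∑ j, ⟪dd v (dd v (dd (t i) (dd (t j) F))) x₀, dd (t i) (dd (t j) F) x₀⟫
      = ∑ i, ∑ j, ⟪dd (t i) (dd (t j) F) x₀, dd v (dd v (dd (t i) (dd (t j) F))) x₀⟫ := by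
    simp_rw [real_inner_comm]
  rw [s3]
  ring

end IsGraph

end Graph

end FlatNormal
end

noncomputable section

namespace FlatNormal

open scoped Topology RealInnerProductSpace

/-! ### Graphs: the Ricci equation and Simons' inequality -/

section Graph

variable {E : Type*} [NormedAddCommGroup E] [InnerProductSpace ℝ E] [FiniteDimensional ℝ E]

omit [FiniteDimensional ℝ E] in
/-- The contractions that enter Simons' identity, for a symmetric array `f` of vectors whose
shape operators commute. -/
theorem simons_contraction {ι : Type*} [Fintype ι] (f : ι → ι → E) (hs : ∀ i j, f i j = f j i)
    (hc : ∀ i j a b c d, ∑ k, ⟪f j k, f a b⟫ * ⟪f i k, f c d⟫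
      = ∑ k, ⟪f i k, f a b⟫ * ⟪f j k, f c d⟫) :
    ∑ i, ∑ j, ∑ k, ∑ l, (⟪f i k, f j l⟫ + ⟪f j k, f i l⟫) * ⟪f k l, f i j⟫
      = 2 * ∑ m, ∑ i, ∑ j, ∑ k, ⟪f m i, f m k⟫ * ⟪f i j, f k j⟫ := by
  have h1 : ∑ i, ∑ j, ∑ k, ∑ l, ⟪f i k, f j l⟫ * ⟪f k l, f i j⟫
      = ∑ m, ∑ i, ∑ j, ∑ k, ⟪f m i, f m k⟫ * ⟪f i j, f k j⟫ := by
    calc _ = ∑ i, ∑ j, ∑ l, ∑ k, ⟪f l k, f i j⟫ * ⟪f i k, f j l⟫ := by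
          refine Finset.sum_congr rfl fun i _ => Finset.sum_congr rfl fun j _ => ?_
          rw [Finset.sum_comm]
          refine Finset.sum_congr rfl fun l _ => Finset.sum_congr rfl fun k _ => ?_
          rw [hs l k]; ring
      -- Commuting shape operators allow `i` and `l` to trade places in the two factors containing
      -- `k`, which produces the index pattern of the right-hand side.
      _ = ∑ i, ∑ j, ∑ l, ∑ k, ⟪f i k, f i j⟫ * ⟪f l k, f j l⟫ := by simp_rw [hc]
      _ = ∑ i, ∑ j, ∑ k, ∑ l, ⟪f i k, f i j⟫ * ⟪f k l, f j l⟫ := by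
          refine Finset.sum_congr rfl fun i _ => Finset.sum_congr rfl fun j _ => ?_
          rw [Finset.sum_comm]
          refine Finset.sum_congr rfl fun k _ => Finset.sum_congr rfl fun l _ => ?_
          rw [hs l k]
      _ = _ := by
          refine Finset.sum_congr rfl fun i _ => ?_
          rw [Finset.sum_comm]
          exact Finset.sum_congr rfl fun k _ => Finset.sum_comm
  have h2 : ∑ i, ∑ j, ∑ k, ∑ l, ⟪f j k, f i l⟫ * ⟪f k l, f i j⟫
      = ∑ i, ∑ j, ∑ k, ∑ l, ⟪f i k, f j l⟫ * ⟪f k l, f i j⟫ := by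
    rw [Finset.sum_comm]
    refine Finset.sum_congr rfl fun i _ => Finset.sum_congr rfl fun j _ => ?_
    rw [hs j i]
  simp_rw [add_mul, Finset.sum_add_distrib]
  rw [h2, h1]
  ring

namespace IsGraph

variable {T : Submodule ℝ E} {x₀ : T} {F : T → E} {P : T → E →L[ℝ] E}

variable {G : Type*} [NormedAddCommGroup G] [NormedSpace ℝ G]

/-- The derivative of `g` along the projection of the constant field `v`. -/
def along (P : T → E →L[ℝ] E) (v : T) (g : T → G) (x : T) : G :=
  fderiv ℝ g x (T.orthogonalProjectionOnto (P x v))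

theorem contDiffAt_along (h : IsGraph T x₀ F P) {g : T → G} (hg : ContDiffAt ℝ ∞ g x₀) (v : T) :
    ContDiffAt ℝ ∞ (along P v g) x₀ :=
  (hg.fderiv_right (m := ∞) (by norm_cast)).clm_apply
    (T.orthogonalProjectionOnto.contDiff.contDiffAt.comp x₀ (h.contDiffAt_P_apply contDiffAt_const))

theorem along_base (h : IsGraph T x₀ F P) (v : T) (g : T → G) : along P v g x₀ = dd v g x₀ := by
  rw [along, h.P_of_mem v.2, Submodule.orthogonalProjectionOnto_mem_subspace_eq_self, dd]

/-- The fields `x ↦ P x v` are parallel at the base point. -/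
theorem dd_along (h : IsGraph T x₀ F P) {g : T → G} (hg : ContDiffAt ℝ ∞ g x₀) (u v : T) :
    dd u (along P v g) x₀ = dd u (dd v g) x₀ := by
  have hPv := h.contDiffAt_P_apply (contDiffAt_const (c := (v : E)))
  have h1 : dd u (fun x => T.orthogonalProjectionOnto (P x v)) x₀ = 0 := by
    rw [(dd_clm _ hPv u).eq_of_nhds, (h.dd_P_apply contDiffAt_const u).eq_of_nhds, dd_const,
      map_zero, add_zero, h.dd_P_of_mem]
    exact Submodule.orthogonalProjectionOnto_eq_zero_iff.2 (h.F₂_mem u v)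
  have hd : ContDiffAt ℝ ∞ (fderiv ℝ g) x₀ := hg.fderiv_right (m := ∞) (by norm_cast)
  have h2 := (dd_bilin (ContinuousLinearMap.id ℝ (T →L[ℝ] G)) hd
    (T.orthogonalProjectionOnto.contDiff.contDiffAt.comp x₀ hPv) u).eq_of_nhds
  refine h2.trans ?_
  rw [(dd_dd_apply hg u v).eq_of_nhds]
  simp only [ContinuousLinearMap.id_apply, Function.comp_apply]
  erw [h1]
  rw [map_zero, add_zero, h.P_of_mem v.2, Submodule.orthogonalProjectionOnto_mem_subspace_eq_self]
  rfl

/-- The normal part of the derivative of `g` along the projection of `v`. -/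
def alongN (P : T → E →L[ℝ] E) (v : T) (g : T → E) (x : T) : E :=
  along P v g x - P x (along P v g x)

/-- Product rule for `g' - P g'`: the term `P (D²g)` is orthogonal to `ν`, and `DP` moves to `ν` by
its symmetry. -/
theorem inner_dd_alongN (h : IsGraph T x₀ F P) {g : T → E} (hg : ContDiffAt ℝ ∞ g x₀) (u v : T)
    {ν : E} (hν : ν ∈ Tᗮ) : ⟪dd u (alongN P v g) x₀, ν⟫
      = ⟪dd u (dd v g) x₀, ν⟫ - ⟪dd v g x₀, dd u P x₀ ν⟫ := by
  have ha := h.contDiffAt_along hg v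
  have h1 := (dd_sub ha (h.contDiffAt_P_apply ha) u).eq_of_nhds
  rw [(h.dd_P_apply ha u).eq_of_nhds, h.dd_along hg, h.along_base] at h1
  have h2 : dd u (alongN P v g) x₀ = dd u (dd v g) x₀ -
    (dd u P x₀ (dd v g x₀) + P x₀ (dd u (dd v g) x₀)) := h1
  rw [h2, inner_sub_left, inner_add_left, h.dd_P_symm, inner_of_mem (h.P_mem _) hν, add_zero]

/-- The Ricci equation: commuting normal derivatives means commuting shape operators. -/
theorem inner_dd_P_comm (h : IsGraph T x₀ F P) (u v : T) {ν μ : E} (hμ : μ ∈ Tᗮ)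
    (hc : ⟪dd u (alongN P v fun x => ν - P x ν) x₀, μ⟫
      = ⟪dd v (alongN P u fun x => ν - P x ν) x₀, μ⟫) :
    ⟪dd v P x₀ ν, dd u P x₀ μ⟫ = ⟪dd u P x₀ ν, dd v P x₀ μ⟫ := by
  have hZ : ContDiffAt ℝ ∞ (fun x => ν - P x ν) x₀ :=
    contDiffAt_const.sub (h.contDiffAt_P_apply contDiffAt_const)
  have hd : ∀ w, dd w (fun x => ν - P x ν) x₀ = -dd w P x₀ ν := by
    intro w
    rw [(dd_sub contDiffAt_const (h.contDiffAt_P_apply contDiffAt_const) w).eq_of_nhds,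
      (h.dd_P_apply contDiffAt_const w).eq_of_nhds, dd_const]
    simp
  -- The second derivatives of the normal section agree in both orders. What is left is its first
  -- derivative `-DP ν`, paired with `DP μ`.
  rw [h.inner_dd_alongN hZ u v hμ, h.inner_dd_alongN hZ v u hμ, (dd_comm hZ u v).eq_of_nhds, hd,
    hd, inner_neg_left, inner_neg_left] at hc
  linarith

variable {ι : Type*} [Fintype ι] (t : OrthonormalBasis ι ℝ T)

theorem contDiffAt_mean_summand (h : IsGraph T x₀ F P) (a b : T) :
    ContDiffAt ℝ ∞ (fun x => invMetric P a b x • sff F P a b x) x₀ :=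
  (h.contDiffAt_invMetric a b).smul (h.contDiffAt_sff a b)

theorem contDiffAt_mean (h : IsGraph T x₀ F P) : ContDiffAt ℝ ∞ (mean F P t) x₀ := by
  refine ContDiffAt.sum fun i _ => ?_
  refine ContDiffAt.sum fun j _ => ?_
  exact h.contDiffAt_mean_summand _ _

omit [FiniteDimensional ℝ E] in
theorem mean_eq_sum : mean F P t = fun x => ∑ q : ι × ι,
    invMetric P (t q.1) (t q.2) x • sff F P (t q.1) (t q.2) x := by
  funext x
  simp only [Fintype.sum_prod_type]
  rfl

theorem mean_base (h : IsGraph T x₀ F P) : mean F P t x₀ = ∑ i, dd (t i) (dd (t i) F) x₀ := by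
  classical
  simp [mean, h.invMetric_base, h.sff_base]

theorem dd_mean (h : IsGraph T x₀ F P) (v : T) : dd v (mean F P t) x₀
    = ∑ i, dd v (dd (t i) (dd (t i) F)) x₀ - dd v P x₀ (∑ i, dd (t i) (dd (t i) F) x₀) := by
  classical
  have hd : ∀ a b : T, dd v (fun x => invMetric P a b x • sff F P a b x) x₀
      = invMetric P a b x₀ • (dd v (dd a (dd b F)) x₀ - dd v P x₀ (dd a (dd b F) x₀)) := by
    intro a b
    have e1 := (dd_bilin (ContinuousLinearMap.lsmul ℝ ℝ) (h.contDiffAt_invMetric a b)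
      (h.contDiffAt_sff a b) v).eq_of_nhds
    simp only [ContinuousLinearMap.lsmul_apply] at e1
    rw [e1, h.dd_invMetric, zero_smul, zero_add, h.dd_sff]
  rw [mean_eq_sum, (dd_sum _ (fun q => h.contDiffAt_mean_summand _ _) v).eq_of_nhds]
  simp [hd, Fintype.sum_prod_type, h.invMetric_base]

/-- The inverse metric is stationary, so only its second derivatives and those of the second
fundamental form survive in the trace. -/
theorem dd_dd_mean (h : IsGraph T x₀ F P) (u v : T) : dd u (dd v (mean F P t)) x₀
    = -∑ i, ∑ j, (⟪dd u (dd (t i) F) x₀, dd v (dd (t j) F) x₀⟫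
        + ⟪dd v (dd (t i) F) x₀, dd u (dd (t j) F) x₀⟫) • dd (t i) (dd (t j) F) x₀
      + ∑ i, dd u (dd v (sff F P (t i) (t i))) x₀ := by
  classical
  have hd : ∀ a b : T, dd u (dd v (fun x => invMetric P a b x • sff F P a b x)) x₀
      = -((⟪dd u (dd a F) x₀, dd v (dd b F) x₀⟫
        + ⟪dd v (dd a F) x₀, dd u (dd b F) x₀⟫) • dd a (dd b F) x₀)
        + invMetric P a b x₀ • dd u (dd v (sff F P a b)) x₀ := by
    intro a b
    have e1 := dd_dd_bilin (ContinuousLinearMap.lsmul ℝ ℝ) (h.contDiffAt_invMetric a b)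
      (h.contDiffAt_sff a b) u v
    simp only [ContinuousLinearMap.lsmul_apply] at e1
    rw [e1, h.dd_invMetric, h.dd_invMetric, zero_smul, zero_smul, add_zero, add_zero,
      h.dd_dd_invMetric, neg_smul, h.sff_base]
  rw [mean_eq_sum, (dd_congr (dd_sum _ (fun q => h.contDiffAt_mean_summand _ _) v) u).eq_of_nhds,
    (dd_sum _ (fun q => contDiffAt_dd (h.contDiffAt_mean_summand _ _) v) u).eq_of_nhds]
  simp only [hd, Fintype.sum_prod_type, h.invMetric_base, Finset.sum_add_distrib,
    Finset.sum_neg_distrib, ite_smul, one_smul, zero_smul, Finset.sum_ite_eq, Finset.mem_univ,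
    if_true]

/-- The second covariant derivative of the mean curvature at the base point. -/
theorem inner_hess_mean (h : IsGraph T x₀ F P) (u v : T) {ν : E} (hν : ν ∈ Tᗮ) :
    ⟪dd u (alongN P v (mean F P t)) x₀, ν⟫ =
      ∑ i, ⟪dd u (dd v (dd (t i) (dd (t i) F))) x₀, ν⟫
      - ∑ i, ∑ j, (⟪dd u (dd (t i) F) x₀, dd v (dd (t j) F) x₀⟫
        + ⟪dd v (dd (t i) F) x₀, dd u (dd (t j) F) x₀⟫) * ⟪dd (t i) (dd (t j) F) x₀, ν⟫
      - ∑ k, ⟪dd u (dd (t k) F) x₀, ∑ i, dd (t i) (dd (t i) F) x₀⟫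
        * ⟪dd v (dd (t k) F) x₀, ν⟫ := by
  have hH : ∑ i, dd (t i) (dd (t i) F) x₀ ∈ Tᗮ := Submodule.sum_mem _ fun i _ => h.F₂_mem _ _
  have h3 : ∑ i, dd v (dd (t i) (dd (t i) F)) x₀ ∈ Tᗮ :=
    Submodule.sum_mem _ fun i _ => h.F₃_mem _ _ _
  have hs : ∑ i, ⟪dd u (dd v P) x₀ (dd (t i) (dd (t i) F) x₀), ν⟫
      = ⟪dd u P x₀ (∑ i, dd (t i) (dd (t i) F) x₀), dd v P x₀ ν⟫
        + ⟪dd v P x₀ (∑ i, dd (t i) (dd (t i) F) x₀), dd u P x₀ ν⟫ := by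
    rw [← sum_inner, ← map_sum, h.inner_dd_dd_P_normal u v hH hν]
  have hz : ∀ a b c w : T, ⟪dd w P x₀ (dd a (dd b (dd c F)) x₀), ν⟫ = 0 := fun a b c w =>
    inner_of_mem (h.dd_P_mem _ (h.F₃_mem _ _ _)) hν
  have hz' : ⟪∑ i, dd v (dd (t i) (dd (t i) F)) x₀, dd u P x₀ ν⟫ = 0 := by
    rw [real_inner_comm]; exact inner_of_mem (h.dd_P_mem _ hν) h3
  rw [h.inner_dd_alongN (h.contDiffAt_mean t) u v hν, h.dd_dd_mean, h.dd_mean, inner_sub_left, hz',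
    inner_add_left, inner_neg_left, sum_inner, sum_inner]
  simp only [h.dd_dd_sff, inner_sub_left, inner_add_left, hz, add_zero, Finset.sum_sub_distrib, hs]
  rw [← h.inner_dd_P_dd_P t u v hH hν]
  simp only [sum_inner, inner_smul_left, conj_trivial]
  ring

theorem dd_dd_eq_fderiv (h : IsGraph T x₀ F P) (v w : T) :
    dd v (dd w F) x₀ = fderiv ℝ (fderiv ℝ F) x₀ v w :=
  (dd_dd_apply h.contDiffAt_F v w).eq_of_nhds

theorem dd_dd_dd_eq_fderiv (h : IsGraph T x₀ F P) (u v w : T) :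
    dd u (dd v (dd w F)) x₀ = fderiv ℝ (fderiv ℝ (fderiv ℝ F)) x₀ u v w := by
  have hF' : ContDiffAt ℝ ∞ (fderiv ℝ F) x₀ := h.contDiffAt_F.fderiv_right (m := ∞) (by norm_cast)
  have h1 : dd v (fderiv ℝ F) =ᶠ[𝓝 x₀] fun x => fderiv ℝ (fderiv ℝ F) x v :=
    Filter.EventuallyEq.rfl
  have h2 : dd v (dd w F) =ᶠ[𝓝 x₀]
      fun x => ContinuousLinearMap.apply ℝ E w (dd v (fderiv ℝ F) x) :=
    dd_dd_apply h.contDiffAt_F v w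
  rw [(dd_congr h2 u).eq_of_nhds, (dd_clm _ (contDiffAt_dd hF' v) u).eq_of_nhds,
    (dd_dd_apply hF' u v).eq_of_nhds]
  rfl

/-- Simons' inequality at the base point of a graph with commuting shape operators. -/
theorem simons_inequality (h : IsGraph T x₀ F P) {ε : ℝ} (hε : 0 < ε)
    (hc : ∀ u v : T, ∀ ν ∈ Tᗮ, ∀ μ ∈ Tᗮ, ⟪dd v P x₀ ν, dd u P x₀ μ⟫ = ⟪dd u P x₀ ν, dd v P x₀ μ⟫)
    {g : ℝ} (hg : sffNormSq F P t x₀ ≠ 0 →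
      4 * sffNormSq F P t x₀ * g = ∑ k, (dd (t k) (sffNormSq F P t) x₀) ^ 2)
    (hg₀ : sffNormSq F P t x₀ = 0 → g = 0) :
    (1 + 2 / ((Module.finrank ℝ T : ℝ) + ε)) * g
      + ∑ i, ∑ j, ⟪dd (t i) (dd (t j) F) x₀, dd (t i) (alongN P (t j) (mean F P t)) x₀⟫
      + ∑ i, ∑ j, ∑ k, ⟪mean F P t x₀, dd (t i) (dd (t j) F) x₀⟫
        * ⟪dd (t j) (dd (t k) F) x₀, dd (t k) (dd (t i) F) x₀⟫
      - sffNormSq F P t x₀ ^ 2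
      - katoConst (Module.finrank ℝ T) ε * ∑ k, ‖∑ i, dd (t k) (dd (t i) (dd (t i) F)) x₀‖ ^ 2
      ≤ 1 / 2 * ∑ k, dd (t k) (dd (t k) (sffNormSq F P t)) x₀ := by
  set f : ι → ι → E := fun i j => dd (t i) (dd (t j) F) x₀ with hf
  have hfs : ∀ i j, f i j = f j i := fun i j => h.F₂_symm _ _
  have hfm : ∀ i j, f i j ∈ Tᗮ := fun i j => h.F₂_mem _ _
  have hcomm : ∀ i j, ∀ ν ∈ Tᗮ, ∀ μ ∈ Tᗮ,
      ∑ k, ⟪f j k, ν⟫ * ⟪f i k, μ⟫ = ∑ k, ⟪f i k, ν⟫ * ⟪f j k, μ⟫ := by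
    intro i j ν hν μ hμ
    have := hc (t i) (t j) ν hν μ hμ
    rwa [h.inner_dd_P_dd_P t _ _ hν hμ, h.inner_dd_P_dd_P t _ _ hν hμ] at this
  -- the refined Kato inequality
  obtain ⟨T₀, hT₀, hk₁, hk₂⟩ := refined_kato hε (fderiv ℝ (fderiv ℝ F) x₀)
    (fderiv ℝ (fderiv ℝ (fderiv ℝ F)) x₀)
    (fun v w => by rw [← h.dd_dd_eq_fderiv, ← h.dd_dd_eq_fderiv, h.F₂_symm])
    (fun u v w => by rw [← h.dd_dd_dd_eq_fderiv, ← h.dd_dd_dd_eq_fderiv, h.F₃_symm₁])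
    (fun u v w => by rw [← h.dd_dd_dd_eq_fderiv, ← h.dd_dd_dd_eq_fderiv, h.F₃_symm₂]) t
    (fun i j ζ => by
      simp only [← h.dd_dd_eq_fderiv]
      have hsum : ∀ i j, ∑ k, ⟪f j k, ζ⟫ • f i k ∈ Tᗮ := fun i j =>
        Submodule.sum_mem _ fun k _ => Submodule.smul_mem _ _ (hfm _ _)
      -- The commutation is known for normal vectors only. Since the `f i j` are normal, `ζ` may be
      -- replaced by its normal part; the difference of the two sides is itself normal, and it is
      -- shown to be orthogonal to itself.
      have hζ : ∀ i j, ⟪f i j, ζ⟫ = ⟪f i j, Tᗮ.starProjection ζ⟫ := by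
        intro i j
        rw [← Submodule.inner_starProjection_left_eq_right,
          Submodule.starProjection_eq_self_iff.2 (hfm i j)]
      change ∑ k, ⟪f j k, ζ⟫ • f i k = ∑ k, ⟪f i k, ζ⟫ • f j k
      rw [← sub_eq_zero, ← inner_self_eq_zero (𝕜 := ℝ)]
      have hd := Submodule.sub_mem _ (hsum i j) (hsum j i)
      have hex : ∀ d ∈ Tᗮ, ⟪∑ k, ⟪f j k, ζ⟫ • f i k - ∑ k, ⟪f i k, ζ⟫ • f j k, d⟫ = 0 := by
        intro d hd
        simp only [inner_sub_left, sum_inner, inner_smul_left, conj_trivial, hζ _ _]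
        rw [hcomm i j _ (Submodule.starProjection_apply_mem _ _) d hd, sub_self]
      exact hex _ hd)
  simp only [← h.dd_dd_eq_fderiv, ← h.dd_dd_dd_eq_fderiv] at hk₁ hk₂
  -- Kato's inequality in the form `4 |A|² g = |∇|A|²|² ≤ 4 |A|² T₀`. At a zero of `|A|` nothing can
  -- be divided out, and the normalization `g = 0` is used instead.
  have hgT : g ≤ T₀ := by
    have h2 := h.sffNormSq_base t
    have h3 : ∑ k, (dd (t k) (sffNormSq F P t) x₀) ^ 2 ≤ 4 * (sffNormSq F P t x₀ * T₀) := by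
      rw [h2]
      refine le_trans (le_of_eq ?_) (mul_le_mul_of_nonneg_left hk₁ (by norm_num))
      rw [Finset.mul_sum]
      refine Finset.sum_congr rfl fun k _ => ?_
      rw [h.dd_sffNormSq]
      ring
    by_cases h0 : sffNormSq F P t x₀ = 0
    · rw [hg₀ h0]; exact hT₀
    · have h4 : 0 < sffNormSq F P t x₀ := lt_of_le_of_ne (by rw [h2]; positivity) (Ne.symm h0)
      rw [← hg h0] at h3
      nlinarith
  -- Simons' identity
  set A := ∑ i, ∑ j, ∑ m, ⟪f i j, dd (t m) (dd (t m) (dd (t i) (dd (t j) F))) x₀⟫ with hA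
  set B := ∑ k, ∑ i, ∑ j, ‖dd (t k) (dd (t i) (dd (t j) F)) x₀‖ ^ 2 with hB
  set Y := ∑ m, ∑ i, ∑ j, ∑ k, ⟪f m i, f m k⟫ * ⟪f i j, f k j⟫ with hY
  set Q := ∑ m, ∑ i, ∑ j, ∑ k, ⟪f m k, f i j⟫ ^ 2 with hQ
  set W := ∑ i, ∑ j, ∑ k, ⟪mean F P t x₀, f i j⟫ * ⟪f j k, f k i⟫ with hW
  have hlap : 1 / 2 * ∑ k, dd (t k) (dd (t k) (sffNormSq F P t)) x₀ = A + B - Q - 2 * Y := by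
    simp only [h.dd_dd_sffNormSq t, ← Finset.mul_sum, Finset.sum_add_distrib,
      Finset.sum_sub_distrib]
    have : ∑ m, ∑ i, ∑ j, ⟪f i j, dd (t m) (dd (t m) (dd (t i) (dd (t j) F))) x₀⟫ = A := by
      rw [Finset.sum_comm]
      exact Finset.sum_congr rfl fun i _ => Finset.sum_comm
    rw [this]
    ring
  -- The trace of the fourth derivative becomes `A` after exchanging index pairs, the metric terms
  -- contract to `2 * Y` because the shape operators commute, and `W` is the cubic term. Subtracting
  -- this from `hlap` leaves `B - Q + W`.
  have hhess : ∑ i, ∑ j, ⟪f i j, dd (t i) (alongN P (t j) (mean F P t)) x₀⟫ = A - 2 * Y - W := by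
    have h1 : ∀ i j, ⟪f i j, dd (t i) (alongN P (t j) (mean F P t)) x₀⟫ =
        ∑ m, ⟪f i j, dd (t m) (dd (t m) (dd (t i) (dd (t j) F))) x₀⟫
        - ∑ k, ∑ l, (⟪f i k, f j l⟫ + ⟪f j k, f i l⟫) * ⟪f k l, f i j⟫
        - ∑ k, ⟪mean F P t x₀, f i k⟫ * ⟪f k j, f j i⟫ := by
      intro i j
      rw [real_inner_comm, h.inner_hess_mean t _ _ (hfm i j), h.mean_base]
      congr 1
      · congr 1
        refine Finset.sum_congr rfl fun m _ => ?_
        rw [real_inner_comm, h.F₄_symm]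
      · refine Finset.sum_congr rfl fun k _ => ?_
        rw [hfs k j, hfs j i, real_inner_comm (f i k)]
    simp only [h1, Finset.sum_sub_distrib]
    rw [simons_contraction f hfs fun i j a b c d => hcomm i j _ (hfm a b) _ (hfm c d)]
    congr 1
    exact Finset.sum_congr rfl fun i _ => Finset.sum_comm
  have hQle : Q ≤ sffNormSq F P t x₀ ^ 2 := by
    have h1 : Q ≤ ∑ m, ∑ i, ∑ j, ∑ k, ‖f m k‖ ^ 2 * ‖f i j‖ ^ 2 := by
      refine Finset.sum_le_sum fun m _ => Finset.sum_le_sum fun i _ => Finset.sum_le_sum fun j _ =>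
        Finset.sum_le_sum fun k _ => ?_
      rw [← mul_pow, ← sq_abs]
      exact pow_le_pow_left₀ (abs_nonneg _) (abs_real_inner_le_norm _ _) 2
    refine h1.trans (le_of_eq ?_)
    simp only [← Finset.sum_mul, ← Finset.mul_sum]
    rw [h.sffNormSq_base, sq]
  rw [hlap, hhess]
  have h5 : (1 + 2 / ((Module.finrank ℝ T : ℝ) + ε)) * g
      ≤ (1 + 2 / ((Module.finrank ℝ T : ℝ) + ε)) * T₀ :=
    mul_le_mul_of_nonneg_left hgT (by positivity)
  linarith

end IsGraph

end Graph

end FlatNormal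
end

noncomputable section

namespace FlatNormal

open scoped Topology RealInnerProductSpace

/-! ### Graph charts of an immersion -/

section GraphChart

variable {n m : ℕ} {M : Type*} [TopologicalSpace M] [ChartedSpace (EuclideanSpace ℝ (Fin n)) M]
  {f : M → EuclideanSpace ℝ (Fin m)} {V : Type*} [NormedAddCommGroup V] [NormedSpace ℝ V]

/-- On a finite-dimensional domain an operator is assembled, by fixed linear maps, from its values
on an orthonormal basis. -/
theorem contDiffAt_clm_of_apply {W E : Type*} [NormedAddCommGroup W] [NormedSpace ℝ W]
    [NormedAddCommGroup E] [InnerProductSpace ℝ E] [FiniteDimensional ℝ E] {P : W → E →L[ℝ] V}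
    {x : W} {k : ℕ∞ω} (h : ∀ v, ContDiffAt ℝ k (fun y => P y v) x) : ContDiffAt ℝ k P x := by
  let e := stdOrthonormalBasis ℝ E
  have hP : P = fun y => ∑ a, ContinuousLinearMap.smulRightL ℝ E V (innerSL ℝ (e a)) (P y (e a)) := by
    funext y
    refine ContinuousLinearMap.coe_injective (e.toBasis.ext fun b => ?_)
    simp [orthonormal_iff_ite.1 e.orthonormal]
  rw [hP]
  exact ContDiffAt.sum fun a _ =>
    (ContinuousLinearMap.contDiff _).contDiffAt.comp x (h (e a))

/-- The tangential projection of a constant vector. -/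
def pf (n : ℕ) {m : ℕ} {M : Type*} [TopologicalSpace M] [ChartedSpace (EuclideanSpace ℝ (Fin n)) M]
    (f : M → EuclideanSpace ℝ (Fin m)) (v : EuclideanSpace ℝ (Fin m)) (q : M) :
    EuclideanSpace ℝ (Fin m) := (tangent n f q).starProjection v

theorem pf_mem (v : EuclideanSpace ℝ (Fin m)) (q : M) : pf n f v q ∈ tangent n f q :=
  Submodule.starProjection_apply_mem _ _

theorem finrank_tangent (hf : IsSmoothImmersion n f) (p : M) :
    Module.finrank ℝ (tangent n f p) = n := by
  rw [tangent, LinearMap.finrank_range_of_inj (hf.2 p)]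
  exact finrank_euclideanSpace_fin

/-- `ψ` is the inverse of the orthogonal projection of the immersion to its tangent space at
`p`, near `p`. -/
structure IsGraphChart (f : M → EuclideanSpace ℝ (Fin m)) (p : M) (ψ : tangent n f p → M)
    (x₀ : tangent n f p) : Prop where
  base : ψ x₀ = p
  smooth : ContMDiffAt 𝓘(ℝ, tangent n f p) (𝓡 n) ∞ ψ x₀
  proj : ∀ᶠ x in 𝓝 x₀, (tangent n f p).orthogonalProjectionOnto (f (ψ x)) = x

variable [IsManifold (𝓡 n) ∞ M]

/-- Projected constant vectors are global smooth fields that together span every tangent space, so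
no local frames are needed. -/
theorem isTangentField_pf (hf : IsSmoothImmersion n f) (v : EuclideanSpace ℝ (Fin m)) :
    IsTangentField n f (pf n f v) :=
  ⟨contMDiff_starProjection hf contMDiff_const, pf_mem v⟩

/-- Inverse function theorem for the immersion in a chart followed by the projection to the tangent
space at `p`. That projection fixes the image of the derivative at `p`, so the composite derivative
is injective, hence bijective by dimension. -/
theorem exists_isGraphChart (hf : IsSmoothImmersion n f) (p : M) :
    ∃ (ψ : tangent n f p → M) (x₀ : tangent n f p), IsGraphChart f p ψ x₀ := by
  set c := extChartAt (𝓡 n) p with hc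
  set a := c p with ha
  have hat : a ∈ c.target := mem_extChartAt_target p
  have hca : c.symm a = p := extChartAt_to_inv p
  set π := (tangent n f p).orthogonalProjectionOnto with hπ
  let G : EuclideanSpace ℝ (Fin n) → tangent n f p := fun y => π ((f ∘ c.symm) y)
  have hF : ContDiffAt ℝ ∞ (f ∘ c.symm) a := contDiffAt_comp_chart_symm hat hf.1.contMDiffAt
  have hG : ContDiffAt ℝ ∞ G a := π.contDiff.contDiffAt.comp a hF
  let L : EuclideanSpace ℝ (Fin n) →L[ℝ] tangent n f p := π ∘L fderiv ℝ (f ∘ c.symm) a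
  have hGL : HasFDerivAt G L a :=
    π.hasFDerivAt.comp a (hF.differentiableAt (by simp)).hasFDerivAt
  have hmem : ∀ v, fderiv ℝ (f ∘ c.symm) a v ∈ tangent n f p := by
    intro v
    have : fderiv ℝ (f ∘ c.symm) a v ∈ (fderiv ℝ (f ∘ c.symm) a).toLinearMap.range := ⟨v, rfl⟩
    rwa [range_fderiv_chart hf hat, hca] at this
  have hinj : Function.Injective L := by
    intro v w hvw
    apply fderiv_chart_injective hf hat
    have h1 : ∀ v, (L v : EuclideanSpace ℝ (Fin m)) = fderiv ℝ (f ∘ c.symm) a v := by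
      intro v
      change ((π (fderiv ℝ (f ∘ c.symm) a v) : tangent n f p) : EuclideanSpace ℝ (Fin m)) = _
      rw [← Submodule.starProjection_apply]
      exact Submodule.starProjection_eq_self_iff.2 (hmem v)
    rw [← h1, ← h1, hvw]
  have hsurj : Function.Surjective L :=
    (LinearMap.injective_iff_surjective_of_finrank_eq_finrank (f := L.toLinearMap)
      (by rw [finrank_tangent hf]; exact finrank_euclideanSpace_fin)).1 hinj
  let L' : EuclideanSpace ℝ (Fin n) ≃L[ℝ] tangent n f p :=
    (LinearEquiv.ofBijective L.toLinearMap ⟨hinj, hsurj⟩).toContinuousLinearEquiv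
  have hGL' : HasFDerivAt G (L' : EuclideanSpace ℝ (Fin n) →L[ℝ] tangent n f p) a := hGL
  let e := hG.toOpenPartialHomeomorph G hGL' (by simp)
  have hae : a ∈ e.source := hG.mem_toOpenPartialHomeomorph_source hGL' (by simp)
  have heG : ∀ y, e y = G y := fun y => rfl
  have hGt : G a ∈ e.target := hG.image_mem_toOpenPartialHomeomorph_target hGL' (by simp)
  have hsym : e.symm (G a) = a := by rw [← heG]; exact e.left_inv hae
  have hes : ContDiffAt ℝ ∞ e.symm (G a) := by
    refine e.contDiffAt_symm hGt (f₀' := L') ?_ ?_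
    · rw [hsym]; exact hGL'
    · rw [hsym]; exact hG
  refine ⟨fun x => c.symm (e.symm x), G a, ?_, ?_, ?_⟩
  · rw [hsym, hca]
  · have h1 : ContMDiffAt (𝓡 n) (𝓡 n) ∞ c.symm (e.symm (G a)) := by
      rw [hsym]; exact contMDiffAt_chart_symm hat
    exact h1.comp (G a) hes.contMDiffAt
  · filter_upwards [e.eventually_right_inverse hGt] with x hx
    exact hx

namespace IsGraphChart

variable {p : M} {ψ : tangent n f p → M} {x₀ : tangent n f p}

omit [IsManifold (𝓡 n) ∞ M] in
theorem contDiffAt_comp (h : IsGraphChart f p ψ x₀) {u : M → V}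
    (hu : ContMDiff (𝓡 n) 𝓘(ℝ, V) ∞ u) : ContDiffAt ℝ ∞ (u ∘ ψ) x₀ :=
  (hu.contMDiffAt.comp x₀ h.smooth).contDiffAt

theorem eventually_mdifferentiableAt (h : IsGraphChart f p ψ x₀) :
    ∀ᶠ x in 𝓝 x₀, MDifferentiableAt 𝓘(ℝ, tangent n f p) (𝓡 n) ψ x := by
  have : IsManifold (𝓡 n) 1 M := IsManifold.of_le (n := ∞) (by norm_cast)
  have h1 : ContMDiffAt 𝓘(ℝ, tangent n f p) (𝓡 n) 1 ψ x₀ := h.smooth.of_le (by norm_cast)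
  filter_upwards [(contMDiffAt_iff_contMDiffAt_nhds (by simp)).1 h1] with x hx
  exact hx.mdifferentiableAt (by simp)

/-- In a graph chart the tangent spaces are the images of the derivative, which is inverted by the
orthogonal projection. -/
theorem eventually_fderiv (h : IsGraphChart f p ψ x₀) (hf : IsSmoothImmersion n f) :
    ∀ᶠ x in 𝓝 x₀, (∀ v, fderiv ℝ (f ∘ ψ) x v ∈ tangent n f (ψ x)) ∧
      ∀ w ∈ tangent n f (ψ x),
        fderiv ℝ (f ∘ ψ) x ((tangent n f p).orthogonalProjectionOnto w) = w := by
  have hF := h.contDiffAt_comp hf.1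
  filter_upwards [h.eventually_mdifferentiableAt, h.proj.eventually_nhds,
    eventually_differentiableAt hF] with x hx hy hd
  have h1 : ∀ v, fderiv ℝ (f ∘ ψ) x v ∈ tangent n f (ψ x) := by
    intro v
    refine ⟨mfderiv 𝓘(ℝ, tangent n f p) (𝓡 n) ψ x v, ?_⟩
    rw [← mfderiv_eq_fderiv, mfderiv_comp x (hf.1.contMDiffAt.mdifferentiableAt (by simp)) hx]
    rfl
  refine ⟨h1, ?_⟩
  have h2 : ∀ v, (tangent n f p).orthogonalProjectionOnto (fderiv ℝ (f ∘ ψ) x v) = v := by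
    intro v
    have h3 : fderiv ℝ (fun y => (tangent n f p).orthogonalProjectionOnto ((f ∘ ψ) y)) x
        = fderiv ℝ (fun y => y) x := Filter.EventuallyEq.fderiv_eq hy
    have h4 := ((tangent n f p).orthogonalProjectionOnto.hasFDerivAt.comp x hd.hasFDerivAt).fderiv
    have h5 := congrArg (fun L => L v) (h4.symm.trans h3)
    simpa using h5
  let L : tangent n f p →ₗ[ℝ] tangent n f (ψ x) :=
    (fderiv ℝ (f ∘ ψ) x).toLinearMap.codRestrict _ h1
  have hL : Function.Injective L := by
    intro v w hvw
    have := congrArg (fun z : tangent n f (ψ x) => (z : EuclideanSpace ℝ (Fin m))) hvw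
    simp only [L, LinearMap.codRestrict_apply, ContinuousLinearMap.coe_coe] at this
    rw [← h2 v, ← h2 w, this]
  have hL' : Function.Surjective L :=
    (LinearMap.injective_iff_surjective_of_finrank_eq_finrank
      (by rw [finrank_tangent hf, finrank_tangent hf])).1 hL
  intro w hw
  obtain ⟨v, hv⟩ := hL' ⟨w, hw⟩
  have hv' : fderiv ℝ (f ∘ ψ) x v = w :=
    congrArg (fun z : tangent n f (ψ x) => (z : EuclideanSpace ℝ (Fin m))) hv
  rw [← hv', h2]

theorem isGraph (h : IsGraphChart f p ψ x₀) (hf : IsSmoothImmersion n f) :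
    IsGraph (tangent n f p) x₀ (f ∘ ψ) (fun x => (tangent n f (ψ x)).starProjection) where
  contDiffAt_F := h.contDiffAt_comp hf.1
  contDiffAt_P := contDiffAt_clm_of_apply fun v => h.contDiffAt_comp (isTangentField_pf hf v).1
  proj := h.proj
  symm := Filter.Eventually.of_forall fun x v w => Submodule.inner_starProjection_left_eq_right _ _ _
  idem := Filter.Eventually.of_forall fun x v =>
    Submodule.starProjection_eq_self_iff.2 (Submodule.starProjection_apply_mem _ _)
  tang := by
    filter_upwards [h.eventually_fderiv hf] with x hx v
    exact Submodule.starProjection_eq_self_iff.2 (hx.1 v)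
  rng := by
    filter_upwards [h.eventually_fderiv hf] with x hx v
    exact hx.2 _ (Submodule.starProjection_apply_mem _ _)
  base := by rw [h.base]

/-- `D_X u` in a graph chart. -/
theorem eventually_D (h : IsGraphChart f p ψ x₀) (hf : IsSmoothImmersion n f) :
    ∀ᶠ x in 𝓝 x₀, ∀ (X : M → EuclideanSpace ℝ (Fin m)) (u : M → V),
      X (ψ x) ∈ tangent n f (ψ x) → MDifferentiableAt (𝓡 n) 𝓘(ℝ, V) u (ψ x) →
      D n f X u (ψ x)
        = fderiv ℝ (u ∘ ψ) x ((tangent n f p).orthogonalProjectionOnto (X (ψ x))) := by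
  filter_upwards [h.eventually_fderiv hf, h.eventually_mdifferentiableAt] with x hx hψ X u hX hu
  exact D_eq_fderiv hψ (hf.1.contMDiffAt.mdifferentiableAt (by simp)) hu (hf.2 _) (hx.2 _ hX)

theorem D_pf (h : IsGraphChart f p ψ x₀) (hf : IsSmoothImmersion n f) {u : M → V}
    (hu : ContMDiff (𝓡 n) 𝓘(ℝ, V) ∞ u) (v : tangent n f p) :
    D n f (pf n f v) u ∘ ψ =ᶠ[𝓝 x₀]
      IsGraph.along (fun x => (tangent n f (ψ x)).starProjection) v (u ∘ ψ) := by
  filter_upwards [h.eventually_D (V := V) hf] with x hx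
  exact hx _ u (pf_mem _ _) (hu.contMDiffAt.mdifferentiableAt (by simp))

theorem nablaN_pf (h : IsGraphChart f p ψ x₀) (hf : IsSmoothImmersion n f)
    {u : M → EuclideanSpace ℝ (Fin m)} (hu : ContMDiff (𝓡 n) (𝓡 m) ∞ u) (v : tangent n f p) :
    nablaN n f (pf n f v) u ∘ ψ =ᶠ[𝓝 x₀]
      IsGraph.alongN (fun x => (tangent n f (ψ x)).starProjection) v (u ∘ ψ) := by
  filter_upwards [h.D_pf hf hu v] with x hx
  have hx' : D n f (pf n f v) u (ψ x) = _ := hx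
  rw [IsGraph.alongN, Function.comp_apply, nablaN, hx']
  rw [Submodule.starProjection_orthogonal_val]

theorem D_base (h : IsGraphChart f p ψ x₀) (hf : IsSmoothImmersion n f)
    {X : M → EuclideanSpace ℝ (Fin m)} {u : M → V} (hu : MDifferentiableAt (𝓡 n) 𝓘(ℝ, V) u p)
    (v : tangent n f p) (hX : X p = v) : D n f X u p = dd v (u ∘ ψ) x₀ := by
  have h1 := (h.eventually_D (V := V) hf).self_of_nhds X u
  rw [h.base] at h1
  rw [h1 (hX ▸ v.2) hu, hX, Submodule.orthogonalProjectionOnto_mem_subspace_eq_self, dd]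

/-- The second fundamental form in a graph chart. -/
theorem eventually_secondFF (h : IsGraphChart f p ψ x₀) (hf : IsSmoothImmersion n f) :
    ∀ᶠ x in 𝓝 x₀, ∀ v w, secondFF n f (pf n f v) (pf n f w) (ψ x) =
      (tangent n f (ψ x))ᗮ.starProjection (fderiv ℝ (fderiv ℝ (f ∘ ψ)) x
        ((tangent n f p).orthogonalProjectionOnto (pf n f v (ψ x)))
        ((tangent n f p).orthogonalProjectionOnto (pf n f w (ψ x)))) := by
  have hF := h.contDiffAt_comp hf.1
  have hF' : ContDiffAt ℝ ∞ (fderiv ℝ (f ∘ ψ)) x₀ := hF.fderiv_right (m := ∞) (by norm_cast)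
  filter_upwards [h.eventually_D (V := EuclideanSpace ℝ (Fin m)) hf, (h.eventually_fderiv hf).eventually_nhds,
    eventually_differentiableAt hF', h.eventually_mdifferentiableAt] with x hx hy hd hψ v w
  have hpw : ContMDiff (𝓡 n) (𝓡 m) ∞ (pf n f w) := (isTangentField_pf hf w).1
  rw [secondFF, hx _ _ (pf_mem _ _) (hpw.contMDiffAt.mdifferentiableAt (by simp))]
  have h1 : pf n f w ∘ ψ =ᶠ[𝓝 x] fun y => fderiv ℝ (f ∘ ψ) y
      ((tangent n f p).orthogonalProjectionOnto (pf n f w (ψ y))) := by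
    filter_upwards [hy] with y hy using (hy.2 _ (pf_mem _ _)).symm
  have hpd : DifferentiableAt ℝ (fun y => pf n f w (ψ y)) x :=
    ((hpw.contMDiffAt.mdifferentiableAt (by simp)).comp x hψ).differentiableAt
  have h2 := (hd.hasFDerivAt.clm_apply
    ((tangent n f p).orthogonalProjectionOnto.hasFDerivAt.comp x hpd.hasFDerivAt)).fderiv
  have h3 : fderiv ℝ (pf n f w ∘ ψ) x = _ := h1.fderiv_eq.trans h2
  rw [h3]
  simp only [add_apply, ContinuousLinearMap.comp_apply, map_add,
    ContinuousLinearMap.flip_apply]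
  rw [(Submodule.starProjection_apply_eq_zero_iff _).2
    (Submodule.le_orthogonal_orthogonal _ (hy.self_of_nhds.1 _)), zero_add]
  rfl

end IsGraphChart

end GraphChart

end FlatNormal
end

noncomputable section

namespace FlatNormal

open scoped Topology RealInnerProductSpace

/-! ### Traces over nearby tangent spaces -/

section Trace

variable {E G : Type*} [NormedAddCommGroup E] [InnerProductSpace ℝ E] [FiniteDimensional ℝ E]
  [AddCommGroup G] [Module ℝ G] {ι κ : Type*} [Fintype ι] [Fintype κ]

/-- The trace of a bilinear map on `T` over the image of a projection `P` in terms of the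
coefficients `⟨P t_i, t_j⟩`. -/
theorem sum_bilin_proj (T K : Submodule ℝ E) (b : T → T → G)
    (h₁ : ∀ w, IsLinearMap ℝ fun v => b v w) (h₂ : ∀ v, IsLinearMap ℝ (b v))
    (t : OrthonormalBasis ι ℝ T) (e : OrthonormalBasis κ ℝ E) :
    ∑ a, b (T.orthogonalProjectionOnto (K.starProjection (e a)))
        (T.orthogonalProjectionOnto (K.starProjection (e a)))
      = ∑ i, ∑ j, ⟪K.starProjection (t i : E), (t j : E)⟫ • b (t i) (t j) := by
  have hx : ∀ a, T.orthogonalProjectionOnto (K.starProjection (e a))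
      = ∑ i, ⟪K.starProjection (t i : E), e a⟫ • t i := by
    intro a
    rw [← t.sum_repr' (T.orthogonalProjectionOnto (K.starProjection (e a)))]
    refine Finset.sum_congr rfl fun i _ => ?_
    rw [Submodule.inner_orthogonalProjectionOnto_eq_of_mem_left,
      Submodule.inner_starProjection_left_eq_right]
  let B : T →ₗ[ℝ] T →ₗ[ℝ] G := LinearMap.mk₂ ℝ b (fun v w z => (h₁ z).map_add v w)
    (fun r v z => (h₁ z).map_smul r v) (fun v => (h₂ v).map_add)
    (fun r v w => (h₂ v).map_smul r w)
  have hB : ∀ v w, b v w = B v w := fun _ _ => rfl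
  simp only [hB, hx, map_sum, map_smul, LinearMap.sum_apply, LinearMap.smul_apply]
  rw [Finset.sum_comm]
  conv_rhs => rw [Finset.sum_comm]
  simp only [Finset.smul_sum]
  refine Finset.sum_congr rfl fun j _ => ?_
  rw [Finset.sum_comm]
  refine Finset.sum_congr rfl fun i _ => ?_
  -- Parseval in `E`, together with `⟨P t_i, P t_j⟩ = ⟨P t_i, t_j⟩` for a projection `P`.
  have : ⟪K.starProjection (t i : E), (t j : E)⟫
      = ∑ a, ⟪K.starProjection (t j : E), e a⟫ * ⟪K.starProjection (t i : E), e a⟫ := by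
    have h3 := e.sum_inner_mul_inner (K.starProjection (t i : E)) (K.starProjection (t j : E))
    rw [← Submodule.inner_starProjection_left_eq_right,
      Submodule.starProjection_eq_self_iff.2 (Submodule.starProjection_apply_mem _ _)] at h3
    rw [← h3]
    refine Finset.sum_congr rfl fun a _ => ?_
    rw [mul_comm, real_inner_comm (K.starProjection (t j : E))]
  rw [this, Finset.sum_smul]
  exact Finset.sum_congr rfl fun a _ => smul_smul _ _ _

end Trace

/-! ### Basis-free and smooth expressions for `A`, `H` and their norms -/

section Transport

variable {n m : ℕ} {M : Type*} [TopologicalSpace M] [ChartedSpace (EuclideanSpace ℝ (Fin n)) M]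
  {f : M → EuclideanSpace ℝ (Fin m)}

/-- The second fundamental form at `q`, extended by zero to normal vectors. -/
def secA (n : ℕ) {m : ℕ} {M : Type*} [TopologicalSpace M]
    [ChartedSpace (EuclideanSpace ℝ (Fin n)) M] (f : M → EuclideanSpace ℝ (Fin m))
    (v w : EuclideanSpace ℝ (Fin m)) (q : M) : EuclideanSpace ℝ (Fin m) :=
  secondFF n f (pf n f v) (pf n f w) q

theorem secA_mem (v w : EuclideanSpace ℝ (Fin m)) (q : M) : secA n f v w q ∈ normal n f q :=
  Submodule.starProjection_apply_mem _ _

theorem sum_inner_nvec {q : M} {x : EuclideanSpace ℝ (Fin m)} (hx : x ∈ normal n f q)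
    (y : EuclideanSpace ℝ (Fin m)) :
    ∑ α, ⟪x, nvec n f q α⟫ * ⟪y, nvec n f q α⟫ = ⟪x, y⟫ := by
  have h1 := (stdOrthonormalBasis ℝ (normal n f q)).sum_inner_mul_inner ⟨x, hx⟩
    ((normal n f q).orthogonalProjectionOnto y)
  rw [Submodule.inner_orthogonalProjectionOnto_eq_of_mem_left] at h1
  change _ = ⟪x, y⟫ at h1
  rw [← h1]
  refine Finset.sum_congr rfl fun α _ => ?_
  rw [Submodule.inner_orthogonalProjectionOnto_eq_of_mem_left, real_inner_comm y]
  rfl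

theorem h_eq (q : M) (α : NIdx n f q) (i j : TIdx n f q) :
    h n f q α i j = ⟪secA n f (tvec n f q i) (tvec n f q j) q, nvec n f q α⟫ := rfl

theorem meanCurv_eq_tvec (q : M) :
    meanCurv n f q = ∑ i, secA n f (tvec n f q i) (tvec n f q i) q := rfl

theorem Hc_eq (q : M) (α : NIdx n f q) : Hc n f q α = ⟪meanCurv n f q, nvec n f q α⟫ := by
  rw [meanCurv_eq_tvec, sum_inner]
  rfl

theorem meanCurv_mem (q : M) : meanCurv n f q ∈ normal n f q :=
  Submodule.sum_mem _ fun _ _ => secA_mem _ _ _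

theorem normASq_eq_tvec (q : M) :
    normASq n f q = ∑ i, ∑ j, ‖secA n f (tvec n f q i) (tvec n f q j) q‖ ^ 2 := by
  rw [normASq, Finset.sum_comm]
  refine Finset.sum_congr rfl fun i _ => ?_
  rw [Finset.sum_comm]
  refine Finset.sum_congr rfl fun j _ => ?_
  rw [← real_inner_self_eq_norm_sq, ← sum_inner_nvec (secA_mem _ _ _)]
  refine Finset.sum_congr rfl fun α _ => ?_
  rw [h_eq, sq]

theorem normASq_nonneg (q : M) : 0 ≤ normASq n f q := by
  rw [normASq]; positivity

theorem normA_pow_four (q : M) : normA n f q ^ 4 = normASq n f q ^ 2 := by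
  rw [normA, show (4 : ℕ) = 2 * 2 from rfl, pow_mul, Real.sq_sqrt (normASq_nonneg q)]

theorem sum_h_ddH_eq (q : M) : ∑ α, ∑ i, ∑ j, h n f q α i j * ddH n f q i j α
    = ∑ i, ∑ j, ⟪secA n f (tvec n f q i) (tvec n f q j) q,
      hessN n f (pf n f (tvec n f q i)) (pf n f (tvec n f q j)) (meanCurv n f) q⟫ := by
  rw [Finset.sum_comm]
  refine Finset.sum_congr rfl fun i _ => ?_
  rw [Finset.sum_comm]
  refine Finset.sum_congr rfl fun j _ => ?_
  rw [← sum_inner_nvec (secA_mem _ _ _)]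
  rfl

theorem sum_cubic_eq (q : M) : ∑ α, ∑ β, ∑ i, ∑ j, ∑ k, Hc n f q α * h n f q α i j *
      h n f q β j k * h n f q β k i
    = ∑ i, ∑ j, ∑ k, ⟪meanCurv n f q, secA n f (tvec n f q i) (tvec n f q j) q⟫ *
      ⟪secA n f (tvec n f q j) (tvec n f q k) q, secA n f (tvec n f q k) (tvec n f q i) q⟫ := by
  simp only [← sum_inner_nvec (meanCurv_mem q) (secA n f _ _ q),
    ← sum_inner_nvec (secA_mem _ _ q) (secA n f _ _ q), Finset.sum_mul_sum]
  simp only [← Hc_eq, ← h_eq]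
  have h1 : ∀ g : NIdx n f q → NIdx n f q → TIdx n f q → TIdx n f q → TIdx n f q → ℝ,
      ∑ α, ∑ β, ∑ i, ∑ j, ∑ k, g α β i j k = ∑ i, ∑ j, ∑ k, ∑ α, ∑ β, g α β i j k := by
    intro g
    calc _ = ∑ α, ∑ i, ∑ β, ∑ j, ∑ k, g α β i j k :=
          Finset.sum_congr rfl fun α _ => Finset.sum_comm
      _ = ∑ i, ∑ α, ∑ β, ∑ j, ∑ k, g α β i j k := Finset.sum_comm
      _ = ∑ i, ∑ α, ∑ j, ∑ β, ∑ k, g α β i j k :=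
          Finset.sum_congr rfl fun i _ => Finset.sum_congr rfl fun α _ => Finset.sum_comm
      _ = ∑ i, ∑ j, ∑ α, ∑ β, ∑ k, g α β i j k :=
          Finset.sum_congr rfl fun i _ => Finset.sum_comm
      _ = ∑ i, ∑ j, ∑ α, ∑ k, ∑ β, g α β i j k :=
          Finset.sum_congr rfl fun i _ => Finset.sum_congr rfl fun j _ =>
            Finset.sum_congr rfl fun α _ => Finset.sum_comm
      _ = _ := Finset.sum_congr rfl fun i _ => Finset.sum_congr rfl fun j _ => Finset.sum_comm
  rw [h1]
  refine Finset.sum_congr rfl fun i _ => Finset.sum_congr rfl fun j _ =>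
    Finset.sum_congr rfl fun k _ => Finset.sum_congr rfl fun α _ =>
    Finset.sum_congr rfl fun β _ => ?_
  ring

theorem nablaN_mem (X Y : M → EuclideanSpace ℝ (Fin m)) (q : M) :
    nablaN n f X Y q ∈ normal n f q :=
  Submodule.starProjection_apply_mem _ _

theorem normDHSq_eq (q : M) : normDHSq n f q
    = ∑ i, ‖nablaN n f (pf n f (tvec n f q i)) (meanCurv n f) q‖ ^ 2 := by
  rw [normDHSq, Finset.sum_comm]
  refine Finset.sum_congr rfl fun i _ => ?_
  rw [← real_inner_self_eq_norm_sq, ← sum_inner_nvec (nablaN_mem _ _ _)]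
  refine Finset.sum_congr rfl fun α _ => ?_
  rw [← sq]
  rfl

variable [IsManifold (𝓡 n) ∞ M] (hf : IsSmoothImmersion n f)
include hf

/-- In a graph chart at `q` the second fundamental form is the second derivative of the graph
function. This gives at once that it is bilinear, symmetric and zero on normal vectors. -/
theorem exists_secA_eq (q : M) : ∃ B : tangent n f q →L[ℝ] tangent n f q →L[ℝ]
      EuclideanSpace ℝ (Fin m), (∀ x y, B x y = B y x) ∧ ∀ v w, secA n f v w q =
      B ((tangent n f q).orthogonalProjectionOnto v)
        ((tangent n f q).orthogonalProjectionOnto w) := by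
  obtain ⟨ψ, x₀, h⟩ := exists_isGraphChart hf q
  have hg := h.isGraph hf
  refine ⟨fderiv ℝ (fderiv ℝ (f ∘ ψ)) x₀, fun x y => ?_, fun v w => ?_⟩
  · rw [← hg.dd_dd_eq_fderiv, ← hg.dd_dd_eq_fderiv, hg.F₂_symm]
  · have h1 := (h.eventually_secondFF hf).self_of_nhds v w
    rw [h.base] at h1
    have h2 : ∀ v, (tangent n f q).orthogonalProjectionOnto (pf n f v q)
        = (tangent n f q).orthogonalProjectionOnto v := by
      intro v
      rw [pf, Submodule.starProjection_apply,
        Submodule.orthogonalProjectionOnto_mem_subspace_eq_self]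
    rw [secA, h1, h2, h2]
    refine Submodule.starProjection_eq_self_iff.2 ?_
    rw [← hg.dd_dd_eq_fderiv]
    exact hg.F₂_mem _ _

theorem secA_symm (v w : EuclideanSpace ℝ (Fin m)) (q : M) : secA n f v w q = secA n f w v q := by
  obtain ⟨B, hB, hA⟩ := exists_secA_eq hf q
  rw [hA, hA, hB]

theorem secA_isLinearMap_left (w : EuclideanSpace ℝ (Fin m)) (q : M) :
    IsLinearMap ℝ fun v => secA n f v w q := by
  obtain ⟨B, -, hA⟩ := exists_secA_eq hf q
  simp only [hA]
  exact ⟨by simp, by simp⟩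

theorem secA_isLinearMap_right (v : EuclideanSpace ℝ (Fin m)) (q : M) :
    IsLinearMap ℝ fun w => secA n f v w q := by
  obtain ⟨B, -, hA⟩ := exists_secA_eq hf q
  simp only [hA]
  exact ⟨by simp, by simp⟩

theorem secA_eq_zero {q : M} {v : EuclideanSpace ℝ (Fin m)} (hv : v ∈ (tangent n f q)ᗮ)
    (w : EuclideanSpace ℝ (Fin m)) : secA n f v w q = 0 := by
  obtain ⟨B, -, hA⟩ := exists_secA_eq hf q
  rw [hA, Submodule.orthogonalProjectionOnto_eq_zero_iff.2 hv]
  simp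

variable {κ : Type*} [Fintype κ] (e : OrthonormalBasis κ ℝ (EuclideanSpace ℝ (Fin m)))

/-- The orthonormal bases of the tangent spaces are chosen point by point, without continuity. As
`secA` vanishes on normal vectors, a fixed basis of `ℝ^m` computes the same trace and exhibits `H`
as a sum of smooth maps. -/
theorem meanCurv_eq (q : M) : meanCurv n f q = ∑ a, secA n f (e a) (e a) q :=
  sum_bilin_subspace (tangent n f q) (fun v w => secA n f v w q)
    (fun w => secA_isLinearMap_left hf w q) (fun v => secA_isLinearMap_right hf v q)
    (fun _ hv w => secA_eq_zero hf hv w) (stdOrthonormalBasis ℝ (tangent n f q)) e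

theorem normASq_eq (q : M) : normASq n f q = ∑ a, ∑ b, ‖secA n f (e a) (e b) q‖ ^ 2 := by
  rw [normASq_eq_tvec]
  have hl := fun w => secA_isLinearMap_left hf w q
  have hr := fun v => secA_isLinearMap_right hf v q
  have hz : ∀ v ∈ (tangent n f q)ᗮ, ∀ w, secA n f v w q = 0 := fun _ hv w => secA_eq_zero hf hv w
  have h1 : ∀ w, ∑ i, ‖secA n f (tvec n f q i) w q‖ ^ 2 = ∑ a, ‖secA n f (e a) w q‖ ^ 2 := by
    intro w
    simp only [← real_inner_self_eq_norm_sq]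
    refine sum_bilin_subspace (tangent n f q) (fun v v' => ⟪secA n f v w q, secA n f v' w q⟫)
      (fun z => ⟨?_, ?_⟩) (fun z => ⟨?_, ?_⟩) (fun v hv z => ?_)
      (stdOrthonormalBasis ℝ (tangent n f q)) e
    · intro x y; rw [(hl w).map_add, inner_add_left]
    · intro r x; rw [(hl w).map_smul, inner_smul_left]; rfl
    · intro x y; rw [(hl w).map_add, inner_add_right]
    · intro r x; rw [(hl w).map_smul, inner_smul_right]; rfl
    · rw [hz v hv, inner_zero_left]
  have h2 : ∀ w, ∑ i, ‖secA n f w (tvec n f q i) q‖ ^ 2 = ∑ a, ‖secA n f w (e a) q‖ ^ 2 := by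
    intro w
    simp_rw [secA_symm hf w]
    exact h1 w
  simp_rw [h2]
  rw [Finset.sum_comm]
  simp_rw [h1]
  exact Finset.sum_comm

theorem contMDiff_nablaT {X Y : M → EuclideanSpace ℝ (Fin m)} (hX : IsTangentField n f X)
    (hY : ContMDiff (𝓡 n) (𝓡 m) ∞ Y) : IsTangentField n f (nablaT n f X Y) :=
  ⟨contMDiff_starProjection hf (contMDiff_D hf hX hY),
    fun _ => Submodule.starProjection_apply_mem _ _⟩

theorem contMDiff_nablaN {X Y : M → EuclideanSpace ℝ (Fin m)} (hX : IsTangentField n f X)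
    (hY : ContMDiff (𝓡 n) (𝓡 m) ∞ Y) : ContMDiff (𝓡 n) (𝓡 m) ∞ (nablaN n f X Y) := by
  have h1 : nablaN n f X Y = fun q => D n f X Y q - nablaT n f X Y q := by
    funext q
    rw [nablaN, Submodule.starProjection_orthogonal_val]
    rfl
  rw [h1]
  exact (contMDiff_D hf hX hY).sub (contMDiff_nablaT hf hX hY).1

theorem contMDiff_secA (v w : EuclideanSpace ℝ (Fin m)) :
    ContMDiff (𝓡 n) (𝓡 m) ∞ (secA n f v w) :=
  contMDiff_nablaN hf (isTangentField_pf hf v) (isTangentField_pf hf w).1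

theorem contMDiff_meanCurv : ContMDiff (𝓡 n) (𝓡 m) ∞ (meanCurv n f) := by
  have h1 : meanCurv n f = fun q => ∑ a, secA n f (EuclideanSpace.basisFun (Fin m) ℝ a)
      (EuclideanSpace.basisFun (Fin m) ℝ a) q := funext fun q => meanCurv_eq hf _ q
  rw [h1]
  exact contMDiff_finsetSum fun a _ => contMDiff_secA hf _ _

end Transport

end FlatNormal
end

noncomputable section

namespace FlatNormal

open scoped Topology RealInnerProductSpace

/-! ### Transfer to the manifold and the pointwise inequality -/

section Pointwise

variable {n m : ℕ} {M : Type*} [TopologicalSpace M] [ChartedSpace (EuclideanSpace ℝ (Fin n)) M]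
  {f : M → EuclideanSpace ℝ (Fin m)} {V : Type*} [NormedAddCommGroup V] [NormedSpace ℝ V]

/-- The chain rule for `D_X`. -/
theorem D_comp {W : Type*} [NormedAddCommGroup W] [NormedSpace ℝ W]
    {X : M → EuclideanSpace ℝ (Fin m)} {u : M → V} {p : M} {g : V → W}
    (hg : DifferentiableAt ℝ g (u p)) (hu : MDifferentiableAt (𝓡 n) 𝓘(ℝ, V) u p) :
    D n f X (g ∘ u) p = fderiv ℝ g (u p) (D n f X u p) := by
  rw [D, D, differential, mfderiv_comp p hg.mdifferentiableAt hu, mfderiv_eq_fderiv]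
  rfl

theorem IsGraph.along_congr {E G : Type*} [NormedAddCommGroup E] [InnerProductSpace ℝ E]
    [FiniteDimensional ℝ E] [NormedAddCommGroup G] [NormedSpace ℝ G] {T : Submodule ℝ E} {x₀ : T}
    {P : T → E →L[ℝ] E} {g g' : T → G} (h : g =ᶠ[𝓝 x₀] g') (v : T) :
    IsGraph.along P v g =ᶠ[𝓝 x₀] IsGraph.along P v g' := by
  filter_upwards [h.fderiv (𝕜 := ℝ)] with x hx
  rw [IsGraph.along, IsGraph.along, hx]

theorem IsGraph.alongN_congr {E : Type*} [NormedAddCommGroup E] [InnerProductSpace ℝ E]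
    [FiniteDimensional ℝ E] {T : Submodule ℝ E} {x₀ : T}
    {P : T → E →L[ℝ] E} {g g' : T → E} (h : g =ᶠ[𝓝 x₀] g') (v : T) :
    IsGraph.alongN P v g =ᶠ[𝓝 x₀] IsGraph.alongN P v g' := by
  filter_upwards [IsGraph.along_congr (P := P) h v] with x hx
  rw [IsGraph.alongN, IsGraph.alongN, hx]

variable [IsManifold (𝓡 n) ∞ M]

theorem contMDiff_normASq (hf : IsSmoothImmersion n f) :
    ContMDiff (𝓡 n) 𝓘(ℝ, ℝ) ∞ (normASq n f) := by
  have h1 : normASq n f = fun q => ∑ a, ∑ b, ‖secA n f (EuclideanSpace.basisFun (Fin m) ℝ a)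
      (EuclideanSpace.basisFun (Fin m) ℝ b) q‖ ^ 2 := funext fun q => normASq_eq hf _ q
  rw [h1]
  exact contMDiff_finsetSum fun a _ => contMDiff_finsetSum fun b _ =>
    (contDiff_norm_sq ℝ).comp_contMDiff (contMDiff_secA hf _ _)

namespace IsGraphChart

variable {p : M} {ψ : tangent n f p → M} {x₀ : tangent n f p}
  {ι : Type*} [Fintype ι] (t : OrthonormalBasis ι ℝ (tangent n f p))

/-- The identity is needed near `x₀`, because two derivatives of `|A|²` are taken. Each of the two
traces over the ambient basis turns into a contraction with the inverse metric. -/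
theorem normASq_comp (h : IsGraphChart f p ψ x₀) (hf : IsSmoothImmersion n f) :
    normASq n f ∘ ψ =ᶠ[𝓝 x₀]
      IsGraph.sffNormSq (f ∘ ψ) (fun x => (tangent n f (ψ x)).starProjection) t := by
  have hg := h.isGraph hf
  have hdd : ∀ᶠ x in 𝓝 x₀, ∀ i j, dd (t i) (dd (t j) (f ∘ ψ)) x
      = fderiv ℝ (fderiv ℝ (f ∘ ψ)) x (t i) (t j) :=
    Filter.eventually_all.2 fun i => Filter.eventually_all.2 fun j =>
      dd_dd_apply hg.contDiffAt_F (t i) (t j)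
  filter_upwards [h.eventually_secondFF hf, hdd] with x hx hdx
  set e := EuclideanSpace.basisFun (Fin m) ℝ
  set K := tangent n f (ψ x)
  set π := (tangent n f p).orthogonalProjectionOnto
  set B := fderiv ℝ (fderiv ℝ (f ∘ ψ)) x
  rw [Function.comp_apply, normASq_eq hf e]
  have h1 : ∀ v w, ‖secA n f v w (ψ x)‖ ^ 2
      = ⟪Kᗮ.starProjection (B (π (K.starProjection v)) (π (K.starProjection w))),
        B (π (K.starProjection v)) (π (K.starProjection w))⟫ := by
    intro v w
    rw [secA, hx, ← real_inner_self_eq_norm_sq, Submodule.inner_starProjection_left_eq_right,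
      Submodule.starProjection_eq_self_iff.2 (Submodule.starProjection_apply_mem _ _),
      ← Submodule.inner_starProjection_left_eq_right]
    rfl
  simp only [h1]
  have h2 : ∀ ξ, ∑ b, ⟪Kᗮ.starProjection (B ξ (π (K.starProjection (e b)))),
        B ξ (π (K.starProjection (e b)))⟫
      = ∑ j, ∑ l, ⟪K.starProjection (t j : EuclideanSpace ℝ (Fin m)), (t l : _)⟫ •
        ⟪Kᗮ.starProjection (B ξ (t j)), B ξ (t l)⟫ := fun ξ =>
    sum_bilin_proj (tangent n f p) K (fun v w => ⟪Kᗮ.starProjection (B ξ v), B ξ w⟫)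
      (fun w => ⟨fun x y => by rw [map_add, map_add, inner_add_left],
        fun c x => by rw [map_smul, map_smul, real_inner_smul_left, smul_eq_mul]⟩)
      (fun w => ⟨fun x y => by rw [map_add, inner_add_right],
        fun c x => by rw [map_smul, real_inner_smul_right, smul_eq_mul]⟩) t e
  have h3 := sum_bilin_proj (tangent n f p) K
      (fun v w => ∑ j, ∑ l, ⟪K.starProjection (t j : EuclideanSpace ℝ (Fin m)), (t l : _)⟫ •
        ⟪Kᗮ.starProjection (B v (t j)), B w (t l)⟫)
      (fun w => ⟨fun x y => by
          simp only [map_add, add_apply, inner_add_left, smul_add, Finset.sum_add_distrib],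
        fun c x => by
          simp only [map_smul, smul_apply, real_inner_smul_left, Finset.smul_sum]
          refine Finset.sum_congr rfl fun j _ => Finset.sum_congr rfl fun l _ => ?_
          simp only [smul_eq_mul]
          ring⟩)
      (fun w => ⟨fun x y => by
          simp only [map_add, add_apply, inner_add_right, smul_add, Finset.sum_add_distrib],
        fun c x => by
          simp only [map_smul, smul_apply, real_inner_smul_right, Finset.smul_sum]
          refine Finset.sum_congr rfl fun j _ => Finset.sum_congr rfl fun l _ => ?_
          simp only [smul_eq_mul]
          ring⟩) t e
  simp only [h2]
  refine h3.trans ?_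
  simp only [IsGraph.sffNormSq, IsGraph.invMetric, IsGraph.sff, hdx, smul_eq_mul, Finset.mul_sum]
  refine Finset.sum_congr rfl fun i _ => ?_
  rw [Finset.sum_comm]
  refine Finset.sum_congr rfl fun j _ => Finset.sum_congr rfl fun k _ =>
    Finset.sum_congr rfl fun l _ => ?_
  rw [Submodule.starProjection_orthogonal_val]

theorem meanCurv_comp (h : IsGraphChart f p ψ x₀) (hf : IsSmoothImmersion n f) :
    meanCurv n f ∘ ψ =ᶠ[𝓝 x₀]
      IsGraph.mean (f ∘ ψ) (fun x => (tangent n f (ψ x)).starProjection) t := by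
  have hg := h.isGraph hf
  have hdd : ∀ᶠ x in 𝓝 x₀, ∀ i j, dd (t i) (dd (t j) (f ∘ ψ)) x
      = fderiv ℝ (fderiv ℝ (f ∘ ψ)) x (t i) (t j) :=
    Filter.eventually_all.2 fun i => Filter.eventually_all.2 fun j =>
      dd_dd_apply hg.contDiffAt_F (t i) (t j)
  filter_upwards [h.eventually_secondFF hf, hdd] with x hx hdx
  rw [Function.comp_apply, meanCurv_eq hf (EuclideanSpace.basisFun (Fin m) ℝ)]
  simp only [secA, hx]
  refine (sum_bilin_proj (tangent n f p) (tangent n f (ψ x))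
    (fun v w => (tangent n f (ψ x))ᗮ.starProjection (fderiv ℝ (fderiv ℝ (f ∘ ψ)) x v w))
    (fun w => ⟨fun x y => by rw [map_add, add_apply, map_add],
      fun c x => by rw [map_smul, smul_apply, map_smul]⟩)
    (fun w => ⟨fun x y => by rw [map_add, map_add], fun c x => by rw [map_smul, map_smul]⟩) t
    (EuclideanSpace.basisFun (Fin m) ℝ)).trans ?_
  simp only [IsGraph.mean, IsGraph.invMetric, IsGraph.sff, hdx]
  refine Finset.sum_congr rfl fun i _ => Finset.sum_congr rfl fun j _ => ?_
  rw [Submodule.starProjection_orthogonal_val]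

theorem D_D_pf (h : IsGraphChart f p ψ x₀) (hf : IsSmoothImmersion n f) {u : M → V}
    (hu : ContMDiff (𝓡 n) 𝓘(ℝ, V) ∞ u) (v w : tangent n f p) :
    D n f (pf n f v) (D n f (pf n f w) u) p = dd v (dd w (u ∘ ψ)) x₀ := by
  have h1 := contMDiff_D hf (isTangentField_pf hf (w : EuclideanSpace ℝ (Fin m))) hu
  rw [h.D_base hf (h1.contMDiffAt.mdifferentiableAt (by simp)) v
    (Submodule.starProjection_eq_self_iff.2 v.2), (dd_congr (h.D_pf hf hu w) v).eq_of_nhds,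
    (h.isGraph hf).dd_along (h.contDiffAt_comp hu)]

theorem D_pf_pf (h : IsGraphChart f p ψ x₀) (hf : IsSmoothImmersion n f) (v w : tangent n f p) :
    D n f (pf n f v) (pf n f w) p = dd v (dd w (f ∘ ψ)) x₀ := by
  have hg := h.isGraph hf
  have h1 := (isTangentField_pf hf (w : EuclideanSpace ℝ (Fin m))).1
  rw [h.D_base hf (h1.contMDiffAt.mdifferentiableAt (by simp)) v
    (Submodule.starProjection_eq_self_iff.2 v.2)]
  have h2 := (hg.dd_P_apply (contDiffAt_const (c := (w : EuclideanSpace ℝ (Fin m)))) v).eq_of_nhds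
  rw [dd_const, map_zero, add_zero, hg.dd_P_of_mem] at h2
  exact h2

/-- The projections of vectors of `T` are parallel at `p`, since their derivatives there are normal.
Hence the connection terms in `hess`, `hessN` and the bracket vanish at `p`. -/
theorem nablaT_pf_pf (h : IsGraphChart f p ψ x₀) (hf : IsSmoothImmersion n f)
    (v w : tangent n f p) : nablaT n f (pf n f v) (pf n f w) p = 0 := by
  rw [nablaT, h.D_pf_pf hf]
  exact (Submodule.starProjection_apply_eq_zero_iff _).2 ((h.isGraph hf).F₂_mem v w)

theorem secA_eq (h : IsGraphChart f p ψ x₀) (hf : IsSmoothImmersion n f)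
    (v w : tangent n f p) : secA n f v w p = dd v (dd w (f ∘ ψ)) x₀ := by
  rw [secA, secondFF, h.D_pf_pf hf]
  exact Submodule.starProjection_eq_self_iff.2 ((h.isGraph hf).F₂_mem v w)

theorem hess_pf (h : IsGraphChart f p ψ x₀) (hf : IsSmoothImmersion n f) {u : M → ℝ}
    (hu : ContMDiff (𝓡 n) 𝓘(ℝ, ℝ) ∞ u) (v w : tangent n f p) :
    hess n f (pf n f v) (pf n f w) u p = dd v (dd w (u ∘ ψ)) x₀ := by
  rw [hess, h.D_D_pf hf hu, D_zero_field (hf.2 p) (h.nablaT_pf_pf hf v w), sub_zero]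

theorem inner_nablaN_nablaN_pf (h : IsGraphChart f p ψ x₀) (hf : IsSmoothImmersion n f)
    {u : M → EuclideanSpace ℝ (Fin m)} (hu : ContMDiff (𝓡 n) (𝓡 m) ∞ u) (v w : tangent n f p)
    {ν : EuclideanSpace ℝ (Fin m)} (hν : ν ∈ normal n f p) :
    ⟪nablaN n f (pf n f v) (nablaN n f (pf n f w) u) p, ν⟫ =
      ⟪dd v (IsGraph.alongN (fun x => (tangent n f (ψ x)).starProjection) w (u ∘ ψ)) x₀, ν⟫ := by
  have h1 := contMDiff_nablaN hf (isTangentField_pf hf (w : EuclideanSpace ℝ (Fin m))) hu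
  rw [nablaN, Submodule.inner_starProjection_left_eq_right,
    Submodule.starProjection_eq_self_iff.2 (show ν ∈ (tangent n f p)ᗮ from hν),
    h.D_base hf (h1.contMDiffAt.mdifferentiableAt (by simp)) v
    (Submodule.starProjection_eq_self_iff.2 v.2), (dd_congr (h.nablaN_pf hf hu w) v).eq_of_nhds]

omit [IsManifold (𝓡 n) ∞ M] in
theorem nablaN_zero_field (hf : IsSmoothImmersion n f) {X u : M → EuclideanSpace ℝ (Fin m)}
    (hX : X p = 0) : nablaN n f X u p = 0 := by
  rw [nablaN, D_zero_field (hf.2 p) hX, map_zero]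

theorem inner_hessN_pf (h : IsGraphChart f p ψ x₀) (hf : IsSmoothImmersion n f)
    (v w : tangent n f p) {ν : EuclideanSpace ℝ (Fin m)} (hν : ν ∈ normal n f p) :
    ⟪hessN n f (pf n f v) (pf n f w) (meanCurv n f) p, ν⟫ =
      ⟪dd v (IsGraph.alongN (fun x => (tangent n f (ψ x)).starProjection) w
        (IsGraph.mean (f ∘ ψ) (fun x => (tangent n f (ψ x)).starProjection) t)) x₀, ν⟫ := by
  rw [hessN, nablaN_zero_field hf (h.nablaT_pf_pf hf v w), sub_zero,
    h.inner_nablaN_nablaN_pf hf (contMDiff_meanCurv hf) v w hν,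
    (dd_congr (IsGraph.alongN_congr (h.meanCurv_comp t hf) w) v).eq_of_nhds]

theorem nablaN_meanCurv (h : IsGraphChart f p ψ x₀) (hf : IsSmoothImmersion n f)
    (v : tangent n f p) : nablaN n f (pf n f v) (meanCurv n f) p
      = ∑ i, dd v (dd (t i) (dd (t i) (f ∘ ψ))) x₀ := by
  have hg := h.isGraph hf
  rw [nablaN, h.D_base hf ((contMDiff_meanCurv hf).contMDiffAt.mdifferentiableAt (by simp)) v
    (Submodule.starProjection_eq_self_iff.2 v.2), (dd_congr (h.meanCurv_comp t hf) v).eq_of_nhds,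
    hg.dd_mean, map_sub, Submodule.starProjection_eq_self_iff.2
      (Submodule.sum_mem _ fun i _ => hg.F₃_mem _ _ _),
    (Submodule.starProjection_apply_eq_zero_iff _).2, sub_zero]
  exact Submodule.le_orthogonal_orthogonal _
    (hg.dd_P_mem v (Submodule.sum_mem _ fun i _ => hg.F₂_mem _ _))

/-- The Ricci equation for a flat normal bundle. -/
theorem inner_dd_P_comm (h : IsGraphChart f p ψ x₀) (hf : IsSmoothImmersion n f)
    (hflat : HasFlatNormalBundle n f) (u v : tangent n f p) (ν : EuclideanSpace ℝ (Fin m))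
    {μ : EuclideanSpace ℝ (Fin m)} (hμ : μ ∈ normal n f p) :
    ⟪dd v (fun x => (tangent n f (ψ x)).starProjection) x₀ ν,
      dd u (fun x => (tangent n f (ψ x)).starProjection) x₀ μ⟫
    = ⟪dd u (fun x => (tangent n f (ψ x)).starProjection) x₀ ν,
      dd v (fun x => (tangent n f (ψ x)).starProjection) x₀ μ⟫ := by
  have hg := h.isGraph hf
  refine hg.inner_dd_P_comm u v hμ ?_
  -- The normal part of a constant vector is a global smooth normal section to which flatness
  -- applies; the bracket term vanishes because `D²F` is symmetric.
  set ζ : M → EuclideanSpace ℝ (Fin m) := fun q => ν - pf n f ν q with hζ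
  have hζs : ContMDiff (𝓡 n) (𝓡 m) ∞ ζ := contMDiff_const.sub (isTangentField_pf hf ν).1
  have hζn : IsNormalField n f ζ := ⟨hζs, fun q => Submodule.sub_starProjection_mem_orthogonal _⟩
  have h1 := hflat _ _ ζ (isTangentField_pf hf (u : EuclideanSpace ℝ (Fin m)))
    (isTangentField_pf hf (v : EuclideanSpace ℝ (Fin m))) hζn p
  have hb : bracket n f (pf n f u) (pf n f v) p = 0 := by
    rw [bracket, h.D_pf_pf hf, h.D_pf_pf hf, hg.F₂_symm, sub_self]
  rw [curvN, nablaN_zero_field hf hb, sub_zero, sub_eq_zero] at h1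
  have h2 := congrArg (inner ℝ · μ) h1
  beta_reduce at h2
  rwa [h.inner_nablaN_nablaN_pf hf hζs u v hμ, h.inner_nablaN_nablaN_pf hf hζs v u hμ] at h2

end IsGraphChart

theorem D_normA (hf : IsSmoothImmersion n f) {X : M → EuclideanSpace ℝ (Fin m)} {p : M}
    (hp : normA n f p ≠ 0) :
    D n f X (normA n f) p = (2 * normA n f p)⁻¹ * D n f X (normASq n f) p := by
  have h0 : normASq n f p ≠ 0 := fun h => hp (by rw [normA, h, Real.sqrt_zero])
  refine (D_comp (Real.hasDerivAt_sqrt h0).differentiableAt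
    ((contMDiff_normASq hf).contMDiffAt.mdifferentiableAt (by simp))).trans ?_
  rw [fderiv_eq_smul_deriv, (Real.hasDerivAt_sqrt h0).deriv, smul_eq_mul, mul_comm, one_div]
  rfl

/-- The pointwise inequality; `g` stands for the squared norm of the weak gradient of `|A|`. -/
theorem simonsRHS_le_laplacian (hf : IsSmoothImmersion n f) (hflat : HasFlatNormalBundle n f)
    {ε : ℝ} (hε : 0 < ε) (p : M) {g : ℝ}
    (hg : normA n f p ≠ 0 → g = gradInner n f (normA n f) (normA n f) p)
    (hg₀ : normA n f p = 0 → g = 0) :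
    simonsRHS n f ε (katoConst n ε) g p ≤ 1 / 2 * laplacian n f (normASq n f) p := by
  obtain ⟨ψ, x₀, h⟩ := exists_isGraphChart hf p
  have hG := h.isGraph hf
  set t := stdOrthonormalBasis ℝ (tangent n f p) with ht
  have htv : ∀ i, tvec n f p i = t i := fun i => rfl
  have htf : ∀ i, tfield n f p i = pf n f (t i : EuclideanSpace ℝ (Fin m)) := fun i => rfl
  have hu := contMDiff_normASq hf
  have hu0 : IsGraph.sffNormSq (f ∘ ψ) (fun x => (tangent n f (ψ x)).starProjection) t x₀
      = normASq n f p := by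
    rw [← (h.normASq_comp t hf).eq_of_nhds, Function.comp_apply, h.base]
  have hm0 : IsGraph.mean (f ∘ ψ) (fun x => (tangent n f (ψ x)).starProjection) t x₀
      = meanCurv n f p := by
    rw [← (h.meanCurv_comp t hf).eq_of_nhds, Function.comp_apply, h.base]
  have hDu : ∀ k, D n f (tfield n f p k) (normASq n f) p = dd (t k)
      (IsGraph.sffNormSq (f ∘ ψ) (fun x => (tangent n f (ψ x)).starProjection) t) x₀ := by
    intro k
    rw [htf, h.D_base hf (hu.contMDiffAt.mdifferentiableAt (by simp)) (t k)
      (Submodule.starProjection_eq_self_iff.2 (t k).2),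
      (dd_congr (h.normASq_comp t hf) (t k)).eq_of_nhds]
  have hA0 : normA n f p = 0 ↔ normASq n f p = 0 := Real.sqrt_eq_zero (normASq_nonneg p)
  have key := hG.simons_inequality t hε
    (fun u v ν _ μ hμ => h.inner_dd_P_comm hf hflat u v ν hμ) (g := g)
    -- Where `|A| ≠ 0`, the derivative of `|A|` is that of `|A|²` divided by `2 |A|`, so `4 |A|² g`
    -- is the squared gradient of `|A|²`.
    (fun h0 => by
      rw [hu0] at h0 ⊢
      have hne : normA n f p ≠ 0 := fun h => h0 (hA0.1 h)
      rw [hg hne, gradInner, Finset.mul_sum]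
      refine Finset.sum_congr rfl fun k _ => ?_
      rw [D_normA hf hne, ← hDu, ← Real.sq_sqrt (normASq_nonneg (n := n) (f := f) p)]
      change 4 * normA n f p ^ 2 * _ = _
      field_simp
      norm_num)
    (fun h0 => hg₀ (hA0.2 (hu0 ▸ h0)))
  have e1 : ((Module.finrank ℝ (tangent n f p) : ℕ) : ℝ) = n := by rw [finrank_tangent hf]
  have e2 : katoConst (Module.finrank ℝ (tangent n f p)) ε = katoConst n ε := by
    rw [finrank_tangent hf]
  rw [e1, e2, hu0, hm0] at key
  have hlap : laplacian n f (normASq n f) p = ∑ k, dd (t k) (dd (t k)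
      (IsGraph.sffNormSq (f ∘ ψ) (fun x => (tangent n f (ψ x)).starProjection) t)) x₀ := by
    refine Finset.sum_congr rfl fun k _ => ?_
    rw [htf, h.hess_pf hf hu,
      (dd_congr (dd_congr (h.normASq_comp t hf) (t k)) (t k)).eq_of_nhds]
  rw [hlap, simonsRHS, sum_h_ddH_eq, sum_cubic_eq, normDHSq_eq, normA_pow_four]
  have h1 : ∑ i, ∑ j, ⟪secA n f (tvec n f p i) (tvec n f p j) p,
      hessN n f (pf n f (tvec n f p i)) (pf n f (tvec n f p j)) (meanCurv n f) p⟫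
      = ∑ i, ∑ j, ⟪dd (t i) (dd (t j) (f ∘ ψ)) x₀, dd (t i) (IsGraph.alongN
        (fun x => (tangent n f (ψ x)).starProjection) (t j) (IsGraph.mean (f ∘ ψ)
          (fun x => (tangent n f (ψ x)).starProjection) t)) x₀⟫ := by
    refine Finset.sum_congr rfl fun i _ => Finset.sum_congr rfl fun j _ => ?_
    rw [real_inner_comm, htv, htv, h.inner_hessN_pf t hf (t i) (t j) (secA_mem _ _ _),
      real_inner_comm, h.secA_eq hf]
  rw [h1]
  simp only [htv, h.secA_eq hf, h.nablaN_meanCurv t hf]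
  exact key

end Pointwise

end FlatNormal
end

noncomputable section

namespace FlatNormal

open scoped Topology RealInnerProductSpace

/-! ### Change of variables for the volume density -/

section ChangeOfVariables

variable {n : ℕ} {E : Type*} [NormedAddCommGroup E] [InnerProductSpace ℝ E]

theorem gramMat_comp (L : EuclideanSpace ℝ (Fin n) →L[ℝ] E)
    (T : EuclideanSpace ℝ (Fin n) →L[ℝ] EuclideanSpace ℝ (Fin n)) :
    gramMat (L.comp T) = (LinearMap.toMatrix (EuclideanSpace.basisFun (Fin n) ℝ).toBasis
      (EuclideanSpace.basisFun (Fin n) ℝ).toBasis T.toLinearMap).transpose * gramMat L *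
      LinearMap.toMatrix (EuclideanSpace.basisFun (Fin n) ℝ).toBasis
      (EuclideanSpace.basisFun (Fin n) ℝ).toBasis T.toLinearMap := by
  set e := EuclideanSpace.basisFun (Fin n) ℝ
  set A := LinearMap.toMatrix e.toBasis e.toBasis T.toLinearMap
  have hT : ∀ i, T (e i) = ∑ k, A k i • e k := by
    intro i
    have h1 := e.toBasis.sum_repr (T (e i))
    simpa [A, LinearMap.toMatrix_apply] using h1.symm
  ext i j
  rw [gramMat_apply, ContinuousLinearMap.comp_apply, ContinuousLinearMap.comp_apply, hT, hT]
  simp only [map_sum, map_smul, sum_inner, inner_sum, real_inner_smul_left, real_inner_smul_right,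
    Matrix.mul_apply, Matrix.transpose_apply, Finset.sum_mul, gramMat_apply]
  refine Finset.sum_congr rfl fun k _ => Finset.sum_congr rfl fun l _ => ?_
  ring

theorem sqrt_det_gramMat_comp (L : EuclideanSpace ℝ (Fin n) →L[ℝ] E)
    (T : EuclideanSpace ℝ (Fin n) →L[ℝ] EuclideanSpace ℝ (Fin n)) :
    √(gramMat (L.comp T)).det = |T.det| * √(gramMat L).det := by
  have h1 : (gramMat (L.comp T)).det = T.det ^ 2 * (gramMat L).det := by
    rw [gramMat_comp, Matrix.det_mul, Matrix.det_mul, Matrix.det_transpose, LinearMap.det_toMatrix]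
    change T.det * _ * T.det = _
    ring
  rw [h1, Real.sqrt_mul (sq_nonneg _), Real.sqrt_sq_eq_abs]

end ChangeOfVariables

/-! ### The Riemannian measure in charts -/

section RiemannianMeasure

variable {n m : ℕ} {M : Type*} [TopologicalSpace M] [ChartedSpace (EuclideanSpace ℝ (Fin n)) M]
  {f : M → EuclideanSpace ℝ (Fin m)}

/-- The density `√(det g_{ij})` in the chart at `p`. -/
def chartDensity (n : ℕ) {m : ℕ} {M : Type*} [TopologicalSpace M]
    [ChartedSpace (EuclideanSpace ℝ (Fin n)) M] (f : M → EuclideanSpace ℝ (Fin m)) (p : M)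
    (x : EuclideanSpace ℝ (Fin n)) : ℝ :=
  √(gramMat (fderiv ℝ (f ∘ (extChartAt (𝓡 n) p).symm) x)).det

theorem chartDensity_nonneg (p : M) (x : EuclideanSpace ℝ (Fin n)) : 0 ≤ chartDensity n f p x :=
  Real.sqrt_nonneg _

theorem measurableSet_chart_preimage [MeasurableSpace M] [BorelSpace M] (p : M) {s : Set M}
    (hs : MeasurableSet s) :
    MeasurableSet ((extChartAt (𝓡 n) p).symm ⁻¹' s ∩ (extChartAt (𝓡 n) p).target) := by
  have h1 := (continuousOn_iff_continuous_domRestrict.1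
    (continuousOn_extChartAt_symm (I := 𝓡 n) p)).measurable hs
  have h2 := MeasurableSet.subtype_image (isOpen_extChartAt_target (I := 𝓡 n) p).measurableSet h1
  convert h2 using 1
  ext x
  simp [Set.mem_image, and_comm]

variable [MeasurableSpace M] [BorelSpace M]

theorem aemeasurable_chart_symm (p : M) :
    AEMeasurable (extChartAt (𝓡 n) p).symm (volume.restrict (extChartAt (𝓡 n) p).target) :=
  (continuousOn_extChartAt_symm (I := 𝓡 n) p).aemeasurable
    (isOpen_extChartAt_target (I := 𝓡 n) p).measurableSet

omit [BorelSpace M] in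
theorem chartVol_eq (p : M) : chartVol n f p = Measure.map (extChartAt (𝓡 n) p).symm
    ((volume.restrict (extChartAt (𝓡 n) p).target).withDensity fun x =>
      ENNReal.ofReal (chartDensity n f p x)) := rfl

theorem chartVol_apply (p : M) {s : Set M} (hs : MeasurableSet s) :
    chartVol n f p s = ∫⁻ x in (extChartAt (𝓡 n) p).symm ⁻¹' s ∩ (extChartAt (𝓡 n) p).target,
      ENNReal.ofReal (chartDensity n f p x) := by
  rw [chartVol_eq, Measure.map_apply_of_aemeasurable
    ((aemeasurable_chart_symm p).mono_ac (withDensity_absolutelyContinuous _ _)) hs,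
    withDensity_apply', Measure.restrict_restrict'
    (isOpen_extChartAt_target (I := 𝓡 n) p).measurableSet]

theorem chartVol_inter_source (p : M) {s : Set M} (hs : MeasurableSet s) :
    chartVol n f p (s ∩ (extChartAt (𝓡 n) p).source) = chartVol n f p s := by
  rw [chartVol_apply p hs,
    chartVol_apply p (hs.inter (isOpen_extChartAt_source (I := 𝓡 n) p).measurableSet)]
  congr 2
  ext x
  constructor
  · rintro ⟨h1, h2⟩
    exact ⟨h1.1, h2⟩
  · rintro ⟨h1, h2⟩
    exact ⟨⟨h1, (extChartAt (𝓡 n) p).map_target h2⟩, h2⟩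

variable [IsManifold (𝓡 n) ∞ M] (hf : IsSmoothImmersion n f)
include hf

omit [MeasurableSpace M] [BorelSpace M] in
theorem contDiffAt_chartDensity {p : M} {x : EuclideanSpace ℝ (Fin n)}
    (hx : x ∈ (extChartAt (𝓡 n) p).target) : ContDiffAt ℝ ∞ (chartDensity n f p) x :=
  (contDiffAt_det (contDiffAt_gramMat (contDiffAt_fderiv_chart hf hx))).sqrt
    (det_gramMat_pos (fderiv_chart_injective hf hx)).ne'

omit [MeasurableSpace M] [BorelSpace M] in
theorem aemeasurable_chartDensity (p : M) :
    AEMeasurable (chartDensity n f p) (volume.restrict (extChartAt (𝓡 n) p).target) :=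
  ContinuousOn.aemeasurable (fun _ hx => (contDiffAt_chartDensity hf hx).continuousAt.continuousWithinAt)
    (isOpen_extChartAt_target (I := 𝓡 n) p).measurableSet

/-- The Riemannian measures of two charts agree on the overlap. -/
theorem chartVol_eq_chartVol (p q : M) {s : Set M} (hs : MeasurableSet s)
    (hp : s ⊆ (extChartAt (𝓡 n) p).source) (hq : s ⊆ (extChartAt (𝓡 n) q).source) :
    chartVol n f p s = chartVol n f q s := by
  set c := extChartAt (𝓡 n) p with hc
  set d := extChartAt (𝓡 n) q with hd
  set τ : EuclideanSpace ℝ (Fin n) → EuclideanSpace ℝ (Fin n) := d ∘ c.symm with hτ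
  set A := c.symm ⁻¹' s ∩ c.target with hA
  have hAm : MeasurableSet A := measurableSet_chart_preimage p hs
  have himg : τ '' A = d.symm ⁻¹' s ∩ d.target := by
    ext y
    constructor
    · rintro ⟨x, ⟨h1, h2⟩, rfl⟩
      refine ⟨?_, d.map_source (hq h1)⟩
      change d.symm (d (c.symm x)) ∈ s
      rw [d.left_inv (hq h1)]
      exact h1
    · rintro ⟨h1, h2⟩
      refine ⟨c (d.symm y), ⟨?_, c.map_source (hp h1)⟩, ?_⟩
      · change c.symm (c (d.symm y)) ∈ s
        rw [c.left_inv (hp h1)]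
        exact h1
      · change d (c.symm (c (d.symm y))) = y
        rw [c.left_inv (hp h1), d.right_inv h2]
  have hinj : Set.InjOn τ A := by
    rintro x ⟨h1, h2⟩ y ⟨h3, h4⟩ hxy
    have h5 : c.symm x = c.symm y := d.injOn (hq h1) (hq h3) hxy
    rw [← c.right_inv h2, h5, c.right_inv h4]
  have hdiff : ∀ x ∈ A, DifferentiableAt ℝ τ x := by
    rintro x ⟨h1, h2⟩
    have h3 : ContMDiffAt (𝓡 n) 𝓘(ℝ, EuclideanSpace ℝ (Fin n)) ∞ d (c.symm x) :=
      contMDiffAt_extChartAt' (by rw [← extChartAt_source (𝓡 n)]; exact hq h1)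
    exact (contDiffAt_comp_chart_symm h2 h3).differentiableAt (by simp)
  rw [chartVol_apply p hs, chartVol_apply q hs, ← himg,
    lintegral_image_eq_lintegral_abs_det_fderiv_mul volume hAm
      (fun x hx => (hdiff x hx).hasFDerivAt.hasFDerivWithinAt) hinj]
  refine setLIntegral_congr_fun hAm fun x hx => ?_
  have hτx : τ x ∈ d.target := d.map_source (hq hx.1)
  -- The two coordinate expressions of the immersion differ by the transition map, so their
  -- densities differ by the factor `|det Dτ|` of the change of variables.
  have hF : f ∘ c.symm =ᶠ[𝓝 x] (f ∘ d.symm) ∘ τ := by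
    have h3 : ∀ᶠ y in 𝓝 x, c.symm y ∈ d.source :=
      (contMDiffAt_chart_symm (n := n) hx.2).continuousAt.eventually
        ((isOpen_extChartAt_source (I := 𝓡 n) q).mem_nhds (hq hx.1))
    filter_upwards [h3] with y hy
    change f (c.symm y) = f (d.symm (d (c.symm y)))
    rw [d.left_inv hy]
  have hFd : DifferentiableAt ℝ (f ∘ d.symm) (τ x) :=
    (contDiffAt_comp_chart_symm hτx hf.1.contMDiffAt).differentiableAt (by simp)
  rw [chartDensity, chartDensity, ← hc, ← hd, hF.fderiv_eq, fderiv_comp x hFd (hdiff x hx),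
    sqrt_det_gramMat_comp, ENNReal.ofReal_mul (abs_nonneg _)]

/-- The Riemannian measure in a chart. -/
theorem vol_restrict_source (p : M) :
    (vol n f).restrict (extChartAt (𝓡 n) p).source = chartVol n f p := by
  set S := (extChartAt (𝓡 n) p).source with hS
  have hSm : MeasurableSet S := (isOpen_extChartAt_source (I := 𝓡 n) p).measurableSet
  have hle : ∀ q, (chartVol n f q).restrict S ≤ chartVol n f p := by
    intro q
    refine Measure.le_iff.2 fun s hs => ?_
    have hd : MeasurableSet (extChartAt (𝓡 n) q).source :=
      (isOpen_extChartAt_source (I := 𝓡 n) q).measurableSet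
    rw [Measure.restrict_apply hs, ← chartVol_inter_source q (hs.inter hSm),
      chartVol_eq_chartVol hf q p ((hs.inter hSm).inter hd) Set.inter_subset_right
        (Set.inter_subset_left.trans Set.inter_subset_right)]
    exact measure_mono (Set.inter_subset_left.trans Set.inter_subset_left)
  have hself : (chartVol n f p).restrict S = chartVol n f p := by
    refine Measure.ext fun s hs => ?_
    rw [Measure.restrict_apply hs, chartVol_inter_source p hs]
  refine le_antisymm ?_ ?_
  -- A least upper bound of measures is hard to evaluate on sets, but it lies below every upper
  -- bound. The measure on the right dominates each `chartVol n f q` and restricts to `chartVol n f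
  -- p` on `S`.
  · have h1 : vol n f ≤ chartVol n f p + (vol n f).restrict Sᶜ := by
      refine iSup_le fun q => ?_
      rw [← Measure.restrict_add_restrict_compl (μ := chartVol n f q) hSm]
      exact add_le_add (hle q) (Measure.restrict_mono_measure (le_iSup (chartVol n f) q) _)
    refine (Measure.restrict_mono_measure h1 S).trans ?_
    rw [Measure.restrict_add, hself, Measure.restrict_restrict hSm, Set.inter_compl_self,
      Measure.restrict_empty, add_zero]
  · rw [← hself]
    exact Measure.restrict_mono_measure (le_iSup (chartVol n f) p) _

/-- The density is continuous, hence bounded on a small coordinate ball, and balls have finite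
Lebesgue measure. -/
theorem isLocallyFiniteMeasure_vol : IsLocallyFiniteMeasure (vol n f) := by
  refine ⟨fun p => ?_⟩
  set c := extChartAt (𝓡 n) p with hc
  have ha : c p ∈ c.target := mem_extChartAt_target p
  have h1 : ∀ᶠ x in 𝓝 (c p), chartDensity n f p x < chartDensity n f p (c p) + 1 :=
    (contDiffAt_chartDensity hf ha).continuousAt.eventually_lt continuousAt_const (by simp)
  obtain ⟨r, hr, hball⟩ := Metric.eventually_nhds_iff_ball.1 h1
  have hsm : IsOpen (c.source ∩ c ⁻¹' Metric.ball (c p) r) :=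
    (continuousOn_extChartAt (I := 𝓡 n) p).isOpen_inter_preimage
      (isOpen_extChartAt_source (I := 𝓡 n) p) Metric.isOpen_ball
  refine ⟨c.source ∩ c ⁻¹' Metric.ball (c p) r, hsm.mem_nhds
    ⟨mem_extChartAt_source p, Metric.mem_ball_self hr⟩, ?_⟩
  have h2 : vol n f (c.source ∩ c ⁻¹' Metric.ball (c p) r)
      = chartVol n f p (c.source ∩ c ⁻¹' Metric.ball (c p) r) := by
    rw [← vol_restrict_source hf p, Measure.restrict_apply hsm.measurableSet]
    congr 1
    exact (Set.inter_eq_left.2 Set.inter_subset_left).symm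
  rw [h2, chartVol_apply p hsm.measurableSet]
  have h3 : c.symm ⁻¹' (c.source ∩ c ⁻¹' Metric.ball (c p) r) ∩ c.target
      ⊆ Metric.ball (c p) r := by
    rintro x ⟨⟨-, hx⟩, hxt⟩
    rwa [Set.mem_preimage, c.right_inv hxt] at hx
  calc _ ≤ ∫⁻ x in Metric.ball (c p) r, ENNReal.ofReal (chartDensity n f p x) :=
        lintegral_mono_set h3
    _ ≤ ∫⁻ x in Metric.ball (c p) r, ENNReal.ofReal (chartDensity n f p (c p) + 1) :=
        setLIntegral_mono measurable_const fun x hx => ENNReal.ofReal_le_ofReal (hball x hx).le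
    _ = ENNReal.ofReal (chartDensity n f p (c p) + 1) * volume (Metric.ball (c p) r) :=
        setLIntegral_const _ _
    _ < ⊤ := ENNReal.mul_lt_top ENNReal.ofReal_lt_top measure_ball_lt_top

/-- Integration of functions supported in the domain of a chart. -/
theorem integral_vol_eq {G : Type*} [NormedAddCommGroup G] [NormedSpace ℝ G] (p : M) {g : M → G}
    (hg : AEStronglyMeasurable g (vol n f)) (hs : ∀ q ∉ (extChartAt (𝓡 n) p).source, g q = 0) :
    ∫ q, g q ∂(vol n f) = ∫ x in (extChartAt (𝓡 n) p).target,
      chartDensity n f p x • g ((extChartAt (𝓡 n) p).symm x) := by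
  have hg' : AEStronglyMeasurable g (chartVol n f p) := by
    rw [← vol_restrict_source hf p]
    exact hg.restrict
  rw [← setIntegral_eq_integral_of_forall_compl_eq_zero hs, vol_restrict_source hf p]
  rw [chartVol_eq] at hg' ⊢
  rw [integral_map ((aemeasurable_chart_symm p).mono_ac (withDensity_absolutelyContinuous _ _)) hg',
    integral_withDensity_eq_integral_toReal_smul₀ (aemeasurable_chartDensity hf p).ennreal_ofReal
      (Filter.Eventually.of_forall fun _ => ENNReal.ofReal_lt_top)]
  simp only [ENNReal.toReal_ofReal (chartDensity_nonneg _ _)]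

end RiemannianMeasure

end FlatNormal
end

noncomputable section

namespace FlatNormal

open scoped Topology RealInnerProductSpace

/-! ### Jacobi's formula and the divergence in coordinates -/

section Jacobi

/-- Jacobi's formula for the derivative of the determinant. -/
theorem hasDerivAt_det {ι : Type*} [Fintype ι] [DecidableEq ι] {A : ℝ → Matrix ι ι ℝ}
    {A' : Matrix ι ι ℝ} {t : ℝ} (h : ∀ i j, HasDerivAt (fun s => A s i j) (A' i j) t)
    (hA : (A t).det ≠ 0) :
    HasDerivAt (fun s => (A s).det) ((A t).det * ((A t)⁻¹ * A').trace) t := by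
  set g : (ι → ι → ℝ) → ℝ := fun B => (Matrix.of B).det
  have hg : DifferentiableAt ℝ g (A t) := by
    refine (contDiffAt_det (k := 1) fun i j => ?_).differentiableAt (by simp)
    exact (contDiff_apply_apply ℝ ℝ i j).contDiffAt
  have h1 : ∀ (B B' : ι → ι → ℝ) (b : ℝ → ι → ι → ℝ) (s : ℝ), b s = B →
      HasDerivAt b B' s → DifferentiableAt ℝ g B → HasDerivAt (g ∘ b) (fderiv ℝ g B B') s := by
    rintro B B' b s rfl hb hB
    exact hB.hasFDerivAt.comp_hasDerivAt s hb
  have h2 : HasDerivAt (fun s => (A s).det) (fderiv ℝ g (A t) A') t :=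
    h1 (A t) A' A t rfl (hasDerivAt_pi.2 fun i => hasDerivAt_pi.2 fun j => h i j) hg
  -- By the chain rule only `A'` matters, so the path may be replaced by a straight line, along
  -- which the determinant is `det (A t)` times the polynomial `det (1 + X B)`, with `B = (A t)⁻¹
  -- A'`. Its linear coefficient is the trace of `B`.
  have h3 : HasDerivAt (fun r : ℝ => (A t + r • A').det) (fderiv ℝ g (A t) A') 0 := by
    refine h1 (A t) A' (fun r => A t + r • A') 0 (by rw [zero_smul]; exact add_zero _) ?_ hg
    refine hasDerivAt_pi.2 fun i => hasDerivAt_pi.2 fun j => ?_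
    have := ((hasDerivAt_id (0 : ℝ)).mul_const (A' i j)).const_add (A t i j)
    simpa using this
  have h4 : (fun r : ℝ => (A t + r • A').det) = fun r => (A t).det *
      (Matrix.det (1 + (Polynomial.X : Polynomial ℝ) • ((A t)⁻¹ * A').map Polynomial.C)).eval r := by
    funext r
    generalize hB : (A t)⁻¹ * A' = B
    rw [← Polynomial.coe_evalRingHom, RingHom.map_det, ← Matrix.det_mul]
    have h5 : (Polynomial.evalRingHom r).mapMatrix
        (1 + (Polynomial.X : Polynomial ℝ) • B.map Polynomial.C) = 1 + r • B := by
      ext i j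
      simp [Matrix.one_apply, apply_ite (Polynomial.eval r), mul_comm r]
    rw [h5, mul_add, mul_one, Matrix.mul_smul, ← hB, Matrix.mul_nonsing_inv_cancel_left _ _
      (isUnit_iff_ne_zero.2 hA)]
  rw [h4] at h3
  have h5 := ((Matrix.det (1 + (Polynomial.X : Polynomial ℝ) •
    ((A t)⁻¹ * A').map Polynomial.C)).hasDerivAt 0).const_mul (A t).det
  rw [Matrix.derivative_det_one_add_X_smul] at h5
  rwa [h3.unique h5] at h2

variable {n : ℕ} {E : Type*} [NormedAddCommGroup E] [InnerProductSpace ℝ E]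

theorem isLinearMap_pinv (L : EuclideanSpace ℝ (Fin n) →L[ℝ] E) : IsLinearMap ℝ (pinv L) where
  map_add v w := by
    simp only [pinv, inner_add_left, mul_add, add_smul, Finset.sum_add_distrib]
  map_smul c v := by
    simp only [pinv, real_inner_smul_left, Finset.smul_sum, smul_smul]
    refine Finset.sum_congr rfl fun i _ => Finset.sum_congr rfl fun j _ => ?_
    congr 1
    ring

/-- The derivative of the volume density of a family of injective linear maps. -/
theorem hasDerivAt_sqrt_det_gramMat {L : ℝ → EuclideanSpace ℝ (Fin n) →L[ℝ] E}
    {L' : EuclideanSpace ℝ (Fin n) →L[ℝ] E} {t : ℝ} (hL : HasDerivAt L L' t)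
    (hinj : Function.Injective (L t)) :
    HasDerivAt (fun s => √(gramMat (L s)).det) (√(gramMat (L t)).det *
      ∑ i, ⟪pinv (L t) (L' (EuclideanSpace.basisFun (Fin n) ℝ i)),
        EuclideanSpace.basisFun (Fin n) ℝ i⟫) t := by
  set e := EuclideanSpace.basisFun (Fin n) ℝ with he
  have hpos := det_gramMat_pos hinj
  have h1 : ∀ i, HasDerivAt (fun s => L s (e i)) (L' (e i)) t := fun i => by
    simpa using hL.clm_apply (hasDerivAt_const t (e i))
  have h2 := (hasDerivAt_det (A := fun s => gramMat (L s))
    (A' := Matrix.of fun i j => ⟪L t (e i), L' (e j)⟫ + ⟪L' (e i), L t (e j)⟫)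
    (fun i j => (h1 i).inner ℝ (h1 j)) hpos.ne').sqrt hpos.ne'
  refine h2.congr_deriv ?_
  have hsymm : (gramMat (L t)).transpose = gramMat (L t) := by
    ext i j
    simp [gramMat_apply, real_inner_comm]
  have hinvs : ∀ i j, (gramMat (L t))⁻¹ i j = (gramMat (L t))⁻¹ j i := fun i j => by
    conv_lhs => rw [← hsymm, ← Matrix.transpose_nonsing_inv]
    rfl
  have hp : ∀ v i, ⟪pinv (L t) v, e i⟫ = ∑ j, (gramMat (L t))⁻¹ i j * ⟪v, L t (e j)⟫ := by
    intro v i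
    simp only [pinv, sum_inner, real_inner_smul_left, ← he, orthonormal_iff_ite.1 e.orthonormal]
    rw [Finset.sum_eq_single i]
    · simp
    · intro k _ hk
      simp [hk]
    · simp
  have h3 : ((gramMat (L t))⁻¹ *
      Matrix.of fun i j => ⟪L t (e i), L' (e j)⟫ + ⟪L' (e i), L t (e j)⟫).trace
      = 2 * ∑ i, ⟪pinv (L t) (L' (e i)), e i⟫ := by
    simp only [Matrix.trace, Matrix.diag_apply, Matrix.mul_apply, Matrix.of_apply, hp, mul_add,
      Finset.sum_add_distrib, two_mul]
    congr 1
    · refine Finset.sum_congr rfl fun i _ => Finset.sum_congr rfl fun j _ => ?_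
      rw [real_inner_comm]
    · rw [Finset.sum_comm]
      refine Finset.sum_congr rfl fun i _ => Finset.sum_congr rfl fun j _ => ?_
      rw [hinvs]
  rw [h3]
  have h4 := Real.sq_sqrt hpos.le
  have h5 := (Real.sqrt_pos.2 hpos).ne'
  field_simp
  linear_combination (-(∑ i, ⟪pinv (L t) (L' (e i)), e i⟫)) * h4

theorem fderiv_sqrt_det_gramMat {W : Type*} [NormedAddCommGroup W] [NormedSpace ℝ W]
    {L : W → EuclideanSpace ℝ (Fin n) →L[ℝ] E} {x : W} (hL : ContDiffAt ℝ 1 L x)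
    (hinj : Function.Injective (L x)) (v : W) :
    fderiv ℝ (fun y => √(gramMat (L y)).det) x v = √(gramMat (L x)).det *
      ∑ i, ⟪pinv (L x) (fderiv ℝ L x v (EuclideanSpace.basisFun (Fin n) ℝ i)),
        EuclideanSpace.basisFun (Fin n) ℝ i⟫ := by
  have h0 : HasDerivAt (fun s : ℝ => x + s • v) v 0 := by
    simpa using ((hasDerivAt_id (0 : ℝ)).smul_const v).const_add x
  have h1 : HasDerivAt (fun s : ℝ => L (x + s • v)) (fderiv ℝ L x v) 0 := by
    refine HasFDerivAt.comp_hasDerivAt (0 : ℝ) (l := L) ?_ h0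
    simpa using (hL.differentiableAt (by simp)).hasFDerivAt
  have h2 : DifferentiableAt ℝ (fun y => √(gramMat (L y)).det) x :=
    ((contDiffAt_det (contDiffAt_gramMat hL)).sqrt (det_gramMat_pos hinj).ne').differentiableAt
      (by simp)
  have h3 : HasDerivAt (fun s : ℝ => √(gramMat (L (x + s • v))).det)
      (fderiv ℝ (fun y => √(gramMat (L y)).det) x v) 0 := by
    refine HasFDerivAt.comp_hasDerivAt (0 : ℝ) (l := fun y => √(gramMat (L y)).det) ?_ h0
    simpa using h2.hasFDerivAt
  have h4 := hasDerivAt_sqrt_det_gramMat h1 (by simpa using hinj)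
  rw [h3.unique h4]
  simp

/-- The divergence of `η` with respect to the metric induced by `F`. -/
theorem sum_inner_fderiv_pinv [FiniteDimensional ℝ E] {κ : Type*} [Fintype κ]
    (e : OrthonormalBasis κ ℝ E)
    {F : EuclideanSpace ℝ (Fin n) → E} {η : EuclideanSpace ℝ (Fin n) → EuclideanSpace ℝ (Fin n)}
    {x : EuclideanSpace ℝ (Fin n)} (hF : ContDiffAt ℝ ∞ F x) (hη : DifferentiableAt ℝ η x)
    (hinj : Function.Injective (fderiv ℝ F x)) :
    √(gramMat (fderiv ℝ F x)).det *
      ∑ a, ⟪fderiv ℝ (fun y => fderiv ℝ F y (η y)) x (pinv (fderiv ℝ F x) (e a)), e a⟫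
    = ∑ i, ⟪fderiv ℝ (fun y => √(gramMat (fderiv ℝ F y)).det • η y) x
        (EuclideanSpace.basisFun (Fin n) ℝ i), EuclideanSpace.basisFun (Fin n) ℝ i⟫ := by
  set ε := EuclideanSpace.basisFun (Fin n) ℝ with hε
  set L := fderiv ℝ F with hL
  have hLs : ContDiffAt ℝ 1 L x := hF.fderiv_right (by norm_cast)
  have hLd : DifferentiableAt ℝ L x := hLs.differentiableAt (by simp)
  have hJd : DifferentiableAt ℝ (fun y => √(gramMat (L y)).det) x :=
    ((contDiffAt_det (contDiffAt_gramMat hLs)).sqrt (det_gramMat_pos hinj).ne').differentiableAt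
      (by simp)
  have hlin := isLinearMap_pinv (L x)
  -- Cyclicity of the trace: `Φ ∘ pinv L` on `E` and `pinv L ∘ Φ` on `ℝ^n` have the same trace.
  have h1 : ∀ Φ : EuclideanSpace ℝ (Fin n) →L[ℝ] E,
      ∑ a, ⟪Φ (pinv (L x) (e a)), e a⟫ = ∑ i, ⟪pinv (L x) (Φ (ε i)), ε i⟫ := by
    intro Φ
    have h2 : ∀ i, ⟪pinv (L x) (Φ (ε i)), ε i⟫
        = ∑ a, ⟪e a, Φ (ε i)⟫ * ⟪pinv (L x) (e a), ε i⟫ := by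
      intro i
      conv_lhs => rw [← e.sum_repr' (Φ (ε i))]
      rw [← IsLinearMap.mk'_apply hlin, map_sum, sum_inner]
      refine Finset.sum_congr rfl fun a _ => ?_
      rw [map_smul, real_inner_smul_left, IsLinearMap.mk'_apply]
    have h3 : ∀ a, ⟪Φ (pinv (L x) (e a)), e a⟫
        = ∑ i, ⟪e a, Φ (ε i)⟫ * ⟪pinv (L x) (e a), ε i⟫ := by
      intro a
      conv_lhs => rw [← ε.sum_repr' (pinv (L x) (e a))]
      rw [map_sum, sum_inner]
      refine Finset.sum_congr rfl fun i _ => ?_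
      rw [map_smul, real_inner_smul_left, real_inner_comm, mul_comm, real_inner_comm (e a)]
    simp only [h2, h3]
    exact Finset.sum_comm
  have h4 : ∀ v, fderiv ℝ (fun y => L y (η y)) x v
      = fderiv ℝ L x v (η x) + L x (fderiv ℝ η x v) := by
    intro v
    rw [fderiv_clm_apply hLd hη]
    simp [add_comm]
  -- `L` is itself a derivative. Its symmetry turns the trace of `pinv L (D²F(·, η))` into that of
  -- `pinv L (D²F(η, ·))`, the logarithmic derivative of the density along `η`.
  have h5 : ∀ v w, fderiv ℝ L x v w = fderiv ℝ L x w v := fun v w =>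
    ((hF.of_le (m := 2) (by norm_cast)).isSymmSndFDerivAt (by simp)) v w
  have h6 : ∀ i, ⟪pinv (L x) (fderiv ℝ (fun y => L y (η y)) x (ε i)), ε i⟫
      = ⟪pinv (L x) (fderiv ℝ L x (η x) (ε i)), ε i⟫ + ⟪fderiv ℝ η x (ε i), ε i⟫ := by
    intro i
    rw [h4, hlin.map_add, pinv_apply hinj, inner_add_left, h5]
  have h7 : ∀ i, ⟪fderiv ℝ (fun y => √(gramMat (L y)).det • η y) x (ε i), ε i⟫
      = fderiv ℝ (fun y => √(gramMat (L y)).det) x (ε i) * ⟪η x, ε i⟫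
        + √(gramMat (L x)).det * ⟪fderiv ℝ η x (ε i), ε i⟫ := by
    intro i
    rw [fderiv_fun_smul hJd hη]
    simp [inner_add_left, real_inner_smul_left]
    ring
  have h8 : ∑ i, fderiv ℝ (fun y => √(gramMat (L y)).det) x (ε i) * ⟪η x, ε i⟫
      = √(gramMat (L x)).det * ∑ i, ⟪pinv (L x) (fderiv ℝ L x (η x) (ε i)), ε i⟫ := by
    rw [← fderiv_sqrt_det_gramMat hLs hinj (η x)]
    conv_rhs => rw [← ε.sum_repr' (η x)]
    rw [map_sum]
    refine Finset.sum_congr rfl fun i _ => ?_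
    rw [map_smul, smul_eq_mul, mul_comm, real_inner_comm]
  rw [h1, Finset.sum_congr rfl fun i _ => h6 i, Finset.sum_congr rfl fun i _ => h7 i,
    Finset.sum_add_distrib, Finset.sum_add_distrib, h8, mul_add, Finset.mul_sum (s := Finset.univ)
      (f := fun i => ⟪fderiv ℝ η x (ε i), ε i⟫)]

end Jacobi

end FlatNormal
end

noncomputable section

namespace FlatNormal

open scoped Topology RealInnerProductSpace

/-! ### The divergence theorem -/

section Divergence

variable {n m : ℕ} {M : Type*} [TopologicalSpace M] [ChartedSpace (EuclideanSpace ℝ (Fin n)) M]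
  {f : M → EuclideanSpace ℝ (Fin m)} {V : Type*} [NormedAddCommGroup V]

section Fields

variable [NormedSpace ℝ V]

theorem D_congr {X : M → EuclideanSpace ℝ (Fin m)} {u u' : M → V} {q : M} (h : u =ᶠ[𝓝 q] u') :
    D n f X u q = D n f X u' q := by
  rw [D, D, differential, differential, h.mfderiv_eq]
  rfl

theorem D_const {X : M → EuclideanSpace ℝ (Fin m)} (v : V) (q : M) :
    D n f X (fun _ => v) q = 0 := by
  rw [D, differential, mfderiv_const]
  rfl

theorem D_eq_zero_of_notMem_tsupport {X : M → EuclideanSpace ℝ (Fin m)} {u : M → V} {q : M}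
    (h : q ∉ tsupport u) : D n f X u q = 0 :=
  (D_congr (notMem_tsupport_iff_eventuallyEq.1 h)).trans (D_const (V := V) 0 q)

theorem D_add {X : M → EuclideanSpace ℝ (Fin m)} {u v : M → V} {q : M}
    (hu : MDifferentiableAt (𝓡 n) 𝓘(ℝ, V) u q) (hv : MDifferentiableAt (𝓡 n) 𝓘(ℝ, V) v q) :
    D n f X (u + v) q = D n f X u q + D n f X v q := by
  rw [D, differential, mfderiv_add hu hv]
  rfl

theorem contMDiff_inner {F : Type*} [NormedAddCommGroup F] [InnerProductSpace ℝ F] {u v : M → F}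
    (hu : ContMDiff (𝓡 n) 𝓘(ℝ, F) ∞ u) (hv : ContMDiff (𝓡 n) 𝓘(ℝ, F) ∞ v) :
    ContMDiff (𝓡 n) 𝓘(ℝ, ℝ) ∞ fun q => ⟪u q, v q⟫ :=
  (contDiff_inner (𝕜 := ℝ)).comp_contMDiff (hu.prodMk_space hv)

end Fields

theorem IsTangentField.smul {φ : M → ℝ} {X : M → EuclideanSpace ℝ (Fin m)}
    (hX : IsTangentField n f X) (hφ : ContMDiff (𝓡 n) 𝓘(ℝ, ℝ) ∞ φ) :
    IsTangentField n f fun q => φ q • X q :=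
  ⟨ContMDiff.smul hφ hX.1, fun q => Submodule.smul_mem _ _ (hX.2 q)⟩

variable [IsManifold (𝓡 n) ∞ M] (hf : IsSmoothImmersion n f)
include hf

theorem D_smul [NormedSpace ℝ V] {X : M → EuclideanSpace ℝ (Fin m)} {φ : M → ℝ} {u : M → V} {q : M}
    (hX : X q ∈ tangent n f q) (hφ : ContMDiff (𝓡 n) 𝓘(ℝ, ℝ) ∞ φ)
    (hu : ContMDiff (𝓡 n) 𝓘(ℝ, V) ∞ u) :
    D n f X (fun q => φ q • u q) q = D n f X φ q • u q + φ q • D n f X u q := by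
  have hq := mem_extChartAt_target (I := 𝓡 n) q
  have hφu : ContMDiff (𝓡 n) 𝓘(ℝ, V) ∞ fun q => φ q • u q := hφ.smul hu
  have h1 := (contDiffAt_comp_chart_symm hq hφ.contMDiffAt).differentiableAt (by simp)
  have h2 := (contDiffAt_comp_chart_symm hq hu.contMDiffAt).differentiableAt (by simp)
  have hb := extChartAt_to_inv (I := 𝓡 n) q
  have e1 := D_chart hf hq (X := X) (by rwa [hb]) (hφu.contMDiffAt.mdifferentiableAt (by simp))
  have e2 := D_chart hf hq (X := X) (by rwa [hb]) (hφ.contMDiffAt.mdifferentiableAt (by simp))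
  have e3 := D_chart hf hq (X := X) (by rwa [hb]) (hu.contMDiffAt.mdifferentiableAt (by simp))
  rw [hb] at e1 e2 e3
  rw [e1, e2, e3]
  have h3 : fderiv ℝ ((fun q => φ q • u q) ∘ (extChartAt (𝓡 n) q).symm) (extChartAt (𝓡 n) q q) = _ :=
    fderiv_fun_smul h1 h2
  rw [h3]
  simp only [hb, add_apply, smul_apply, ContinuousLinearMap.smulRight_apply]
  exact add_comm _ _

omit [IsManifold (𝓡 n) ∞ M] in
/-- `D_v u` at `q` is linear in `v ∈ ℝ^m`, when `v` is projected to the tangent space. -/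
theorem isLinearMap_D_pf [NormedSpace ℝ V] (u : M → V) (q : M) :
    IsLinearMap ℝ fun v => D n f (pf n f v) u q where
  map_add v w := D_add_field (hf.2 q) (pf_mem v q) (pf_mem w q) (map_add _ v w)
  map_smul c v := D_smul_field (hf.2 q) (pf_mem v q) (map_smul _ c v)

omit [IsManifold (𝓡 n) ∞ M] in
theorem D_pf_eq_zero [NormedSpace ℝ V] (u : M → V) {q : M} {v : EuclideanSpace ℝ (Fin m)}
    (hv : v ∈ (tangent n f q)ᗮ) : D n f (pf n f v) u q = 0 :=
  D_zero_field (hf.2 q) ((Submodule.starProjection_apply_eq_zero_iff _).2 hv)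

omit [IsManifold (𝓡 n) ∞ M] in
theorem D_eq_D_pf [NormedSpace ℝ V] {X : M → EuclideanSpace ℝ (Fin m)} (u : M → V) {q : M}
    (hX : X q ∈ tangent n f q) : D n f X u q = D n f (pf n f (X q)) u q := by
  have h := D_smul_field (f := f) (X := pf n f (X q)) (Z := X) (u := u) (r := 1) (hf.2 q)
    (pf_mem _ _) (by rw [one_smul, pf, Submodule.starProjection_eq_self_iff.2 hX])
  rwa [one_smul] at h

section Basis

variable {κ : Type*} [Fintype κ] (e : OrthonormalBasis κ ℝ (EuclideanSpace ℝ (Fin m)))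

omit [IsManifold (𝓡 n) ∞ M] in
theorem D_eq_sum [NormedSpace ℝ V] {X : M → EuclideanSpace ℝ (Fin m)} (u : M → V) {q : M}
    (hX : X q ∈ tangent n f q) :
    D n f X u q = ∑ a, ⟪X q, e a⟫ • D n f (pf n f (e a)) u q := by
  rw [D_eq_D_pf hf u hX, ← IsLinearMap.mk'_apply (isLinearMap_D_pf hf u q)]
  conv_lhs => rw [← e.sum_repr' (X q)]
  rw [map_sum]
  refine Finset.sum_congr rfl fun a _ => ?_
  rw [map_smul, real_inner_comm, IsLinearMap.mk'_apply]

omit [IsManifold (𝓡 n) ∞ M] in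
theorem divergence_eq (X : M → EuclideanSpace ℝ (Fin m)) (q : M) :
    divergence n f X q = ∑ a, ⟪D n f (pf n f (e a)) X q, e a⟫ := by
  have hl := isLinearMap_D_pf hf X q
  rw [← sum_bilin_subspace (tangent n f q) (fun v w => ⟪D n f (pf n f v) X q, w⟫)
    (fun w => ⟨fun x y => by rw [hl.map_add, inner_add_left],
      fun c x => by rw [hl.map_smul, real_inner_smul_left, smul_eq_mul]⟩)
    (fun v => ⟨fun x y => by rw [inner_add_right],
      fun c x => by rw [real_inner_smul_right, smul_eq_mul]⟩)
    (fun v hv w => by rw [D_pf_eq_zero hf X hv, inner_zero_left])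
    (stdOrthonormalBasis ℝ (tangent n f q)) e]
  refine Finset.sum_congr rfl fun i _ => ?_
  rw [nablaT, Submodule.inner_starProjection_left_eq_right,
    Submodule.starProjection_eq_self_iff.2
      (show tvec n f q i ∈ _ from (stdOrthonormalBasis ℝ (tangent n f q) i).2)]
  rfl

omit [IsManifold (𝓡 n) ∞ M] in
theorem gradInner_eq (u v : M → ℝ) (q : M) : gradInner n f u v q
    = ∑ a, D n f (pf n f (e a)) u q * D n f (pf n f (e a)) v q := by
  have hu := isLinearMap_D_pf hf u q
  have hv := isLinearMap_D_pf hf v q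
  exact sum_bilin_subspace (tangent n f q)
    (fun x y => D n f (pf n f x) u q * D n f (pf n f y) v q)
    (fun w => ⟨fun x y => by rw [hu.map_add, add_mul],
      fun c x => by rw [hu.map_smul, smul_eq_mul, smul_eq_mul, mul_assoc]⟩)
    (fun w => ⟨fun x y => by rw [hv.map_add, mul_add],
      fun c x => by rw [hv.map_smul, smul_eq_mul, smul_eq_mul, mul_left_comm]⟩)
    (fun x hx y => by rw [D_pf_eq_zero hf u hx, zero_mul])
    (stdOrthonormalBasis ℝ (tangent n f q)) e

end Basis

theorem contMDiff_divergence {X : M → EuclideanSpace ℝ (Fin m)} (hX : ContMDiff (𝓡 n) (𝓡 m) ∞ X) :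
    ContMDiff (𝓡 n) 𝓘(ℝ, ℝ) ∞ (divergence n f X) := by
  rw [funext fun q => divergence_eq hf (EuclideanSpace.basisFun (Fin m) ℝ) X q]
  exact contMDiff_finsetSum fun a _ =>
    contMDiff_inner (contMDiff_D hf (isTangentField_pf hf _) hX) contMDiff_const

omit [IsManifold (𝓡 n) ∞ M] in
theorem divergence_eq_zero_of_notMem_tsupport {X : M → EuclideanSpace ℝ (Fin m)} {q : M}
    (h : q ∉ tsupport X) : divergence n f X q = 0 := by
  rw [divergence_eq hf (EuclideanSpace.basisFun (Fin m) ℝ)]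
  exact Finset.sum_eq_zero fun a _ => by rw [D_eq_zero_of_notMem_tsupport h, inner_zero_left]

omit [IsManifold (𝓡 n) ∞ M] in
theorem hasCompactSupport_divergence {X : M → EuclideanSpace ℝ (Fin m)}
    (hX : HasCompactSupport X) : HasCompactSupport (divergence n f X) :=
  hX.of_isClosed_subset (isClosed_tsupport _) (closure_minimal (fun q hq => by
    by_contra h
    exact hq (divergence_eq_zero_of_notMem_tsupport hf h)) (isClosed_tsupport _))

omit [IsManifold (𝓡 n) ∞ M] in
theorem divergence_add {X Y : M → EuclideanSpace ℝ (Fin m)} {q : M}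
    (hX : MDifferentiableAt (𝓡 n) (𝓡 m) X q) (hY : MDifferentiableAt (𝓡 n) (𝓡 m) Y q) :
    divergence n f (X + Y) q = divergence n f X q + divergence n f Y q := by
  simp only [divergence_eq hf (EuclideanSpace.basisFun (Fin m) ℝ), D_add hX hY, inner_add_left,
    Finset.sum_add_distrib]

theorem divergence_smul {φ : M → ℝ} {X : M → EuclideanSpace ℝ (Fin m)}
    (hφ : ContMDiff (𝓡 n) 𝓘(ℝ, ℝ) ∞ φ) (hX : IsTangentField n f X) (q : M) :
    divergence n f (fun q => φ q • X q) q = D n f X φ q + φ q * divergence n f X q := by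
  have h := fun v => D_smul (f := f) (X := pf n f v) (q := q) hf (pf_mem v q) hφ hX.1
  simp only [divergence_eq hf (EuclideanSpace.basisFun (Fin m) ℝ), h, inner_add_left,
    Finset.sum_add_distrib, real_inner_smul_left, ← Finset.mul_sum]
  rw [D_eq_sum hf (EuclideanSpace.basisFun (Fin m) ℝ) φ (hX.2 q)]
  congr 1
  refine Finset.sum_congr rfl fun a _ => ?_
  rw [smul_eq_mul, mul_comm]

/-- The divergence in a chart. -/
theorem chartDensity_mul_divergence {p : M} {X : M → EuclideanSpace ℝ (Fin m)}
    (hX : IsTangentField n f X) {x : EuclideanSpace ℝ (Fin n)}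
    (hx : x ∈ (extChartAt (𝓡 n) p).target) :
    chartDensity n f p x * divergence n f X ((extChartAt (𝓡 n) p).symm x) =
      ∑ i, ⟪fderiv ℝ (fun y => chartDensity n f p y •
        pinv (fderiv ℝ (f ∘ (extChartAt (𝓡 n) p).symm) y) (X ((extChartAt (𝓡 n) p).symm y))) x
        (EuclideanSpace.basisFun (Fin n) ℝ i), EuclideanSpace.basisFun (Fin n) ℝ i⟫ := by
  set c := extChartAt (𝓡 n) p with hc
  set e := EuclideanSpace.basisFun (Fin m) ℝ
  have hinj := fderiv_chart_injective hf hx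
  have hη : ContDiffAt ℝ ∞ (fun y => pinv (fderiv ℝ (f ∘ c.symm) y) (X (c.symm y))) x :=
    contDiffAt_pinv (contDiffAt_fderiv_chart hf hx)
      (contDiffAt_comp_chart_symm hx hX.1.contMDiffAt) hinj
  have h1 := sum_inner_fderiv_pinv e (contDiffAt_comp_chart_symm hx hf.1.contMDiffAt)
    (hη.differentiableAt (by simp)) hinj
  refine Eq.trans ?_ h1
  rw [divergence_eq hf e]
  congr 1
  refine Finset.sum_congr rfl fun a _ => ?_
  have h2 : X ∘ c.symm =ᶠ[𝓝 x]
      fun y => fderiv ℝ (f ∘ c.symm) y (pinv (fderiv ℝ (f ∘ c.symm) y) (X (c.symm y))) := by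
    filter_upwards [(isOpen_extChartAt_target (I := 𝓡 n) p).mem_nhds hx] with y hy
    rw [apply_pinv_chart hf hy, Submodule.starProjection_eq_self_iff.2 (hX.2 _)]
    rfl
  rw [D_chart hf hx (pf_mem _ _) (hX.1.contMDiffAt.mdifferentiableAt (by simp)), h2.fderiv_eq, pf,
    ← apply_pinv_chart hf hx, pinv_apply hinj]

-- Each summand is a directional derivative of a compactly supported function; integrating it by
-- parts against the constant `1` gives zero.
omit hf [IsManifold (𝓡 n) ∞ M] in
theorem integral_sum_inner_fderiv_eq_zero
    {ξ : EuclideanSpace ℝ (Fin n) → EuclideanSpace ℝ (Fin n)} (hξ : ContDiff ℝ 1 ξ)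
    (hc : HasCompactSupport ξ) :
    ∫ x, ∑ i, ⟪fderiv ℝ ξ x (EuclideanSpace.basisFun (Fin n) ℝ i),
      EuclideanSpace.basisFun (Fin n) ℝ i⟫ = 0 := by
  set e := EuclideanSpace.basisFun (Fin n) ℝ
  have hcont : Continuous (fderiv ℝ ξ) := hξ.continuous_fderiv (by simp)
  have hsupp : HasCompactSupport (fderiv ℝ ξ) := hc.fderiv (𝕜 := ℝ)
  have hint : ∀ i, Integrable fun x => ⟪fderiv ℝ ξ x (e i), e i⟫ := fun i =>
    Continuous.integrable_of_hasCompactSupport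
      ((hcont.clm_apply continuous_const).inner continuous_const)
      (hsupp.comp_left (g := fun L : EuclideanSpace ℝ (Fin n) →L[ℝ] _ => ⟪L (e i), e i⟫) (by simp))
  rw [integral_finsetSum _ fun i _ => hint i]
  refine Finset.sum_eq_zero fun i _ => ?_
  have hd : Differentiable ℝ fun x => ⟪ξ x, e i⟫ := (hξ.inner ℝ contDiff_const).differentiable (by simp)
  have h1 : ∀ x, fderiv ℝ (fun x => ⟪ξ x, e i⟫) x (e i) = ⟪fderiv ℝ ξ x (e i), e i⟫ := by
    intro x
    rw [fderiv_inner_apply ℝ ((hξ.differentiable (by simp)) x) (differentiableAt_const _)]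
    simp
  have h3 : Integrable fun x => ⟪ξ x, e i⟫ :=
    Continuous.integrable_of_hasCompactSupport (hξ.continuous.inner continuous_const)
      (hc.comp_left (g := fun v => ⟪v, e i⟫) (inner_zero_left _))
  have h2 := integral_mul_fderiv_eq_neg_fderiv_mul_of_integrable (μ := volume)
    (f := fun _ : EuclideanSpace ℝ (Fin n) => (1 : ℝ)) (g := fun x => ⟪ξ x, e i⟫) (v := e i)
    (by simp) (by simpa [h1] using hint i)
    (by simpa using h3)
    (fun _ _ => differentiableAt_const _) (fun x _ => hd x)
  simpa [h1] using h2

variable [MeasurableSpace M] [BorelSpace M]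

/-- In the chart, density times divergence is the Euclidean divergence of density times the
coordinate field, whose integral vanishes. -/
theorem integral_divergence_eq_zero_of_chart {p : M} {X : M → EuclideanSpace ℝ (Fin m)}
    (hX : IsTangentField n f X) (hXc : HasCompactSupport X)
    (hXs : tsupport X ⊆ (extChartAt (𝓡 n) p).source) :
    ∫ q, divergence n f X q ∂(vol n f) = 0 := by
  set c := extChartAt (𝓡 n) p with hc
  have hct : IsOpen c.target := isOpen_extChartAt_target (I := 𝓡 n) p
  set η : EuclideanSpace ℝ (Fin n) → EuclideanSpace ℝ (Fin n) :=
    fun y => chartDensity n f p y • pinv (fderiv ℝ (f ∘ c.symm) y) (X (c.symm y)) with hη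
  -- Outside the chart target `η` has no meaning and is replaced by zero. The extension is `C¹`
  -- because it vanishes off the compact set `K`, which lies inside the open target.
  set ξ := c.target.indicator η with hξ
  set K := c '' tsupport X with hK
  have hKc : IsCompact K := hXc.image_of_continuousOn ((continuousOn_extChartAt (I := 𝓡 n) p).mono hXs)
  have hKt : K ⊆ c.target := by
    rintro _ ⟨q, hq, rfl⟩
    exact c.map_source (hXs hq)
  have hξ0 : ∀ x ∉ K, ξ x = 0 := by
    intro x hx
    by_cases hxt : x ∈ c.target
    · rw [hξ, Set.indicator_of_mem hxt, hη]
      have h1 : X (c.symm x) = 0 := by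
        by_contra h
        exact hx ⟨c.symm x, subset_tsupport _ h, c.right_inv hxt⟩
      simp only [h1, (isLinearMap_pinv _).map_zero, smul_zero]
    · exact Set.indicator_of_notMem hxt _
  have hξη : ∀ x ∈ c.target, ξ =ᶠ[𝓝 x] η := fun x hx => by
    filter_upwards [hct.mem_nhds hx] with y hy
    exact Set.indicator_of_mem hy _
  have hξn : ∀ x ∉ c.target, ξ =ᶠ[𝓝 x] fun _ => 0 := fun x hx => by
    filter_upwards [hKc.isClosed.isOpen_compl.mem_nhds fun h => hx (hKt h)] with y hy
    exact hξ0 y hy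
  have hξs : ContDiff ℝ 1 ξ := by
    refine contDiff_iff_contDiffAt.2 fun x => ?_
    by_cases hx : x ∈ c.target
    · refine ContDiffAt.congr_of_eventuallyEq ?_ (hξη x hx)
      refine ContDiffAt.of_le (n := ∞) ?_ (by norm_cast)
      exact (contDiffAt_chartDensity hf hx).smul (contDiffAt_pinv (contDiffAt_fderiv_chart hf hx)
        (contDiffAt_comp_chart_symm hx hX.1.contMDiffAt) (fderiv_chart_injective hf hx))
    · exact contDiffAt_const.congr_of_eventuallyEq (hξn x hx)
  rw [integral_vol_eq hf p (contMDiff_divergence hf hX.1).continuous.aestronglyMeasurable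
    fun q hq => divergence_eq_zero_of_notMem_tsupport hf fun h => hq (hXs h)]
  refine Eq.trans ?_ (integral_sum_inner_fderiv_eq_zero hξs (HasCompactSupport.intro hKc hξ0))
  refine Eq.trans ?_ (setIntegral_eq_integral_of_forall_compl_eq_zero (s := c.target) ?_)
  · refine setIntegral_congr_fun hct.measurableSet fun x hx => ?_
    simp only [(hξη x hx).fderiv_eq, smul_eq_mul]
    exact chartDensity_mul_divergence hf hX hx
  · intro x hx
    simp [(hξn x hx).fderiv_eq]

theorem integral_divergence_sum [IsLocallyFiniteMeasure (vol n f)] {ι : Type*} (T : Finset ι)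
    {Y : ι → M → EuclideanSpace ℝ (Fin m)} (hY : ∀ i, IsTangentField n f (Y i))
    (hYc : ∀ i, HasCompactSupport (Y i)) (hY0 : ∀ i, ∫ q, divergence n f (Y i) q ∂(vol n f) = 0) :
    IsTangentField n f (∑ i ∈ T, Y i) ∧ HasCompactSupport (∑ i ∈ T, Y i) ∧
      ∫ q, divergence n f (∑ i ∈ T, Y i) q ∂(vol n f) = 0 := by
  classical
  induction T using Finset.induction_on with
  | empty =>
    have h2 : ∀ q, divergence n f (0 : M → EuclideanSpace ℝ (Fin m)) q = 0 := fun q =>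
      divergence_eq_zero_of_notMem_tsupport hf (by simp)
    rw [Finset.sum_empty]
    refine ⟨⟨contMDiff_const, fun q => Submodule.zero_mem _⟩, HasCompactSupport.zero, ?_⟩
    simp only [h2, integral_zero]
  | insert p T hp ih =>
    obtain ⟨ih1, ih2, ih3⟩ := ih
    rw [Finset.sum_insert hp]
    refine ⟨⟨(hY p).1.add ih1.1, fun q => Submodule.add_mem _ ((hY p).2 q) (ih1.2 q)⟩,
      (hYc p).add ih2, ?_⟩
    have h2 : ∀ {Z : M → EuclideanSpace ℝ (Fin m)}, IsTangentField n f Z → HasCompactSupport Z →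
        Integrable (divergence n f Z) (vol n f) := fun hZ hZc =>
      (contMDiff_divergence hf hZ.1).continuous.integrable_of_hasCompactSupport
        (hasCompactSupport_divergence hf hZc)
    have h3 : ∀ q, divergence n f (Y p + ∑ i ∈ T, Y i) q
        = divergence n f (Y p) q + divergence n f (∑ i ∈ T, Y i) q := fun q =>
      divergence_add hf ((hY p).1.contMDiffAt.mdifferentiableAt (by simp))
        (ih1.1.contMDiffAt.mdifferentiableAt (by simp))
    simp only [h3]
    rw [integral_add (h2 (hY p) (hYc p)) (h2 ih1 ih2), ih3, hY0, add_zero]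

variable [T2Space M] [SecondCountableTopology M]

/-- The divergence theorem. -/
theorem integral_divergence_eq_zero {X : M → EuclideanSpace ℝ (Fin m)}
    (hX : IsTangentField n f X) (hXc : HasCompactSupport X) :
    ∫ q, divergence n f X q ∂(vol n f) = 0 := by
  have : LocallyCompactSpace M := Manifold.locallyCompact_of_finiteDimensional (𝓡 n)
  have : IsLocallyFiniteMeasure (vol n f) := isLocallyFiniteMeasure_vol hf
  obtain ⟨ρ, hρ⟩ := SmoothPartitionOfUnity.exists_isSubordinate (𝓡 n) (isClosed_tsupport X)
    (fun p : M => (extChartAt (𝓡 n) p).source) (fun p => isOpen_extChartAt_source p)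
    (fun q _ => Set.mem_iUnion.2 ⟨q, mem_extChartAt_source q⟩)
  -- Only finitely many members of the partition of unity meet the compact support, so `X` is a
  -- finite sum of fields supported in chart domains.
  set S := (ρ.locallyFinite.finite_nonempty_inter_compact hXc).toFinset with hS
  have hρX : ∀ p, IsTangentField n f fun q => ρ p q • X q := fun p =>
    hX.smul (ρ p).contMDiff
  have hρc : ∀ p, HasCompactSupport fun q => ρ p q • X q := fun p =>
    hXc.smul_left (f := ρ p)
  have h1 := (integral_divergence_sum hf S hρX hρc fun p =>
    integral_divergence_eq_zero_of_chart hf (hρX p) (hρc p)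
      ((tsupport_smul_subset_left _ _).trans (hρ p))).2.2
  have h3 : X = ∑ p ∈ S, fun q => ρ p q • X q := by
    funext q
    rw [Finset.sum_apply, ← Finset.sum_smul]
    by_cases hq : q ∈ tsupport X
    · rw [ρ.sum_finsupport' q hq, one_smul]
      intro p hp
      rw [hS, Set.Finite.mem_toFinset]
      exact ⟨q, (ρ.mem_finsupport q).1 hp, hq⟩
    · rw [image_eq_zero_of_notMem_tsupport hq, smul_zero]
  rwa [← h3] at h1

end Divergence

end FlatNormal
end

noncomputable section

namespace FlatNormal

open scoped Topology RealInnerProductSpace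

/-! ### Gradient, Laplacian and Green's formula -/

section Gradient

variable {n m : ℕ} {M : Type*} [TopologicalSpace M] [ChartedSpace (EuclideanSpace ℝ (Fin n)) M]
  {f : M → EuclideanSpace ℝ (Fin m)} {V : Type*} [NormedAddCommGroup V] [NormedSpace ℝ V]

theorem D_clm {W : Type*} [NormedAddCommGroup W] [NormedSpace ℝ W]
    {X : M → EuclideanSpace ℝ (Fin m)} {u : M → V} {p : M} (L : V →L[ℝ] W)
    (hu : MDifferentiableAt (𝓡 n) 𝓘(ℝ, V) u p) :
    D n f X (fun q => L (u q)) p = L (D n f X u p) := by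
  have h := D_comp (f := f) (X := X) (g := L) L.differentiableAt hu
  rwa [L.fderiv] at h

/-- The gradient of a function. -/
def grad (n : ℕ) {m : ℕ} {M : Type*} [TopologicalSpace M]
    [ChartedSpace (EuclideanSpace ℝ (Fin n)) M] (f : M → EuclideanSpace ℝ (Fin m)) (u : M → ℝ)
    (q : M) : EuclideanSpace ℝ (Fin m) :=
  ∑ a, D n f (pf n f (EuclideanSpace.basisFun (Fin m) ℝ a)) u q •
    pf n f (EuclideanSpace.basisFun (Fin m) ℝ a) q

theorem grad_mem (u : M → ℝ) (q : M) : grad n f u q ∈ tangent n f q :=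
  Submodule.sum_mem _ fun _ _ => Submodule.smul_mem _ _ (pf_mem _ _)

variable (hf : IsSmoothImmersion n f)

theorem isTangentField_grad [IsManifold (𝓡 n) ∞ M] (hf : IsSmoothImmersion n f) {u : M → ℝ}
    (hu : ContMDiff (𝓡 n) 𝓘(ℝ, ℝ) ∞ u) : IsTangentField n f (grad n f u) :=
  ⟨contMDiff_finsetSum fun _ _ => ContMDiff.smul (contMDiff_D hf (isTangentField_pf hf _) hu)
    (isTangentField_pf hf _).1, grad_mem u⟩

include hf

theorem inner_grad_pf (u : M → ℝ) (v : EuclideanSpace ℝ (Fin m)) (q : M) :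
    ⟪grad n f u q, v⟫ = D n f (pf n f v) u q := by
  rw [D_eq_sum hf (EuclideanSpace.basisFun (Fin m) ℝ) u (pf_mem v q), grad, sum_inner]
  refine Finset.sum_congr rfl fun a _ => ?_
  rw [real_inner_smul_left, pf, pf, Submodule.inner_starProjection_left_eq_right, real_inner_comm,
    smul_eq_mul, mul_comm]

theorem inner_grad (u : M → ℝ) {X : M → EuclideanSpace ℝ (Fin m)} {q : M}
    (hX : X q ∈ tangent n f q) : ⟪grad n f u q, X q⟫ = D n f X u q := by
  rw [inner_grad_pf hf, D_eq_D_pf hf u hX]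

theorem inner_grad_grad (u v : M → ℝ) (q : M) :
    ⟪grad n f u q, grad n f v q⟫ = gradInner n f u v q := by
  rw [inner_grad hf u (grad_mem v q), D_eq_sum hf (EuclideanSpace.basisFun (Fin m) ℝ) u
    (grad_mem v q), gradInner_eq hf (EuclideanSpace.basisFun (Fin m) ℝ)]
  refine Finset.sum_congr rfl fun a _ => ?_
  rw [inner_grad_pf hf, smul_eq_mul, mul_comm]

variable [IsManifold (𝓡 n) ∞ M]

/-- The extended basis fields are parallel at `p`, and the derivative of `u` along such a field is
the pairing of the gradient with the constant vector `e_i`. So each diagonal Hessian entry is `⟨D_i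
grad u, e_i⟩`. -/
theorem laplacian_eq_divergence {u : M → ℝ} (hu : ContMDiff (𝓡 n) 𝓘(ℝ, ℝ) ∞ u) (p : M) :
    laplacian n f u p = divergence n f (grad n f u) p := by
  obtain ⟨ψ, x₀, h⟩ := exists_isGraphChart hf p
  refine Finset.sum_congr rfl fun i _ => ?_
  have h1 : nablaT n f (tfield n f p i) (tfield n f p i) p = 0 :=
    h.nablaT_pf_pf hf (stdOrthonormalBasis ℝ (tangent n f p) i)
      (stdOrthonormalBasis ℝ (tangent n f p) i)
  have h2 : D n f (tfield n f p i) u = fun q => innerSL ℝ (tvec n f p i) (grad n f u q) := by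
    funext q
    rw [innerSL_apply_apply, real_inner_comm, inner_grad_pf hf]
    rfl
  rw [hess, D_zero_field (hf.2 p) h1, sub_zero, h2, D_clm _
    ((isTangentField_grad hf hu).1.contMDiffAt.mdifferentiableAt (by simp)), innerSL_apply_apply,
    nablaT, Submodule.inner_starProjection_left_eq_right, Submodule.starProjection_eq_self_iff.2
      (show tvec n f p i ∈ _ from (stdOrthonormalBasis ℝ (tangent n f p) i).2), real_inner_comm]

theorem contMDiff_laplacian {u : M → ℝ} (hu : ContMDiff (𝓡 n) 𝓘(ℝ, ℝ) ∞ u) :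
    ContMDiff (𝓡 n) 𝓘(ℝ, ℝ) ∞ (laplacian n f u) := by
  rw [funext fun q => laplacian_eq_divergence hf hu q]
  exact contMDiff_divergence hf (isTangentField_grad hf hu).1

theorem contMDiff_gradInner {u v : M → ℝ} (hu : ContMDiff (𝓡 n) 𝓘(ℝ, ℝ) ∞ u)
    (hv : ContMDiff (𝓡 n) 𝓘(ℝ, ℝ) ∞ v) : ContMDiff (𝓡 n) 𝓘(ℝ, ℝ) ∞ (gradInner n f u v) := by
  rw [← funext fun q => inner_grad_grad hf u v q]
  exact contMDiff_inner (isTangentField_grad hf hu).1 (isTangentField_grad hf hv).1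

omit [IsManifold (𝓡 n) ∞ M] in
theorem hasCompactSupport_gradInner {u v : M → ℝ} (hv : HasCompactSupport v) :
    HasCompactSupport (gradInner n f u v) :=
  hv.mono' fun q hq => by
    by_contra h
    refine hq ?_
    rw [gradInner_eq hf (EuclideanSpace.basisFun (Fin m) ℝ)]
    exact Finset.sum_eq_zero fun a _ => by rw [D_eq_zero_of_notMem_tsupport h, mul_zero]

variable [MeasurableSpace M] [BorelSpace M]

theorem integrable_of_continuous {G : Type*} [NormedAddCommGroup G] {g : M → G}
    (hg : Continuous g) (hc : HasCompactSupport g) : Integrable g (vol n f) := by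
  have : IsLocallyFiniteMeasure (vol n f) := isLocallyFiniteMeasure_vol hf
  exact hg.integrable_of_hasCompactSupport hc

variable [T2Space M] [SecondCountableTopology M]

/-- Integration by parts against a compactly supported tangent field. -/
theorem integral_mul_divergence {u : M → ℝ} (hu : ContMDiff (𝓡 n) 𝓘(ℝ, ℝ) ∞ u)
    {X : M → EuclideanSpace ℝ (Fin m)} (hX : IsTangentField n f X) (hXc : HasCompactSupport X) :
    ∫ q, u q * divergence n f X q ∂(vol n f) = -∫ q, ⟪grad n f u q, X q⟫ ∂(vol n f) := by
  have h1 := integral_divergence_eq_zero hf (hX.smul hu) (hXc.smul_left (f := u))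
  have h2 : ∀ q, divergence n f (fun q => u q • X q) q
      = ⟪grad n f u q, X q⟫ + u q * divergence n f X q := fun q => by
    rw [divergence_smul hf hu hX, inner_grad hf u (hX.2 q)]
  simp only [h2] at h1
  rw [integral_add] at h1
  · linarith
  · refine integrable_of_continuous hf
      (contMDiff_inner (isTangentField_grad hf hu).1 hX.1).continuous
      (HasCompactSupport.intro hXc fun q hq => ?_)
    rw [image_eq_zero_of_notMem_tsupport hq, inner_zero_right]
  · exact integrable_of_continuous hf
      (hu.continuous.mul (contMDiff_divergence hf hX.1).continuous)
      (hasCompactSupport_divergence hf hXc).mul_left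

/-- Green's formula. -/
theorem integral_laplacian_mul {u φ : M → ℝ} (hu : ContMDiff (𝓡 n) 𝓘(ℝ, ℝ) ∞ u)
    (hφ : ContMDiff (𝓡 n) 𝓘(ℝ, ℝ) ∞ φ) (hc : HasCompactSupport φ) :
    ∫ q, laplacian n f u q * φ q ∂(vol n f) = -∫ q, gradInner n f u φ q ∂(vol n f) := by
  have hT := isTangentField_grad hf hu
  have h1 := integral_divergence_eq_zero hf (hT.smul hφ) (hc.smul_right (f' := grad n f u))
  have h2 : ∀ q, divergence n f (fun q => φ q • grad n f u q) q
      = laplacian n f u q * φ q + gradInner n f u φ q := fun q => by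
    rw [divergence_smul hf hφ hT, laplacian_eq_divergence hf hu, ← inner_grad hf φ (grad_mem u q),
      real_inner_comm, inner_grad_grad hf]
    ring
  simp only [h2] at h1
  rw [integral_add] at h1
  · linarith
  · exact integrable_of_continuous hf ((contMDiff_laplacian hf hu).continuous.mul hφ.continuous)
      hc.mul_left
  · exact integrable_of_continuous hf (contMDiff_gradInner hf hu hφ).continuous
      (hasCompactSupport_gradInner hf hc)

end Gradient

end FlatNormal
end

noncomputable section

namespace FlatNormal

open scoped Topology RealInnerProductSpace

/-! ### Continuity of the right-hand side -/

section Continuity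

variable {n m : ℕ} {M : Type*} [TopologicalSpace M] [ChartedSpace (EuclideanSpace ℝ (Fin n)) M]
  {f : M → EuclideanSpace ℝ (Fin m)} (hf : IsSmoothImmersion n f)
include hf

theorem isLinearMap_nablaN_pf (u : M → EuclideanSpace ℝ (Fin m)) (q : M) :
    IsLinearMap ℝ fun v => nablaN n f (pf n f v) u q where
  map_add v w := by
    simp only [nablaN, (isLinearMap_D_pf hf u q).map_add, map_add]
  map_smul c v := by
    simp only [nablaN, (isLinearMap_D_pf hf u q).map_smul, map_smul]

theorem nablaN_add_field {X Y Z u : M → EuclideanSpace ℝ (Fin m)} {p : M}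
    (hX : X p ∈ tangent n f p) (hY : Y p ∈ tangent n f p) (hZ : Z p = X p + Y p) :
    nablaN n f Z u p = nablaN n f X u p + nablaN n f Y u p := by
  rw [nablaN, nablaN, nablaN, D_add_field (hf.2 p) hX hY hZ, map_add]

theorem nablaN_smul_field {X Z u : M → EuclideanSpace ℝ (Fin m)} {p : M} {r : ℝ}
    (hX : X p ∈ tangent n f p) (hZ : Z p = r • X p) :
    nablaN n f Z u p = r • nablaN n f X u p := by
  rw [nablaN, nablaN, D_smul_field (hf.2 p) hX hZ, map_smul]

omit hf in
theorem nablaT_mem (X Y : M → EuclideanSpace ℝ (Fin m)) (q : M) :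
    nablaT n f X Y q ∈ tangent n f q :=
  Submodule.starProjection_apply_mem _ _

theorem isLinearMap_hessN_left (Y η : M → EuclideanSpace ℝ (Fin m)) (q : M) :
    IsLinearMap ℝ fun v => hessN n f (pf n f v) Y η q where
  map_add v w := by
    have h := isLinearMap_D_pf hf Y q
    simp only [hessN]
    rw [(isLinearMap_nablaN_pf hf (nablaN n f Y η) q).map_add,
      nablaN_add_field hf (Z := nablaT n f (pf n f (v + w)) Y) (nablaT_mem (pf n f v) Y q)
        (nablaT_mem (pf n f w) Y q) (by simp only [nablaT, h.map_add, map_add])]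
    abel
  map_smul c v := by
    have h := isLinearMap_D_pf hf Y q
    simp only [hessN]
    rw [(isLinearMap_nablaN_pf hf (nablaN n f Y η) q).map_smul,
      nablaN_smul_field hf (r := c) (Z := nablaT n f (pf n f (c • v)) Y) (nablaT_mem (pf n f v) Y q)
        (by simp only [nablaT, h.map_smul, map_smul]), smul_sub]

variable [IsManifold (𝓡 n) ∞ M]

theorem isLinearMap_hessN_right {X η : M → EuclideanSpace ℝ (Fin m)} (q : M)
    (hη : ContMDiff (𝓡 n) (𝓡 m) ∞ η) :
    IsLinearMap ℝ fun w => hessN n f X (pf n f w) η q := by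
  have hd : ∀ w, MDifferentiableAt (𝓡 n) (𝓡 m) (nablaN n f (pf n f w) η) q := fun w =>
    (contMDiff_nablaN hf (isTangentField_pf hf w) hη).contMDiffAt.mdifferentiableAt (by simp)
  have hp : ∀ w, MDifferentiableAt (𝓡 n) (𝓡 m) (pf n f w) q := fun w =>
    (isTangentField_pf hf w).1.contMDiffAt.mdifferentiableAt (by simp)
  constructor
  · intro v w
    have h1 : nablaN n f (pf n f (v + w)) η = nablaN n f (pf n f v) η + nablaN n f (pf n f w) η :=
      funext fun q => (isLinearMap_nablaN_pf hf η q).map_add v w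
    have h2 : pf n f (v + w) = pf n f v + pf n f w := funext fun q => map_add _ v w
    simp only [hessN]
    rw [h1, nablaN, D_add (hd v) (hd w), map_add, nablaN_add_field hf
      (Z := nablaT n f X (pf n f (v + w))) (nablaT_mem X (pf n f v) q) (nablaT_mem X (pf n f w) q)
      (by rw [h2, nablaT, D_add (hp v) (hp w), map_add]; rfl)]
    simp only [nablaN]
    abel
  · intro c v
    have h1 : nablaN n f (pf n f (c • v)) η = fun q =>
        (c • ContinuousLinearMap.id ℝ (EuclideanSpace ℝ (Fin m))) (nablaN n f (pf n f v) η q) :=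
      funext fun q => (isLinearMap_nablaN_pf hf η q).map_smul c v
    have h2 : pf n f (c • v) = fun q =>
        (c • ContinuousLinearMap.id ℝ (EuclideanSpace ℝ (Fin m))) (pf n f v q) :=
      funext fun q => map_smul _ c v
    simp only [hessN]
    rw [h1, nablaN, D_clm _ (hd v), nablaN_smul_field hf (r := c)
      (Z := nablaT n f X (pf n f (c • v))) (nablaT_mem X (pf n f v) q)
      (by rw [h2, nablaT, D_clm _ (hp v)]; exact (tangent n f q).starProjection.map_smul _ _),
      smul_sub]
    congr 1
    exact (tangent n f q)ᗮ.starProjection.map_smul _ _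

theorem contMDiff_hessN_pf {η : M → EuclideanSpace ℝ (Fin m)} (hη : ContMDiff (𝓡 n) (𝓡 m) ∞ η)
    (v w : EuclideanSpace ℝ (Fin m)) :
    ContMDiff (𝓡 n) (𝓡 m) ∞ (hessN n f (pf n f v) (pf n f w) η) :=
  (contMDiff_nablaN hf (isTangentField_pf hf v)
    (contMDiff_nablaN hf (isTangentField_pf hf w) hη)).sub
    (contMDiff_nablaN hf (contMDiff_nablaT hf (isTangentField_pf hf v) (isTangentField_pf hf w).1) hη)

section Basis

variable {κ : Type*} [Fintype κ] (e : OrthonormalBasis κ ℝ (EuclideanSpace ℝ (Fin m)))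

/-- The factor `secA` vanishes on normal vectors, so both traces extend from the tangent space to a
fixed ambient basis. This and its companions below remove the bases chosen point by point, which
obstruct continuity. -/
theorem sum_h_ddH_eq_basis (q : M) : ∑ α, ∑ i, ∑ j, h n f q α i j * ddH n f q i j α
    = ∑ a, ∑ b, ⟪secA n f (e a) (e b) q,
      hessN n f (pf n f (e a)) (pf n f (e b)) (meanCurv n f) q⟫ := by
  have hH := contMDiff_meanCurv hf
  rw [sum_h_ddH_eq]
  have h1 : ∀ v, ∑ j, ⟪secA n f v (tvec n f q j) q,
        hessN n f (pf n f v) (pf n f (tvec n f q j)) (meanCurv n f) q⟫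
      = ∑ b, ⟪secA n f v (e b) q, hessN n f (pf n f v) (pf n f (e b)) (meanCurv n f) q⟫ := by
    intro v
    have hl := secA_isLinearMap_right hf v q
    have hr := isLinearMap_hessN_right hf (X := pf n f v) q hH
    exact sum_bilin_subspace (tangent n f q)
      (fun x y => ⟪secA n f v x q, hessN n f (pf n f v) (pf n f y) (meanCurv n f) q⟫)
      (fun w => ⟨fun x y => by rw [hl.map_add, inner_add_left],
        fun c x => by rw [hl.map_smul, real_inner_smul_left, smul_eq_mul]⟩)
      (fun w => ⟨fun x y => by rw [hr.map_add, inner_add_right],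
        fun c x => by rw [hr.map_smul, real_inner_smul_right, smul_eq_mul]⟩)
      (fun x hx y => by rw [secA_symm hf, secA_eq_zero hf hx, inner_zero_left])
      (stdOrthonormalBasis ℝ (tangent n f q)) e
  simp only [h1]
  rw [Finset.sum_comm]
  refine Eq.trans (Finset.sum_congr rfl fun b _ => ?_) Finset.sum_comm
  have hl := secA_isLinearMap_left hf (e b) q
  have hr := isLinearMap_hessN_left hf (pf n f (e b)) (meanCurv n f) q
  exact sum_bilin_subspace (tangent n f q)
    (fun x y => ⟪secA n f x (e b) q, hessN n f (pf n f y) (pf n f (e b)) (meanCurv n f) q⟫)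
    (fun w => ⟨fun x y => by rw [hl.map_add, inner_add_left],
      fun c x => by rw [hl.map_smul, real_inner_smul_left, smul_eq_mul]⟩)
    (fun w => ⟨fun x y => by rw [hr.map_add, inner_add_right],
      fun c x => by rw [hr.map_smul, real_inner_smul_right, smul_eq_mul]⟩)
    (fun x hx y => by rw [secA_eq_zero hf hx, inner_zero_left])
    (stdOrthonormalBasis ℝ (tangent n f q)) e

theorem sum_cubic_eq_basis (q : M) : ∑ α, ∑ β, ∑ i, ∑ j, ∑ k, Hc n f q α * h n f q α i j *
      h n f q β j k * h n f q β k i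
    = ∑ a, ∑ b, ∑ c, ⟪meanCurv n f q, secA n f (e a) (e b) q⟫ *
      ⟪secA n f (e b) (e c) q, secA n f (e c) (e a) q⟫ := by
  rw [sum_cubic_eq]
  have hla : ∀ x y w, secA n f (x + y) w q = secA n f x w q + secA n f y w q := fun x y w =>
    (secA_isLinearMap_left hf w q).map_add x y
  have hls : ∀ (c : ℝ) x w, secA n f (c • x) w q = c • secA n f x w q := fun c x w =>
    (secA_isLinearMap_left hf w q).map_smul c x
  have hra : ∀ w x y, secA n f w (x + y) q = secA n f w x q + secA n f w y q := fun w x y =>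
    (secA_isLinearMap_right hf w q).map_add x y
  have hrs : ∀ (c : ℝ) w x, secA n f w (c • x) q = c • secA n f w x q := fun c w x =>
    (secA_isLinearMap_right hf w q).map_smul c x
  have h3 : ∀ v w, ∑ k, ⟪secA n f v (tvec n f q k) q, secA n f (tvec n f q k) w q⟫
      = ∑ c, ⟪secA n f v (e c) q, secA n f (e c) w q⟫ := fun v w =>
    sum_bilin_subspace (tangent n f q) (fun x y => ⟪secA n f v x q, secA n f y w q⟫)
      (fun _ => ⟨fun x y => by rw [hra, inner_add_left],
        fun c x => by rw [hrs, real_inner_smul_left, smul_eq_mul]⟩)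
      (fun _ => ⟨fun x y => by rw [hla, inner_add_right],
        fun c x => by rw [hls, real_inner_smul_right, smul_eq_mul]⟩)
      (fun x hx y => by rw [secA_symm hf, secA_eq_zero hf hx, inner_zero_left])
      (stdOrthonormalBasis ℝ (tangent n f q)) e
  have h2 : ∀ v, ∑ j, ⟪meanCurv n f q, secA n f v (tvec n f q j) q⟫ *
        ∑ c, ⟪secA n f (tvec n f q j) (e c) q, secA n f (e c) v q⟫
      = ∑ b, ⟪meanCurv n f q, secA n f v (e b) q⟫ *
        ∑ c, ⟪secA n f (e b) (e c) q, secA n f (e c) v q⟫ := fun v =>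
    sum_bilin_subspace (tangent n f q)
      (fun x y => ⟪meanCurv n f q, secA n f v x q⟫ *
        ∑ c, ⟪secA n f y (e c) q, secA n f (e c) v q⟫)
      (fun _ => ⟨fun x y => by rw [hra, inner_add_right, add_mul],
        fun c x => by rw [hrs, real_inner_smul_right, smul_eq_mul, mul_assoc]⟩)
      (fun _ => ⟨fun x y => by simp only [hla, inner_add_left, Finset.sum_add_distrib, mul_add],
        fun c x => by
          simp only [hls, real_inner_smul_left, ← Finset.mul_sum, smul_eq_mul, mul_left_comm]⟩)
      (fun x hx y => by rw [secA_symm hf, secA_eq_zero hf hx, inner_zero_right, zero_mul])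
      (stdOrthonormalBasis ℝ (tangent n f q)) e
  have h1 : ∑ i, ∑ b, ⟪meanCurv n f q, secA n f (tvec n f q i) (e b) q⟫ *
        ∑ c, ⟪secA n f (e b) (e c) q, secA n f (e c) (tvec n f q i) q⟫
      = ∑ a, ∑ b, ⟪meanCurv n f q, secA n f (e a) (e b) q⟫ *
        ∑ c, ⟪secA n f (e b) (e c) q, secA n f (e c) (e a) q⟫ :=
    sum_bilin_subspace (tangent n f q)
      (fun x y => ∑ b, ⟪meanCurv n f q, secA n f x (e b) q⟫ *
        ∑ c, ⟪secA n f (e b) (e c) q, secA n f (e c) y q⟫)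
      (fun _ => ⟨fun x y => by
          simp only [hla, inner_add_right, add_mul, Finset.sum_add_distrib],
        fun c x => by
          simp only [hls, real_inner_smul_right, mul_assoc, ← Finset.mul_sum, smul_eq_mul]⟩)
      (fun _ => ⟨fun x y => by
          simp only [hra, inner_add_right, Finset.sum_add_distrib, mul_add],
        fun c x => by
          simp only [hrs, real_inner_smul_right, ← Finset.mul_sum, smul_eq_mul, mul_left_comm _ c]⟩)
      (fun x hx y => Finset.sum_eq_zero fun b _ => by
        rw [secA_eq_zero hf hx, inner_zero_right, zero_mul])
      (stdOrthonormalBasis ℝ (tangent n f q)) e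
  simp only [← Finset.mul_sum, h3, h2, h1]

omit [IsManifold (𝓡 n) ∞ M] in
theorem normDHSq_eq_basis (q : M) : normDHSq n f q
    = ∑ a, ‖nablaN n f (pf n f (e a)) (meanCurv n f) q‖ ^ 2 := by
  rw [normDHSq_eq]
  simp only [← real_inner_self_eq_norm_sq]
  have hl := isLinearMap_nablaN_pf hf (meanCurv n f) q
  exact sum_bilin_subspace (tangent n f q)
    (fun x y => ⟪nablaN n f (pf n f x) (meanCurv n f) q, nablaN n f (pf n f y) (meanCurv n f) q⟫)
    (fun w => ⟨fun x y => by rw [hl.map_add, inner_add_left],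
      fun c x => by rw [hl.map_smul, real_inner_smul_left, smul_eq_mul]⟩)
    (fun w => ⟨fun x y => by rw [hl.map_add, inner_add_right],
      fun c x => by rw [hl.map_smul, real_inner_smul_right, smul_eq_mul]⟩)
    (fun x hx y => by
      rw [nablaN, D_pf_eq_zero hf _ hx, map_zero, inner_zero_left])
    (stdOrthonormalBasis ℝ (tangent n f q)) e

end Basis

theorem continuous_normA : Continuous (normA n f) :=
  (contMDiff_normASq hf).continuous.sqrt

/-- The gradient term is set to zero here because it need not be continuous at the zeros of `|A|`;
it is added back by `simonsRHS_eq` and treated as a bounded measurable term. -/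
theorem continuous_simonsRHS (ε C : ℝ) : Continuous fun q => simonsRHS n f ε C 0 q := by
  set e := EuclideanSpace.basisFun (Fin m) ℝ
  have hH := contMDiff_meanCurv hf
  have hA := fun v w => (contMDiff_secA hf v w).continuous
  simp only [simonsRHS, sum_h_ddH_eq_basis hf e, sum_cubic_eq_basis hf e, normDHSq_eq_basis hf e]
  refine (((continuous_const.add ?_).add ?_).sub ((continuous_normA hf).pow 4)).sub
    (continuous_const.mul ?_)
  · exact continuous_finsetSum _ fun a _ => continuous_finsetSum _ fun b _ =>
      (hA _ _).inner (contMDiff_hessN_pf hf hH _ _).continuous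
  · exact continuous_finsetSum _ fun a _ => continuous_finsetSum _ fun b _ =>
      continuous_finsetSum _ fun c _ => (hH.continuous.inner (hA _ _)).mul ((hA _ _).inner (hA _ _))
  · exact continuous_finsetSum _ fun a _ =>
      (contMDiff_nablaN hf (isTangentField_pf hf _) hH).continuous.norm.pow 2

omit hf [IsManifold (𝓡 n) ∞ M] in
theorem simonsRHS_eq (ε C g : ℝ) (q : M) :
    simonsRHS n f ε C g q = (1 + 2 / ((n : ℝ) + ε)) * g + simonsRHS n f ε C 0 q := by
  simp only [simonsRHS]
  ring

end Continuity

end FlatNormal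
end

noncomputable section

namespace FlatNormal

open scoped Topology RealInnerProductSpace

/-! ### The weak gradient of `|A|` -/

section WeakGradient

variable {n m : ℕ} {M : Type*} [TopologicalSpace M] [ChartedSpace (EuclideanSpace ℝ (Fin n)) M]
  {f : M → EuclideanSpace ℝ (Fin m)}

theorem D_sum {V : Type*} [NormedAddCommGroup V] [NormedSpace ℝ V]
    {X : M → EuclideanSpace ℝ (Fin m)} {ι : Type*} (s : Finset ι) {u : ι → M → V} {q : M}
    (hu : ∀ i, MDifferentiableAt (𝓡 n) 𝓘(ℝ, V) (u i) q) :
    MDifferentiableAt (𝓡 n) 𝓘(ℝ, V) (∑ i ∈ s, u i) q ∧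
      D n f X (∑ i ∈ s, u i) q = ∑ i ∈ s, D n f X (u i) q := by
  classical
  induction s using Finset.induction_on with
  | empty =>
    rw [Finset.sum_empty, Finset.sum_empty]
    exact ⟨mdifferentiableAt_const, D_const 0 q⟩
  | insert i s hi ih =>
    rw [Finset.sum_insert hi, Finset.sum_insert hi, D_add (hu i) ih.1, ih.2]
    exact ⟨(hu i).add ih.1, rfl⟩

theorem D_norm_sq {X s : M → EuclideanSpace ℝ (Fin m)} {q : M}
    (hs : MDifferentiableAt (𝓡 n) (𝓡 m) s q) :
    D n f X (fun q => ‖s q‖ ^ 2) q = 2 * ⟪s q, D n f X s q⟫ := by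
  have h := (hasStrictFDerivAt_norm_sq (s q)).hasFDerivAt
  refine (D_comp (g := fun v : EuclideanSpace ℝ (Fin m) => ‖v‖ ^ 2) h.differentiableAt hs).trans ?_
  rw [h.fderiv]
  simp

/-- The gradient of `|A|`, where `|A|` does not vanish, extended by `0`. -/
def gradNormA (n : ℕ) {m : ℕ} {M : Type*} [TopologicalSpace M]
    [ChartedSpace (EuclideanSpace ℝ (Fin n)) M] (f : M → EuclideanSpace ℝ (Fin m)) (q : M) :
    EuclideanSpace ℝ (Fin m) :=
  (2 * normA n f q)⁻¹ • grad n f (normASq n f) q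

/-- The sum of the `|D_k A(e_i, e_j)|^2`, which bounds `|∇|A||^2`. -/
def normDASq (n : ℕ) {m : ℕ} {M : Type*} [TopologicalSpace M]
    [ChartedSpace (EuclideanSpace ℝ (Fin n)) M] (f : M → EuclideanSpace ℝ (Fin m)) (q : M) : ℝ :=
  ∑ k, ∑ a, ∑ b, ‖D n f (pf n f (EuclideanSpace.basisFun (Fin m) ℝ k))
    (secA n f (EuclideanSpace.basisFun (Fin m) ℝ a) (EuclideanSpace.basisFun (Fin m) ℝ b)) q‖ ^ 2

theorem normDASq_nonneg (q : M) : 0 ≤ normDASq n f q := by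
  rw [normDASq]; positivity

theorem normA_sq (q : M) : normA n f q ^ 2 = normASq n f q := Real.sq_sqrt (normASq_nonneg q)

theorem normA_nonneg (q : M) : 0 ≤ normA n f q := Real.sqrt_nonneg _

theorem gradNormA_mem (q : M) : gradNormA n f q ∈ tangent n f q :=
  Submodule.smul_mem _ _ (grad_mem _ _)

theorem gradNormA_eq_zero {q : M} (hq : normA n f q = 0) : gradNormA n f q = 0 := by
  rw [gradNormA, hq, mul_zero, inv_zero, zero_smul]

variable [IsManifold (𝓡 n) ∞ M] (hf : IsSmoothImmersion n f)
include hf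

theorem continuous_normDASq : Continuous (normDASq n f) :=
  continuous_finsetSum _ fun _ _ => continuous_finsetSum _ fun _ _ => continuous_finsetSum _ fun _ _ =>
    (contMDiff_D hf (isTangentField_pf hf _) (contMDiff_secA hf _ _)).continuous.norm.pow 2

/-- `|∇|A|^2|^2 ≤ 4 |A|^2 |DA|^2`. -/
theorem norm_grad_normASq_sq_le (q : M) :
    ‖grad n f (normASq n f) q‖ ^ 2 ≤ 4 * normASq n f q * normDASq n f q := by
  set e := EuclideanSpace.basisFun (Fin m) ℝ with he
  rw [← real_inner_self_eq_norm_sq, inner_grad_grad hf, gradInner_eq hf e, normDASq, Finset.mul_sum]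
  refine Finset.sum_le_sum fun k _ => ?_
  have h1 : D n f (pf n f (e k)) (normASq n f) q
      = 2 * ∑ a, ∑ b, ⟪secA n f (e a) (e b) q, D n f (pf n f (e k)) (secA n f (e a) (e b)) q⟫ := by
    have hs : ∀ a b, MDifferentiableAt (𝓡 n) (𝓡 m) (secA n f (e a) (e b)) q := fun a b =>
      (contMDiff_secA hf _ _).contMDiffAt.mdifferentiableAt (by simp)
    have hs' : ∀ a b, MDifferentiableAt (𝓡 n) 𝓘(ℝ, ℝ) (fun q => ‖secA n f (e a) (e b) q‖ ^ 2) q :=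
      fun a b => ((contDiff_norm_sq ℝ).comp_contMDiff
        (contMDiff_secA hf _ _)).contMDiffAt.mdifferentiableAt (n := ∞) (by simp)
    rw [show normASq n f = ∑ a, ∑ b, fun q => ‖secA n f (e a) (e b) q‖ ^ 2 from
      funext fun q => by simp only [normASq_eq hf e, Finset.sum_apply],
      (D_sum _ fun a => (D_sum (f := f) (X := pf n f (e k)) Finset.univ (hs' a)).1).2, Finset.mul_sum]
    refine Finset.sum_congr rfl fun a _ => ?_
    rw [(D_sum _ (hs' a)).2, Finset.mul_sum]
    exact Finset.sum_congr rfl fun b _ => D_norm_sq (hs a b)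
  have h2 : (∑ a, ∑ b, ⟪secA n f (e a) (e b) q, D n f (pf n f (e k)) (secA n f (e a) (e b)) q⟫) ^ 2
      ≤ normASq n f q * ∑ a, ∑ b, ‖D n f (pf n f (e k)) (secA n f (e a) (e b)) q‖ ^ 2 := by
    rw [normASq_eq hf e, ← Finset.sum_product', ← Finset.sum_product', ← Finset.sum_product']
    calc _ ≤ (∑ x ∈ Finset.univ ×ˢ Finset.univ, ‖secA n f (e x.1) (e x.2) q‖ *
          ‖D n f (pf n f (e k)) (secA n f (e x.1) (e x.2)) q‖) ^ 2 := by
          refine sq_le_sq' ?_ (Finset.sum_le_sum fun x _ => real_inner_le_norm _ _)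
          rw [← Finset.sum_neg_distrib]
          exact Finset.sum_le_sum fun x _ => (abs_le.1 (abs_real_inner_le_norm _ _)).1
      _ ≤ _ := Finset.sum_mul_sq_le_sq_mul_sq _ _ _
  rw [h1]
  linarith

/-- Division of the bound on `|∇|A|²|²` by `4 |A|²`. The right-hand side is continuous across the
zeros of `|A|`, which makes the gradient locally bounded and serves as the dominating function
below. -/
theorem norm_gradNormA_sq_le (q : M) : ‖gradNormA n f q‖ ^ 2 ≤ normDASq n f q := by
  by_cases hq : normA n f q = 0
  · rw [gradNormA_eq_zero hq]
    simpa using normDASq_nonneg q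
  · have h1 := norm_grad_normASq_sq_le hf q
    have h2 : 0 < normA n f q := lt_of_le_of_ne (normA_nonneg q) (Ne.symm hq)
    rw [← normA_sq] at h1
    rw [gradNormA, norm_smul, mul_pow, Real.norm_eq_abs, sq_abs, inv_pow, inv_mul_le_iff₀ (by positivity)]
    linarith

theorem norm_gradNormA_sq {q : M} (hq : normA n f q ≠ 0) :
    ‖gradNormA n f q‖ ^ 2 = gradInner n f (normA n f) (normA n f) q := by
  rw [gradNormA, ← real_inner_self_eq_norm_sq, real_inner_smul_left, real_inner_smul_right,
    inner_grad_grad hf, gradInner_eq hf (EuclideanSpace.basisFun (Fin m) ℝ),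
    gradInner_eq hf (EuclideanSpace.basisFun (Fin m) ℝ), Finset.mul_sum, Finset.mul_sum]
  refine Finset.sum_congr rfl fun a _ => ?_
  rw [D_normA hf hq]
  ring

theorem norm_gradNormA_le (q : M) : ‖gradNormA n f q‖ ≤ √(normDASq n f q) :=
  Real.le_sqrt_of_sq_le (norm_gradNormA_sq_le hf q)

theorem contMDiff_sqrt_normASq_add {δ : ℝ} (hδ : 0 < δ) :
    ContMDiff (𝓡 n) 𝓘(ℝ, ℝ) ∞ fun q => √(normASq n f q + δ) := by
  intro q
  have h1 : normASq n f q + δ ≠ 0 := (add_pos_of_nonneg_of_pos (normASq_nonneg q) hδ).ne'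
  have h2 : ContDiffAt ℝ ∞ (fun t : ℝ => √(t + δ)) (normASq n f q) :=
    (contDiffAt_id.add contDiffAt_const).sqrt h1
  exact h2.contMDiffAt.comp q (contMDiff_normASq hf).contMDiffAt

theorem grad_sqrt_normASq_add {δ : ℝ} (hδ : 0 < δ) (q : M) :
    grad n f (fun q => √(normASq n f q + δ)) q
      = (2 * √(normASq n f q + δ))⁻¹ • grad n f (normASq n f) q := by
  have h1 : normASq n f q + δ ≠ 0 := (add_pos_of_nonneg_of_pos (normASq_nonneg q) hδ).ne'
  have h2 : HasDerivAt (fun t : ℝ => √(t + δ)) (1 / (2 * √(normASq n f q + δ))) (normASq n f q) :=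
    ((hasDerivAt_id _).add_const δ).sqrt h1
  rw [grad, grad, Finset.smul_sum]
  refine Finset.sum_congr rfl fun a _ => ?_
  rw [smul_smul]
  congr 1
  refine (D_comp (g := fun t : ℝ => √(t + δ)) h2.differentiableAt
    ((contMDiff_normASq hf).contMDiffAt.mdifferentiableAt (by simp))).trans ?_
  rw [fderiv_eq_smul_deriv, h2.deriv, smul_eq_mul, mul_comm, one_div]

variable [MeasurableSpace M] [BorelSpace M]

theorem locallyIntegrable_of_norm_le {G : Type*} [NormedAddCommGroup G] {g : M → G} {b : M → ℝ}
    (hg : AEStronglyMeasurable g (vol n f)) (hb : Continuous b) (h : ∀ q, ‖g q‖ ≤ b q) :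
    LocallyIntegrable g (vol n f) := by
  have : IsLocallyFiniteMeasure (vol n f) := isLocallyFiniteMeasure_vol hf
  refine (hb.locallyIntegrable).mono hg (Filter.Eventually.of_forall fun q => ?_)
  exact (h q).trans (le_abs_self _)

omit [IsManifold (𝓡 n) ∞ M] hf in
theorem memLinftyLoc_of_norm_le {G : Type*} [NormedAddCommGroup G] {g : M → G} {b : M → ℝ}
    (hg : AEStronglyMeasurable g (vol n f)) (hb : Continuous b) (h : ∀ q, ‖g q‖ ≤ b q)
    [T2Space M] : MemLinftyLoc n f g := by
  intro K hK
  obtain ⟨C, hC⟩ := hK.bddAbove_image hb.continuousOn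
  refine memLp_top_of_bound hg.restrict C ?_
  filter_upwards [ae_restrict_mem hK.measurableSet] with q hq
  exact (h q).trans (hC ⟨q, hq, rfl⟩)

theorem aestronglyMeasurable_gradNormA : AEStronglyMeasurable (gradNormA n f) (vol n f) :=
  ((continuous_const.mul (continuous_normA hf)).measurable.inv.aestronglyMeasurable).smul
    (isTangentField_grad hf (contMDiff_normASq hf)).1.continuous.aestronglyMeasurable

/-- All terms but the gradient are continuous; the gradient term is measurable and dominated by the
continuous `normDASq`. -/
theorem integrable_simonsRHS_gradNormA (ε C : ℝ) {φ : M → ℝ} (hφ : Continuous φ)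
    (hc : HasCompactSupport φ) :
    Integrable (fun p => simonsRHS n f ε C (‖gradNormA n f p‖ ^ 2) p * φ p) (vol n f) := by
  have h1 : Integrable (fun p => simonsRHS n f ε C 0 p * φ p) (vol n f) :=
    integrable_of_continuous hf ((continuous_simonsRHS hf ε C).mul hφ) hc.mul_left
  have h2 : Integrable (fun p => normDASq n f p * ‖φ p‖) (vol n f) :=
    integrable_of_continuous hf ((continuous_normDASq hf).mul hφ.norm) hc.norm.mul_left
  have h3 : Integrable (fun p => ‖gradNormA n f p‖ ^ 2 * φ p) (vol n f) := by
    refine h2.mono' (((aestronglyMeasurable_gradNormA hf).norm.pow 2).mul hφ.aestronglyMeasurable)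
      (Filter.Eventually.of_forall fun p => ?_)
    rw [norm_mul, Real.norm_of_nonneg (sq_nonneg _)]
    exact mul_le_mul_of_nonneg_right (norm_gradNormA_sq_le hf p) (norm_nonneg _)
  refine ((h3.const_mul (1 + 2 / ((n : ℝ) + ε))).add h1).congr
    (Filter.Eventually.of_forall fun p => ?_)
  simp only [Pi.add_apply]
  rw [simonsRHS_eq ε C (‖gradNormA n f p‖ ^ 2)]
  ring

variable [T2Space M] [SecondCountableTopology M]

/-- `|A|` has the weak gradient `∇|A|`, extended by `0` to the zeros of `|A|`. -/
theorem isWeakGradient_gradNormA : IsWeakGradient n f (normA n f) (gradNormA n f) := by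
  have hloc : IsLocallyFiniteMeasure (vol n f) := isLocallyFiniteMeasure_vol hf
  have hu := contMDiff_normASq hf
  refine ⟨(continuous_normA hf).locallyIntegrable, locallyIntegrable_of_norm_le hf
    (aestronglyMeasurable_gradNormA hf) (continuous_normDASq hf).sqrt (norm_gradNormA_le hf),
    Filter.Eventually.of_forall gradNormA_mem, fun X hX hXc => ?_⟩
  -- Regularization: `√(|A|² + δ k)` is smooth, so integration by parts holds for it, and both sides
  -- pass to the limit by dominated convergence.
  set δ : ℕ → ℝ := fun k => 1 / ((k : ℝ) + 1) with hδ
  have hδ0 : ∀ k, 0 < δ k := fun k => Nat.one_div_pos_of_nat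
  have hδ1 : ∀ k, δ k ≤ 1 := fun k => by
    rw [hδ, div_le_one (by positivity)]
    linarith [k.cast_nonneg (α := ℝ)]
  have hδt : Filter.Tendsto δ Filter.atTop (𝓝 0) := tendsto_one_div_add_atTop_nhds_zero_nat
  have hst : ∀ q, Filter.Tendsto (fun k => √(normASq n f q + δ k)) Filter.atTop (𝓝 (normA n f q)) := by
    intro q
    have h := (hδt.const_add (normASq n f q)).sqrt
    rwa [add_zero] at h
  have hdivc := (contMDiff_divergence hf hX.1).continuous
  have hgX : Continuous fun q => ⟪grad n f (normASq n f) q, X q⟫ :=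
    (isTangentField_grad hf hu).1.continuous.inner hX.1.continuous
  have h1 : Filter.Tendsto (fun k => ∫ q, √(normASq n f q + δ k) * divergence n f X q ∂(vol n f))
      Filter.atTop (𝓝 (∫ q, normA n f q * divergence n f X q ∂(vol n f))) := by
    refine tendsto_integral_of_dominated_convergence
      (fun q => √(normASq n f q + 1) * ‖divergence n f X q‖) (fun k => ?_) ?_ (fun k => ?_) ?_
    · exact ((contMDiff_sqrt_normASq_add hf (hδ0 k)).continuous.mul hdivc).aestronglyMeasurable
    · exact integrable_of_continuous hf
        ((contMDiff_sqrt_normASq_add hf one_pos).continuous.mul hdivc.norm)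
        (hasCompactSupport_divergence hf hXc).norm.mul_left
    · refine Filter.Eventually.of_forall fun q => ?_
      rw [norm_mul, Real.norm_of_nonneg (Real.sqrt_nonneg _)]
      gcongr
      exact hδ1 k
    · exact Filter.Eventually.of_forall fun q => (hst q).mul_const _
  have h2 : Filter.Tendsto
      (fun k => ∫ q, ⟪grad n f (fun q => √(normASq n f q + δ k)) q, X q⟫ ∂(vol n f))
      Filter.atTop (𝓝 (∫ q, ⟪gradNormA n f q, X q⟫ ∂(vol n f))) := by
    refine tendsto_integral_of_dominated_convergence
      (fun q => √(normDASq n f q) * ‖X q‖) (fun k => ?_) ?_ (fun k => ?_) ?_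
    · exact ((isTangentField_grad hf
        (contMDiff_sqrt_normASq_add hf (hδ0 k))).1.continuous.inner hX.1.continuous).aestronglyMeasurable
    · exact integrable_of_continuous hf ((continuous_normDASq hf).sqrt.mul hX.1.continuous.norm)
        hXc.norm.mul_left
    · refine Filter.Eventually.of_forall fun q => ?_
      refine (norm_inner_le_norm _ _).trans ?_
      gcongr
      -- Adding `δ k` under the root only enlarges the denominator, so the regularized gradient is
      -- no longer than `gradNormA`. At the zeros of `|A|` the gradient of `|A|²` vanishes and both
      -- sides are zero.
      refine le_trans ?_ (norm_gradNormA_le hf q)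
      rw [grad_sqrt_normASq_add hf (hδ0 k), gradNormA, norm_smul, norm_smul]
      by_cases hq : normA n f q = 0
      · have h0 : grad n f (normASq n f) q = 0 := by
          have h := norm_grad_normASq_sq_le hf q
          rw [← normA_sq, hq] at h
          have h' : ‖grad n f (normASq n f) q‖ ^ 2 ≤ 0 := by simpa using h
          exact norm_eq_zero.1 (pow_eq_zero_iff two_ne_zero |>.1 (le_antisymm h' (sq_nonneg _)))
        simp [h0]
      · have h3 : 0 < normA n f q := lt_of_le_of_ne (normA_nonneg q) (Ne.symm hq)
        rw [Real.norm_of_nonneg (by positivity), Real.norm_of_nonneg (by positivity)]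
        gcongr
        exact Real.sqrt_le_sqrt (by linarith [hδ0 k])
    · refine Filter.Eventually.of_forall fun q => ?_
      simp only [grad_sqrt_normASq_add hf (hδ0 _), gradNormA]
      refine Filter.Tendsto.inner ?_ tendsto_const_nhds
      by_cases hq : normA n f q = 0
      · have h0 : grad n f (normASq n f) q = 0 := by
          have h := norm_grad_normASq_sq_le hf q
          rw [← normA_sq, hq] at h
          have h' : ‖grad n f (normASq n f) q‖ ^ 2 ≤ 0 := by simpa using h
          exact norm_eq_zero.1 (pow_eq_zero_iff two_ne_zero |>.1 (le_antisymm h' (sq_nonneg _)))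
        simp [h0]
      · exact (((hst q).const_mul 2).inv₀ (mul_ne_zero two_ne_zero hq)).smul_const _
  refine tendsto_nhds_unique h1 (h2.neg.congr fun k => ?_)
  exact (integral_mul_divergence hf (contMDiff_sqrt_normASq_add hf (hδ0 k)) hX hXc).symm

theorem memW1inftyLoc_normA : MemW1inftyLoc n f (normA n f) := by
  refine ⟨memLinftyLoc_of_norm_le (continuous_normA hf).aestronglyMeasurable (continuous_normA hf)
    fun q => (Real.norm_of_nonneg (normA_nonneg q)).le, gradNormA n f, isWeakGradient_gradNormA hf, ?_⟩
  exact memLinftyLoc_of_norm_le (aestronglyMeasurable_gradNormA hf)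
    (continuous_normDASq hf).sqrt (norm_gradNormA_le hf)

/-- Weak gradients are unique. -/
theorem IsWeakGradient.ae_eq {u : M → ℝ} {V W : M → EuclideanSpace ℝ (Fin m)}
    (hV : IsWeakGradient n f u V) (hW : IsWeakGradient n f u W) : V =ᵐ[vol n f] W := by
  have : LocallyCompactSpace M := Manifold.locallyCompact_of_finiteDimensional (𝓡 n)
  have hloc : IsLocallyFiniteMeasure (vol n f) := isLocallyFiniteMeasure_vol hf
  -- Testing with `φ` times the projection of a constant vector `v` recovers `⟨v, ∫ φ V⟩`, because
  -- `V` is tangent almost everywhere. The right-hand side does not involve `V`, so `∫ φ V` is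
  -- determined by `u`.
  have key : ∀ {V : M → EuclideanSpace ℝ (Fin m)}, IsWeakGradient n f u V →
      ∀ φ : M → ℝ, ContMDiff (𝓡 n) 𝓘(ℝ, ℝ) ∞ φ → HasCompactSupport φ →
      ∀ v, ⟪v, ∫ q, φ q • V q ∂(vol n f)⟫
        = -∫ q, u q * divergence n f (fun q => φ q • pf n f v q) q ∂(vol n f) := by
    intro V hV φ hφ hc v
    rw [hV.2.2.2 _ ((isTangentField_pf hf v).smul hφ) (hc.smul_right (f' := pf n f v)), neg_neg,
      ← integral_inner (hV.2.1.integrable_smul_left_of_hasCompactSupport hφ.continuous hc)]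
    refine integral_congr_ae ?_
    filter_upwards [hV.2.2.1] with q hq
    rw [real_inner_smul_right, real_inner_smul_right, real_inner_comm, pf,
      ← Submodule.inner_starProjection_left_eq_right, Submodule.starProjection_eq_self_iff.2 hq]
  have h1 : ∀ᵐ q ∂(vol n f), V q - W q = 0 := by
    refine ae_eq_zero_of_integral_contMDiff_smul_eq_zero (𝓡 n) (hV.2.1.sub hW.2.1) fun φ hφ hc => ?_
    simp only [smul_sub]
    rw [integral_sub (hV.2.1.integrable_smul_left_of_hasCompactSupport hφ.continuous hc)
      (hW.2.1.integrable_smul_left_of_hasCompactSupport hφ.continuous hc), sub_eq_zero]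
    refine ext_inner_left ℝ fun v => ?_
    rw [key hV φ hφ hc, key hW φ hφ hc]
  filter_upwards [h1] with q hq
  exact sub_eq_zero.1 hq

end WeakGradient

end FlatNormal
end

open FlatNormal in
theorem mainTheorem4 (n : ℕ) (ε : ℝ) (hε : 0 < ε) :
    ∃ C : ℝ, ∀ (m : ℕ) (M : Type*) [TopologicalSpace M] [T2Space M] [SecondCountableTopology M]
      [ChartedSpace (EuclideanSpace ℝ (Fin n)) M] [IsManifold (𝓡 n) ∞ M]
      [MeasurableSpace M] [BorelSpace M] (f : M → EuclideanSpace ℝ (Fin m)),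
      IsSmoothImmersion n f → HasFlatNormalBundle n f →
      -- the inequality holds classically wherever `|A|` does not vanish
      (∀ p : M, normA n f p ≠ 0 →
        simonsRHS n f ε C (gradInner n f (normA n f) (normA n f) p) p
          ≤ 1 / 2 * laplacian n f (normASq n f) p) ∧
      -- it holds on all of `M` in the weak sense, for the weak gradient `V` of `|A|`
      MemW1inftyLoc n f (normA n f) ∧
      ∀ V : M → EuclideanSpace ℝ (Fin m), IsWeakGradient n f (normA n f) V →
        ∀ φ : M → ℝ, ContMDiff (𝓡 n) 𝓘(ℝ, ℝ) ∞ φ → HasCompactSupport φ → (∀ p, 0 ≤ φ p) →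
          Integrable (fun p => gradInner n f (normASq n f) φ p) (vol n f) ∧
          Integrable (fun p => simonsRHS n f ε C (‖V p‖ ^ 2) p * φ p) (vol n f) ∧
          ∫ p, simonsRHS n f ε C (‖V p‖ ^ 2) p * φ p ∂(vol n f)
            ≤ -(1 / 2 * ∫ p, gradInner n f (normASq n f) φ p ∂(vol n f)) := by
  refine ⟨katoConst n ε, fun m M _ _ _ _ _ _ _ f hf hflat => ⟨fun p hp =>
    simonsRHS_le_laplacian hf hflat hε p (fun _ => rfl) (fun h => absurd h hp),
    memW1inftyLoc_normA hf, fun V hV φ hφ hc hφ0 => ?_⟩⟩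
  have hu := contMDiff_normASq hf
  -- By uniqueness any weak gradient may be replaced by the explicit one, for which the inequality
  -- is available at every point.
  have hVW := hV.ae_eq hf (isWeakGradient_gradNormA hf)
  -- The zeros of `|A|` are included: there the gradient term is zero, so no assumption about their
  -- measure is needed.
  have hle : ∀ p, simonsRHS n f ε (katoConst n ε) (‖gradNormA n f p‖ ^ 2) p
      ≤ 1 / 2 * laplacian n f (normASq n f) p := fun p =>
    simonsRHS_le_laplacian hf hflat hε p (norm_gradNormA_sq hf)
      (fun h => by simp [gradNormA_eq_zero h])
  have hint := integrable_simonsRHS_gradNormA hf ε (katoConst n ε) hφ.continuous hc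
  have hcongr : (fun p => simonsRHS n f ε (katoConst n ε) (‖V p‖ ^ 2) p * φ p) =ᵐ[vol n f]
      fun p => simonsRHS n f ε (katoConst n ε) (‖gradNormA n f p‖ ^ 2) p * φ p := by
    filter_upwards [hVW] with p hp
    rw [hp]
  refine ⟨integrable_of_continuous hf (contMDiff_gradInner hf hu hφ).continuous
    (hasCompactSupport_gradInner hf hc), hint.congr hcongr.symm, ?_⟩
  rw [integral_congr_ae hcongr]
  have hlap : Integrable (fun p => 1 / 2 * (laplacian n f (normASq n f) p * φ p)) (vol n f) :=
    (integrable_of_continuous hf ((contMDiff_laplacian hf hu).continuous.mul hφ.continuous)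
      hc.mul_left).const_mul _
  calc _ ≤ ∫ p, 1 / 2 * (laplacian n f (normASq n f) p * φ p) ∂(vol n f) :=
        integral_mono hint hlap fun p => by
          simpa only [mul_assoc] using mul_le_mul_of_nonneg_right (hle p) (hφ0 p)
    _ = _ := by
        rw [integral_const_mul, integral_laplacian_mul hf hu hφ hc]
        ring
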